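/- **Setting.** Let $R=\{A_1,\dots,A_n\}$ be a finite set of attributes. Each $A_i$ has a finite domain $\mathrm{Dom}(A_i)$ consisting of the null symbol $*$ and at least two non-null values. A *tuple* $t$ assigns to each $A_i$ an element of $\mathrm{Dom}(A_i)$, it is *complete* if it contains no $*$, and $t(X)$ is its restriction to $X\subseteq R$. A *relation* $r$ is a finite multiset of tuples, and $r(X)$ is the multiset of the restrictions $t(X)$, $t\in r$. A *grounding* of $r$ is obtained by replacing the nulls by non-null values of the respective domains, in each copy of each tuple independently. For $X,Y\subseteq R$: * $r\models X\perp Y$ (independence atom, IA) iff $r(X\cup Y)$ contains only complete tuples and for all $t_1,t_2\in r$ there is $t\in r$ with $t(X)=t_1(X)$ and $t(Y)=t_2(Y)$; * $r\models X\perp_c Y$ (certain independence atom, CIA) iff $r'\models X\perp Y$ for every grounding $r'$ of $r$. A relation $r$ is viewed as the first-order structure $\mathfrak A_r=(U,f,D_1,\dots,D_n,0,*)$, where $D_i=\mathrm{Dom}(A_i)$, $m$ is the largest multiplicity of a tuple in $r$, $U$ is the disjoint union of $\{*\}\cup D_1\cup\dots\cup D_n$ and $\{0,\dots,m\}$, and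 $f:U^n\to\{0,\dots,m\}$ gives the multiplicity of its argument in $r$ ($0$ if it is not a tuple of $r$). A property of relations over $n$ attributes is *in FO* if there is one first-order sentence $\varphi$ such that, for every choice of domains and every relation $r$, $\mathfrak A_r\models\varphi$ iff $r$ has the property. **Theorem.** 1. $r\models X\perp_c Y$ if and only if at least one of the following holds: (i) $r\models X\perp_c X$; (ii) $r\models Y\perp_c Y$; (iii) for all complete $t\in r(X)$ and $t'\in r(Y)$ there is $t''\in r$ with $t''(X)=t$ and $t''(Y)=t'$; and every tuple of every grounding of $r(X\cup Y)$ occurs in $r(X\cup Y)$ (multiplicities are disregarded). 2. The data complexity problem for IAs and CIAs is in FO: for each $n$ and all fixed $X,Y\subseteq R$, the property $r\models X\perp Y$ is in FO, and the property $r\models X\perp_c Y$ is in FO. 3. The combined complexity problem for CIAs is in polynomial time: there is a Turing machine that, given $R$, the domains, a relation $r$ as a list of distinct tuples with their multiplicities, and $X,Y\subseteq R$, decides whether $r\models X\perp_c Y$ in time polynomial in the length of the input. This holds if multiplicities are written in unary and if they are written in binary. -/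

import Mathlib

universe u v

namespace IncompleteRel

/-- A relation schema on the attributes `ι`: each attribute has a finite domain. `dom i` is the set
of *non-null* values of attribute `i`; there are always at least two of them. The null symbol `*`
is `none`, so the full domain of attribute `i` is `dom i` together with `none`. -/
structure Schema (ι : Type v) (V : Type u) where
  dom : ι → Finset V
  two_le_card : ∀ i, 2 ≤ (dom i).card

/-- Tuples, possibly with nulls. That entries lie in the domains is `Schema.IsRelation`. -/
abbrev Tuple (ι : Type v) (V : Type u) := ι → Option V

section Semantics

variable {ι : Type v} {V : Type u}

/-- The tuple contains no null. -/
def Tuple.IsComplete (t : Tuple ι V) : Prop := ∀ i, t i ≠ none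

/-- The finite multiset `r` of tuples is a relation over the schema `S`. -/
def Schema.IsRelation (S : Schema ι V) (r : Multiset (Tuple ι V)) : Prop :=
  ∀ t ∈ r, ∀ i a, t i = some a → a ∈ S.dom i

/-- The schema on the attributes in `X`. -/
def Schema.restrict (S : Schema ι V) (X : Finset ι) : Schema X V where
  dom i := S.dom i
  two_le_card i := S.two_le_card i

/-- The restriction `t(X)` of a tuple. -/
def Tuple.proj (X : Finset ι) (t : Tuple ι V) : Tuple X V := fun i => t i

/-- The projection `r(X)` of a relation, as a multiset. -/
def proj (X : Finset ι) (r : Multiset (Tuple ι V)) : Multiset (Tuple X V) :=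
  r.map (Tuple.proj X)

/-- `t'` is a grounding of the tuple `t`: nulls are replaced by non-null values of the respective
domains, everything else is kept. -/
def Schema.TupleGrounding (S : Schema ι V) (t t' : Tuple ι V) : Prop :=
  ∀ i, ∃ a ∈ S.dom i, t' i = some a ∧ (t i = none ∨ t i = some a)

/-- `r'` is a grounding of the relation `r`: each copy of each tuple is grounded independently. -/
def Schema.Grounding (S : Schema ι V) (r r' : Multiset (Tuple ι V)) : Prop :=
  Multiset.Rel S.TupleGrounding r r'

/-- Satisfaction of the independence atom `X ⊥ Y`. -/
def SatIA [DecidableEq ι] (X Y : Finset ι) (r : Multiset (Tuple ι V)) : Prop :=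
  (∀ t ∈ proj (X ∪ Y) r, t.IsComplete) ∧
    ∀ t₁ ∈ r, ∀ t₂ ∈ r, ∃ t ∈ r, t.proj X = t₁.proj X ∧ t.proj Y = t₂.proj Y

/-- Satisfaction of the certain independence atom `X ⊥_c Y`. -/
def Schema.SatCIA [DecidableEq ι] (S : Schema ι V) (X Y : Finset ι)
    (r : Multiset (Tuple ι V)) : Prop :=
  ∀ r', S.Grounding r r' → SatIA X Y r'

end Semantics

section FirstOrderPart

open FirstOrder

/-- Function symbols: the `n`-ary multiplicity function `f` and the constants `0` and `*`. -/
inductive RelFunctions (n : ℕ) : ℕ → Type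
  | mult : RelFunctions n n
  | zero : RelFunctions n 0
  | null : RelFunctions n 0

/-- Relation symbols: a unary predicate `D i` for the domain of each attribute. -/
inductive RelPredicates (n : ℕ) : ℕ → Type
  | dom (i : Fin n) : RelPredicates n 1

/-- The vocabulary of relations over `n` attributes. -/
def relLanguage (n : ℕ) : Language := ⟨RelFunctions n, RelPredicates n⟩

variable {n : ℕ} {V : Type u}

open Classical in
/-- The largest multiplicity of a tuple in `r` (zero if `r` is empty). -/
noncomputable def maxMult (r : Multiset (Tuple (Fin n) V)) : ℕ :=
  r.toFinset.sup fun t => r.count t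

/-- The elements of the domains `D i`: the null symbol and the values of the attributes. -/
def Symbol (S : Schema (Fin n) V) : Type u :=
  {a : Option V // a = none ∨ ∃ i, ∃ b ∈ S.dom i, a = some b}

/-- The universe: the union of the domains, and (disjointly) the numbers `0, …, m` where `m` is
the largest multiplicity. -/
def RelUniverse (S : Schema (Fin n) V) (r : Multiset (Tuple (Fin n) V)) : Type u :=
  Symbol S ⊕ {k : ℕ // k ≤ maxMult r}

/-- The sequence `x` of elements of the universe is the tuple `t`. -/
def IsTuple {S : Schema (Fin n) V} {r : Multiset (Tuple (Fin n) V)}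
    (x : Fin n → RelUniverse S r) (t : Tuple (Fin n) V) : Prop :=
  ∀ i, ∃ a : Symbol S, x i = Sum.inl a ∧ t i = a.1

open Classical in
/-- The multiplicity in `r` of a sequence of elements of the universe
(zero if the sequence is not a tuple in `r`). -/
noncomputable def multOf {S : Schema (Fin n) V} {r : Multiset (Tuple (Fin n) V)}
    (x : Fin n → RelUniverse S r) : ℕ :=
  r.countP fun t => IsTuple x t

theorem multOf_le {S : Schema (Fin n) V} {r : Multiset (Tuple (Fin n) V)}
    (x : Fin n → RelUniverse S r) : multOf x ≤ maxMult r := by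
  classical
  by_cases h : ∃ t ∈ r, IsTuple x t
  · obtain ⟨t, ht, hx⟩ := h
    have huniq : ∀ s, IsTuple x s ↔ t = s := by
      intro s
      constructor
      · intro hs
        funext i
        obtain ⟨a, ha, hta⟩ := hx i
        obtain ⟨b, hb, hsb⟩ := hs i
        rw [ha] at hb
        rw [hta, hsb, Sum.inl.inj hb]
      · rintro rfl
        exact hx
    have h1 : multOf x = r.count t := by
      unfold multOf Multiset.count
      exact Multiset.countP_congr rfl (fun s _ => propext (huniq s))
    rw [h1]
    exact Finset.le_sup (f := fun t => r.count t) (Multiset.mem_toFinset.2 ht)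
  · have h0 : multOf x = 0 := by
      unfold multOf
      rw [Multiset.countP_eq_zero]
      intro t ht hx
      exact h ⟨t, ht, hx⟩
    omega

/-- The first-order structure `(U, f, D₁, …, Dₙ, 0, *)` of a relation. -/
noncomputable abbrev relStructure (S : Schema (Fin n) V) (r : Multiset (Tuple (Fin n) V)) :
    (relLanguage n).Structure (RelUniverse S r) where
  funMap f x := match f with
    | .mult => Sum.inr ⟨multOf x, multOf_le x⟩
    | .zero => Sum.inr ⟨0, Nat.zero_le _⟩
    | .null => Sum.inl ⟨none, Or.inl rfl⟩
  RelMap R x := match R with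
    | .dom i => ∃ a : Symbol S, x 0 = Sum.inl a ∧
        (a.1 = none ∨ ∃ b ∈ S.dom i, a.1 = some b)

/-- A property `Q` of relations over `n` attributes (with arbitrary finite domains) is in `FO`:
one first-order sentence defines it in the structures of all relations. -/
def InFO (Q : ∀ {V : Type u}, Schema (Fin n) V → Multiset (Tuple (Fin n) V) → Prop) : Prop :=
  ∃ φ : (relLanguage n).Sentence,
    ∀ (V : Type u) (S : Schema (Fin n) V) (r : Multiset (Tuple (Fin n) V)), S.IsRelation r →
      (@Language.Sentence.Realize (relLanguage n) (RelUniverse S r) (relStructure S r) φ ↔ Q S r)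

end FirstOrderPart

section CombinedComplexity

open Computability

/-- An input of the combined complexity problem for certain independence: the number `n` of
attributes, for each attribute a list of its non-null values (values are natural numbers), a
relation given as a list of distinct tuples with their multiplicities, and the atom `X ⊥_c Y`. -/
structure CIAInput where
  n : ℕ
  dom : Fin n → List ℕ
  dom_nodup : ∀ i, (dom i).Nodup
  two_le_dom : ∀ i, 2 ≤ (dom i).length
  rows : List (Tuple (Fin n) ℕ × ℕ)
  rows_nodup : (rows.map Prod.fst).Nodup
  mult_pos : ∀ p ∈ rows, 0 < p.2
  mem_dom : ∀ p ∈ rows, ∀ i a, p.1 i = some a → a ∈ dom i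
  X : Finset (Fin n)
  Y : Finset (Fin n)

/-- The schema given by the input. -/
def CIAInput.schema (I : CIAInput) : Schema (Fin I.n) ℕ where
  dom i := (I.dom i).toFinset
  two_le_card i := by
    rw [List.toFinset_card_of_nodup (I.dom_nodup i)]
    exact I.two_le_dom i

/-- The relation given by the input. -/
def CIAInput.relation (I : CIAInput) : Multiset (Tuple (Fin I.n) ℕ) :=
  (I.rows.map fun p => Multiset.replicate p.2 p.1).sum

open Classical in
/-- The answer to the input. -/
noncomputable def CIAInput.answer (I : CIAInput) : Bool :=
  decide (I.schema.SatCIA I.X I.Y I.relation)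

/-- How multiplicities are written. -/
inductive MultCode
  | unary
  | binary

def MultCode.encode : MultCode → ℕ → List Γ'
  | .unary, k => List.replicate k (Γ'.bit true)
  | .binary, k => (encodeNat k).map Γ'.bit

/-- The null is written as a blank symbol, a value in binary. -/
def encodeEntry : Option ℕ → List Γ'
  | none => [Γ'.blank]
  | some a => (encodeNat a).map Γ'.bit

/-- An attribute set is written as its characteristic vector. -/
def encodeAttrs {n : ℕ} (X : Finset (Fin n)) : List Γ' :=
  List.ofFn fun i => Γ'.bit (decide (i ∈ X))

/-- The string for an input: `X` and `Y`, the domains, and the rows with their multiplicities. Each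
component stands between brackets; values and row entries are terminated by commas. -/
def CIAInput.encode (c : MultCode) (I : CIAInput) : List Γ' :=
  [Γ'.bra] ++ encodeAttrs I.X ++ [Γ'.ket] ++
  [Γ'.bra] ++ encodeAttrs I.Y ++ [Γ'.ket] ++
  ((List.ofFn I.dom).flatMap fun d =>
    [Γ'.bra] ++ (d.flatMap fun a => encodeEntry (some a) ++ [Γ'.comma]) ++ [Γ'.ket]) ++
  [Γ'.comma] ++
  (I.rows.flatMap fun p =>
    [Γ'.bra] ++ ((List.ofFn p.1).flatMap fun e => encodeEntry e ++ [Γ'.comma]) ++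
      c.encode p.2 ++ [Γ'.ket])

end CombinedComplexity

end IncompleteRel

/-! Tuples of groundings are complete, so `X ⊥_c Y` says only that every grounding recombines any
`X`-part with any `Y`-part. Alternatives (i) and (ii) amount to `ConstOn`: at most one tuple, or one
complete value throughout. Alternative (iii) suffices because on `X ∪ Y` every tuple of a grounding
occurs, complete, in `r`, and the recombination found in `r` survives grounding.

The substance is necessity, in `Schema.SatCIA.eq_of_missing`. Suppose that `s` has a null at `a ∈ X`
and that some grounding `s₀` of `s` is missing from `r` on `X ∪ Y`. Ground all other tuples with
values that avoid those of `s₀`, so that none of them becomes `s₀` on `X ∪ Y`, and ground `s` once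
to `s₀` and once to `s₁`, which differs from `s₀` at `a` only. Let another tuple `u` differ from
`s₀` on `Y`. If `a ∈ Y`, the two groundings demand different values of `u` at `a`. If `a ∉ Y`,
recombining `s₀` with `u` yields a tuple other than `s₀` with the `X`-part of `s₀`; it is also
present in the second grounding, where its recombination with `s₁` would be `s₀` on `X ∪ Y`, which
is absent. So all other tuples equal `s₀` on `Y`, and this forces `ConstOn Y`.

For fixed `X` and `Y` the resulting conditions quantify over tuples of elements of the universe
only, so they are first-order. That `r` has at most one tuple is expressed by saying that all rows
coincide and that each number in the universe is `0` or the multiplicity of the row.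

In combined complexity the number of attributes varies, and a grounding of a tuple is no longer
something to quantify over. `Schema.containsGroundings_iff_step` replaces closure under all
groundings by the existence of one complete version and closure under changing the value of one
null. Its quantifiers range over rows, attributes and values, that is, over positions of the input
word. The characterisation thus becomes a sentence of first-order logic with counting on words
(`SatCIAWord`), where counting matches the fields of a row with the attributes. A sentence is
compiled to a stack machine that runs a head over the word for each bound variable; the nesting is
fixed, so the time is polynomial (`WordFormula.reachesIn_code`). Multiplicities matter only through
being `1`, which in unary and in binary means a code of length one. -/

open Turing

namespace IncompleteRel

/-! ### The characterisation of certain independence. -/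

section Characterisation

variable {ι : Type v} {V : Type u}

theorem eq_of_mem_of_card_le_one {α : Type*} {r : Multiset α} (h : r.card ≤ 1) {a b : α}
    (ha : a ∈ r) (hb : b ∈ r) : a = b := by
  obtain ⟨r', rfl⟩ := Multiset.exists_cons_of_mem ha
  have h0 : r' = 0 := by
    rw [← Multiset.card_eq_zero]
    simpa using h
  subst h0
  exact ((Multiset.mem_cons.1 hb).resolve_right (Multiset.notMem_zero b)).symm

theorem Tuple.proj_eq_iff {X : Finset ι} {t u : Tuple ι V} :
    t.proj X = u.proj X ↔ ∀ i ∈ X, t i = u i :=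
  ⟨fun h i hi => congrFun h ⟨i, hi⟩, fun h => funext fun i => h i i.2⟩

/-- The tuple `t` with its nulls filled in from `c`. -/
def Tuple.fill (t : Tuple ι V) (c : ι → V) : Tuple ι V := fun i => some ((t i).getD (c i))

theorem Tuple.fill_of_ne_none {t : Tuple ι V} {c : ι → V} {i : ι} (h : t i ≠ none) :
    t.fill c i = t i := by
  obtain ⟨a, ha⟩ := Option.ne_none_iff_exists'.1 h
  simp [Tuple.fill, ha]

theorem Tuple.fill_of_eq_none {t : Tuple ι V} {c : ι → V} {i : ι} (h : t i = none) :
    t.fill c i = some (c i) := by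
  simp [Tuple.fill, h]

theorem Schema.tupleGrounding_fill {S : Schema ι V} {t : Tuple ι V} {c : ι → V}
    (ht : ∀ i a, t i = some a → a ∈ S.dom i) (hc : ∀ i, c i ∈ S.dom i) :
    S.TupleGrounding t (t.fill c) := by
  intro i
  cases h : t i with
  | none => exact ⟨c i, hc i, Tuple.fill_of_eq_none h, Or.inl rfl⟩
  | some a => exact ⟨a, ht i a h, by simp [Tuple.fill, h], Or.inr rfl⟩

theorem Schema.TupleGrounding.eq_of_ne_none {S : Schema ι V} {t t' : Tuple ι V}
    (h : S.TupleGrounding t t') {i : ι} (hi : t i ≠ none) : t' i = t i := by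
  obtain ⟨a, -, h1, h2⟩ := h i
  rw [h1, h2.resolve_left hi]

theorem Schema.TupleGrounding.ne_none {S : Schema ι V} {t t' : Tuple ι V}
    (h : S.TupleGrounding t t') (i : ι) : t' i ≠ none := by
  obtain ⟨a, -, h1, -⟩ := h i
  simp [h1]

theorem Schema.IsRelation.grounding_map_fill {S : Schema ι V} {r : Multiset (Tuple ι V)}
    (hr : S.IsRelation r) {c : ι → V} (hc : ∀ i, c i ∈ S.dom i) :
    S.Grounding r (r.map fun t => t.fill c) := by
  unfold Schema.Grounding
  rw [Multiset.rel_map_right]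
  exact Multiset.rel_refl_of_refl_on fun t ht => S.tupleGrounding_fill (hr t ht) hc

theorem Schema.exists_ne (S : Schema ι V) (i : ι) (a : Option V) :
    ∃ b ∈ S.dom i, some b ≠ a := by
  cases a with
  | none =>
    obtain ⟨b, hb⟩ := Finset.card_pos.1 (by have := S.two_le_card i; omega : 0 < (S.dom i).card)
    exact ⟨b, hb, by simp⟩
  | some a =>
    obtain ⟨b, hb, hne⟩ := Finset.exists_mem_ne
      (by have := S.two_le_card i; omega : 1 < (S.dom i).card) a
    exact ⟨b, hb, by simpa using hne⟩

/-- A choice of domain values, none of which is the value of `t`. -/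
theorem Schema.exists_avoid (S : Schema ι V) (t : Tuple ι V) :
    ∃ c : ι → V, (∀ i, c i ∈ S.dom i) ∧ ∀ i, some (c i) ≠ t i := by
  choose c h1 h2 using fun i => S.exists_ne i (t i)
  exact ⟨c, h1, h2⟩

theorem Schema.exists_mem_of_grounding {S : Schema ι V} {r g : Multiset (Tuple ι V)}
    (h : S.Grounding r g) {s : Tuple ι V} (hs : s ∈ g) : ∃ t ∈ r, S.TupleGrounding t s :=
  Multiset.exists_mem_of_rel_of_mem (Multiset.rel_flip.2 h) hs

theorem Schema.exists_grounding_mem {S : Schema ι V} {r g : Multiset (Tuple ι V)}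
    (h : S.Grounding r g) {t : Tuple ι V} (ht : t ∈ r) : ∃ s ∈ g, S.TupleGrounding t s :=
  Multiset.exists_mem_of_rel_of_mem h ht

/-- Every two tuples can be recombined to one with the `X`-part of the first and the `Y`-part of
the second. -/
def Recombines (X Y : Finset ι) (r : Multiset (Tuple ι V)) : Prop :=
  ∀ t₁ ∈ r, ∀ t₂ ∈ r, ∃ t ∈ r, (∀ i ∈ X, t i = t₁ i) ∧ ∀ i ∈ Y, t i = t₂ i

theorem Recombines.symm {X Y : Finset ι} {r : Multiset (Tuple ι V)} (h : Recombines X Y r) :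
    Recombines Y X r := fun t₁ h₁ t₂ h₂ =>
  let ⟨t, ht, h3, h4⟩ := h t₂ h₂ t₁ h₁
  ⟨t, ht, h4, h3⟩

variable [DecidableEq ι]

omit [DecidableEq ι] in
theorem isComplete_proj_iff {X : Finset ι} {t : Tuple ι V} :
    (t.proj X).IsComplete ↔ ∀ i ∈ X, t i ≠ none :=
  ⟨fun h i hi => h ⟨i, hi⟩, fun h i => h i i.2⟩

theorem satIA_iff {X Y : Finset ι} {r : Multiset (Tuple ι V)} :
    SatIA X Y r ↔ (∀ t ∈ r, ∀ i ∈ X ∪ Y, t i ≠ none) ∧ Recombines X Y r := by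
  simp only [SatIA, proj, Multiset.mem_map, forall_exists_index, and_imp,
    forall_apply_eq_imp_iff₂, isComplete_proj_iff, Tuple.proj_eq_iff, Recombines]

/-- A grounding has no nulls, so the completeness half of an independence atom is automatic. -/
theorem Schema.satCIA_iff_recombines {S : Schema ι V} {X Y : Finset ι}
    {r : Multiset (Tuple ι V)} :
    S.SatCIA X Y r ↔ ∀ g, S.Grounding r g → Recombines X Y g := by
  refine forall₂_congr fun g hg => ?_
  rw [satIA_iff, and_iff_right]
  intro t ht i _
  obtain ⟨s, -, hs⟩ := S.exists_mem_of_grounding hg ht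
  exact hs.ne_none i

/-- The relation has at most one tuple, or its tuples are complete on `X` and agree there. -/
def ConstOn (X : Finset ι) (r : Multiset (Tuple ι V)) : Prop :=
  r.card ≤ 1 ∨ ∀ t ∈ r, ∀ t' ∈ r, ∀ i ∈ X, t i ≠ none ∧ t i = t' i

/-- Complete `X`-values and complete `Y`-values can be recombined. -/
def Combines (X Y : Finset ι) (r : Multiset (Tuple ι V)) : Prop :=
  ∀ t ∈ r, (∀ i ∈ X, t i ≠ none) → ∀ t' ∈ r, (∀ i ∈ Y, t' i ≠ none) →
    ∃ u ∈ r, (∀ i ∈ X, u i = t i) ∧ ∀ i ∈ Y, u i = t' i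

/-- On `Z`, the relation contains all groundings of its tuples. -/
def Schema.ContainsGroundings (S : Schema ι V) (Z : Finset ι) (r : Multiset (Tuple ι V)) : Prop :=
  ∀ t ∈ r, ∀ s : ι → V, (∀ i ∈ Z, s i ∈ S.dom i ∧ (t i = none ∨ t i = some (s i))) →
    ∃ u ∈ r, ∀ i ∈ Z, u i = some (s i)

/-- Grounding does not touch a complete constant `X`-part and preserves cardinality, so the second
tuple is itself the recombination. -/
theorem Schema.satCIA_of_constOn {S : Schema ι V} {X Y : Finset ι} {r : Multiset (Tuple ι V)}
    (h : ConstOn X r) : S.SatCIA X Y r := by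
  rw [Schema.satCIA_iff_recombines]
  intro g hg t₁ h₁ t₂ h₂
  refine ⟨t₂, h₂, fun i hi => ?_, fun i _ => rfl⟩
  rcases h with h | h
  · rw [Multiset.card_eq_card_of_rel hg] at h
    rw [eq_of_mem_of_card_le_one h h₁ h₂]
  · obtain ⟨s₁, hs₁, g₁⟩ := S.exists_mem_of_grounding hg h₁
    obtain ⟨s₂, hs₂, g₂⟩ := S.exists_mem_of_grounding hg h₂
    rw [g₁.eq_of_ne_none (h s₁ hs₁ s₁ hs₁ i hi).1, g₂.eq_of_ne_none (h s₂ hs₂ s₁ hs₁ i hi).1]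
    exact (h s₂ hs₂ s₁ hs₁ i hi).2

theorem Schema.satCIA_comm {S : Schema ι V} {X Y : Finset ι} {r : Multiset (Tuple ι V)} :
    S.SatCIA X Y r ↔ S.SatCIA Y X r := by
  simp only [Schema.satCIA_iff_recombines]
  exact forall₂_congr fun g _ => ⟨Recombines.symm, Recombines.symm⟩

/-- `X ⊥_c X` makes the `X`-part constant in every grounding. If there is a second tuple, a null in
`X` could be filled so as to disagree with it; hence there is none, and any single grounding shows
that `r` is constant on `X`. -/
theorem Schema.satCIA_self_iff {S : Schema ι V} {X : Finset ι} {r : Multiset (Tuple ι V)}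
    (hr : S.IsRelation r) : S.SatCIA X X r ↔ ConstOn X r := by
  refine ⟨fun h => ?_, Schema.satCIA_of_constOn⟩
  rw [Schema.satCIA_iff_recombines] at h
  have hconst : ∀ g, S.Grounding r g → ∀ t ∈ g, ∀ t' ∈ g, ∀ i ∈ X, t i = t' i := by
    intro g hg t ht t' ht' i hi
    obtain ⟨u, -, h1, h2⟩ := h g hg t ht t' ht'
    rw [← h1 i hi, h2 i hi]
  by_contra hc
  simp only [ConstOn, not_or, not_le] at hc
  obtain ⟨hcard, hc⟩ := hc
  apply hc
  have hnn : ∀ t ∈ r, ∀ i ∈ X, t i ≠ none := by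
    intro t ht i hi hnone
    obtain ⟨r', rfl⟩ := Multiset.exists_cons_of_mem ht
    have hpos : 0 < r'.card := by simpa using hcard
    obtain ⟨u, hu⟩ := Multiset.card_pos_iff_exists_mem.1 hpos
    obtain ⟨c, hc1, -⟩ := S.exists_avoid fun _ => none
    -- The nulls of `t` get values other than those of the grounded `u`.
    obtain ⟨d, hd1, hd2⟩ := S.exists_avoid (u.fill c)
    have hg : S.Grounding (t ::ₘ r') (t.fill d ::ₘ r'.map fun t => t.fill c) :=
      Multiset.Rel.cons (S.tupleGrounding_fill (hr t ht) hd1)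
        (Schema.IsRelation.grounding_map_fill
          (fun s hs => hr s (Multiset.mem_cons_of_mem hs)) hc1)
    have := hconst _ hg _ (Multiset.mem_cons_self _ _) (u.fill c)
      (Multiset.mem_cons_of_mem (Multiset.mem_map_of_mem _ hu)) i hi
    rw [Tuple.fill_of_eq_none hnone] at this
    exact hd2 i this
  intro t ht t' ht' i hi
  obtain ⟨c, hc1, -⟩ := S.exists_avoid fun _ => none
  have := hconst _ (hr.grounding_map_fill hc1) _ (Multiset.mem_map_of_mem _ ht) _
    (Multiset.mem_map_of_mem _ ht') i hi
  rw [Tuple.fill_of_ne_none (hnn t ht i hi), Tuple.fill_of_ne_none (hnn t' ht' i hi)] at this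
  exact ⟨hnn t ht i hi, this⟩

/-- All nulls are filled with values that avoid the wanted combination. The recombination found in
this grounding then owes none of its entries on `X ∪ Y` to a filled null, so its original in `r` has
them already. -/
theorem Schema.SatCIA.combines {S : Schema ι V} {X Y : Finset ι} {r : Multiset (Tuple ι V)}
    (hr : S.IsRelation r) (h : S.SatCIA X Y r) : Combines X Y r := by
  rw [Schema.satCIA_iff_recombines] at h
  intro t₁ h₁ hX t₂ h₂ hY
  obtain ⟨c, hc1, hc2⟩ := S.exists_avoid fun i => if i ∈ X then t₁ i else t₂ i
  obtain ⟨t, ht, htX, htY⟩ := h _ (hr.grounding_map_fill hc1) _ (Multiset.mem_map_of_mem _ h₁) _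
    (Multiset.mem_map_of_mem _ h₂)
  obtain ⟨u, hu, rfl⟩ := Multiset.mem_map.1 ht
  have hX' : ∀ i ∈ X, u.fill c i = t₁ i := fun i hi => by
    rw [htX i hi, Tuple.fill_of_ne_none (hX i hi)]
  have hY' : ∀ i ∈ Y, u.fill c i = t₂ i := fun i hi => by
    rw [htY i hi, Tuple.fill_of_ne_none (hY i hi)]
  have hnX : ∀ i ∈ X, u i ≠ none := by
    intro i hi hnone
    have h1 := hX' i hi
    rw [Tuple.fill_of_eq_none hnone] at h1
    exact hc2 i (by simpa [hi] using h1)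
  have hnY : ∀ i ∈ Y, u i ≠ none := by
    intro i hi hnone
    -- On `X ∩ Y` the filling was chosen to avoid `t₁`, so there the argument for `X` is needed.
    by_cases hiX : i ∈ X
    · exact hnX i hiX hnone
    · have h1 := hY' i hi
      rw [Tuple.fill_of_eq_none hnone] at h1
      exact hc2 i (by simpa [hiX] using h1)
  refine ⟨u, hu, fun i hi => ?_, fun i hi => ?_⟩
  · rw [← hX' i hi, Tuple.fill_of_ne_none (hnX i hi)]
  · rw [← hY' i hi, Tuple.fill_of_ne_none (hnY i hi)]

/-- If a tuple `s` of a relation with `X ⊥_c Y` has a null in `X` and some grounding of `s` is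
missing in the relation on `X ∪ Y`, then the other tuples agree with this grounding on `Y`. -/
theorem Schema.SatCIA.eq_of_missing {S : Schema ι V} {X Y : Finset ι} {r : Multiset (Tuple ι V)}
    {s : Tuple ι V} (hr : S.IsRelation (s ::ₘ r)) (h : S.SatCIA X Y (s ::ₘ r)) {c₀ : ι → V}
    (hc₀ : ∀ i, c₀ i ∈ S.dom i) (hmiss : ∀ u ∈ r, ∃ i ∈ X ∪ Y, u i ≠ s.fill c₀ i)
    {a : ι} (ha : a ∈ X) (hsa : s a = none) :
    ∀ u ∈ r, ∀ i ∈ Y, u i = s.fill c₀ i := by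
  rw [Schema.satCIA_iff_recombines] at h
  -- Nulls of the other tuples never receive the value of `s.fill c₀`. So an entry that equals it
  -- after grounding did so before (`key`), and no other tuple turns into the missing grounding
  -- (`havoid`).
  obtain ⟨c, hc1, hc2⟩ := S.exists_avoid (s.fill c₀)
  have hrest : S.Grounding r (r.map fun t => t.fill c) :=
    Schema.IsRelation.grounding_map_fill (fun t ht => hr t (Multiset.mem_cons_of_mem ht)) hc1
  have hr0 := hr s (Multiset.mem_cons_self _ _)
  have key : ∀ u : Tuple ι V, ∀ i, u.fill c i = s.fill c₀ i → u i = s.fill c₀ i := by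
    intro u i hui
    by_cases hn : u i = none
    · rw [Tuple.fill_of_eq_none hn] at hui
      exact absurd hui (hc2 i)
    · rwa [Tuple.fill_of_ne_none hn] at hui
  have havoid : ∀ u ∈ r, ¬ ∀ i ∈ X ∪ Y, u.fill c i = s.fill c₀ i := by
    intro u hu hall
    obtain ⟨i, hi, hne⟩ := hmiss u hu
    exact hne (key u i (hall i hi))
  -- The second grounding of `s`, which differs from the first at `a` only.
  obtain ⟨b, hb, hbne⟩ := S.exists_ne a (some (c₀ a))
  have hc₁ : ∀ i, Function.update c₀ a b i ∈ S.dom i := by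
    intro i
    by_cases hia : i = a
    · subst hia; simpa using hb
    · simpa [hia] using hc₀ i
  have hfa : s.fill (Function.update c₀ a b) a ≠ s.fill c₀ a := by
    rw [Tuple.fill_of_eq_none hsa, Tuple.fill_of_eq_none hsa]
    simpa using hbne
  have hfi : ∀ i, i ≠ a → s.fill (Function.update c₀ a b) i = s.fill c₀ i := by
    intro i hi
    simp [Tuple.fill, hi]
  have hG := h _ (Multiset.Rel.cons (S.tupleGrounding_fill hr0 hc₀) hrest)
  have hG' := h _ (Multiset.Rel.cons (S.tupleGrounding_fill hr0 hc₁) hrest)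
  intro u hu i hi
  apply key
  by_contra hne
  have hu' : u.fill c ∈ r.map fun t => t.fill c := Multiset.mem_map_of_mem _ hu
  obtain ⟨t, ht, htX, htY⟩ := hG _ (Multiset.mem_cons_self _ _) _ (Multiset.mem_cons_of_mem hu')
  -- If `a ∈ X ∩ Y`, the entry of `u` at `a` would have to equal that of both versions of `s`.
  by_cases haY : a ∈ Y
  · obtain ⟨t', -, htX', htY'⟩ := hG' _ (Multiset.mem_cons_self _ _) _
      (Multiset.mem_cons_of_mem hu')
    apply hfa
    rw [← htX' a ha, htY' a haY, ← htY a haY, htX a ha]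
  -- Otherwise `hne` shows that `t` is not the grounded `s`, so `t` belongs to both groundings. In
  -- the second one it is recombined with the changed `s`; as `a ∉ Y`, the result equals `s.fill c₀`
  -- on `X ∪ Y`.
  · rcases Multiset.mem_cons.1 ht with rfl | ht
    · exact hne (htY i hi).symm
    · obtain ⟨t', ht', htX', htY'⟩ := hG' t (Multiset.mem_cons_of_mem ht) _
        (Multiset.mem_cons_self _ _)
      rcases Multiset.mem_cons.1 ht' with rfl | ht'
      · exact hfa ((htX' a ha).trans (htX a ha))
      · obtain ⟨w, hw, rfl⟩ := Multiset.mem_map.1 ht'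
        apply havoid w hw
        intro j hj
        rcases Finset.mem_union.1 hj with hj | hj
        · exact (htX' j hj).trans (htX j hj)
        · rw [htY' j hj, hfi j]
          rintro rfl
          exact haY hj

/-- The other tuples have on `Y` the values of the missing grounding. If `s` has a null in `Y`, the
same holds on `X` by symmetry, so there are no other tuples; if not, these values are those of `s`.
-/
theorem Schema.SatCIA.constOn_of_missing {S : Schema ι V} {X Y : Finset ι}
    {r : Multiset (Tuple ι V)} {s : Tuple ι V} (hr : S.IsRelation (s ::ₘ r))
    (h : S.SatCIA X Y (s ::ₘ r)) {c₀ : ι → V}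
    (hc₀ : ∀ i, c₀ i ∈ S.dom i) (hmiss : ∀ u ∈ r, ∃ i ∈ X ∪ Y, u i ≠ s.fill c₀ i)
    {a : ι} (ha : a ∈ X) (hsa : s a = none) : ConstOn Y (s ::ₘ r) := by
  have h1 := h.eq_of_missing hr hc₀ hmiss ha hsa
  by_cases hY : ∃ b ∈ Y, s b = none
  · obtain ⟨b, hb, hsb⟩ := hY
    have h2 := (Schema.satCIA_comm.1 h).eq_of_missing hr hc₀
      (by simpa only [Finset.union_comm] using hmiss) hb hsb
    left
    have : r = 0 := by
      refine Multiset.eq_zero_of_forall_notMem fun u hu => ?_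
      obtain ⟨i, hi, hne⟩ := hmiss u hu
      rcases Finset.mem_union.1 hi with hi | hi
      · exact hne (h2 u hu i hi)
      · exact hne (h1 u hu i hi)
    simp [this]
  · push Not at hY
    right
    have h3 : ∀ t ∈ s ::ₘ r, ∀ i ∈ Y, t i = s i := by
      intro t ht i hi
      rcases Multiset.mem_cons.1 ht with rfl | ht
      · rfl
      · rw [h1 t ht i hi, Tuple.fill_of_ne_none (hY i hi)]
    intro t ht t' ht' i hi
    rw [h3 t ht i hi, h3 t' ht' i hi]
    exact ⟨hY i hi, rfl⟩

theorem Schema.SatCIA.containsGroundings {S : Schema ι V} {X Y : Finset ι}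
    {r : Multiset (Tuple ι V)} (hr : S.IsRelation r) (h : S.SatCIA X Y r)
    (hX : ¬ ConstOn X r) (hY : ¬ ConstOn Y r) : S.ContainsGroundings (X ∪ Y) r := by
  intro t ht s hs
  by_contra hmiss
  push Not at hmiss
  obtain ⟨d, hd, -⟩ := S.exists_avoid fun _ => none
  -- Off `X ∪ Y` the values of `s` need not lie in the domains.
  set c₀ : ι → V := fun i => if i ∈ X ∪ Y then s i else d i with hc₀def
  have hc₀ : ∀ i, c₀ i ∈ S.dom i := by
    intro i
    by_cases hi : i ∈ X ∪ Y
    · simp only [hc₀def, if_pos hi]; exact (hs i hi).1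
    · simp only [hc₀def, if_neg hi]; exact hd i
  have hfill : ∀ i ∈ X ∪ Y, t.fill c₀ i = some (s i) := by
    intro i hi
    rcases (hs i hi).2 with h0 | h0
    · rw [Tuple.fill_of_eq_none h0]; simp only [hc₀def, if_pos hi]
    · rw [Tuple.fill_of_ne_none (by simp [h0]), h0]
  -- Since `t` itself does not realise the grounding, it has a null in `X ∪ Y`.
  obtain ⟨a, ha, hta⟩ := hmiss t ht
  have hnone : t a = none := (hs a ha).2.resolve_right hta
  obtain ⟨r', rfl⟩ := Multiset.exists_cons_of_mem ht
  have hmiss' : ∀ u ∈ r', ∃ i ∈ X ∪ Y, u i ≠ t.fill c₀ i := by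
    intro u hu
    obtain ⟨i, hi, hne⟩ := hmiss u (Multiset.mem_cons_of_mem hu)
    exact ⟨i, hi, by rwa [hfill i hi]⟩
  rcases Finset.mem_union.1 ha with ha | ha
  · exact hY (h.constOn_of_missing hr hc₀ hmiss' ha hnone)
  · exact hX ((Schema.satCIA_comm.1 h).constOn_of_missing hr hc₀
      (by simpa only [Finset.union_comm] using hmiss') ha hnone)

/-- Each tuple of a grounding agrees on `X ∪ Y` with a tuple of `r` that is complete there. The
combination of two of these in `r` is complete on `X ∪ Y` too, so grounding keeps it. -/
theorem Schema.satCIA_of_containsGroundings {S : Schema ι V} {X Y : Finset ι}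
    {r : Multiset (Tuple ι V)} (hc : Combines X Y r) (hg : S.ContainsGroundings (X ∪ Y) r) :
    S.SatCIA X Y r := by
  rw [Schema.satCIA_iff_recombines]
  intro g hrg t₁ h₁ t₂ h₂
  have key : ∀ t ∈ g, ∃ u ∈ r, ∀ i ∈ X ∪ Y, u i = t i ∧ u i ≠ none := by
    intro t ht
    obtain ⟨s, hs, hst⟩ := S.exists_mem_of_grounding hrg ht
    choose b hb1 hb2 hb3 using hst
    obtain ⟨u, hu, h⟩ := hg s hs b fun i _ => ⟨hb1 i, hb3 i⟩
    exact ⟨u, hu, fun i hi => ⟨by rw [h i hi, hb2], by simp [h i hi]⟩⟩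
  obtain ⟨u₁, hu₁, e₁⟩ := key t₁ h₁
  obtain ⟨u₂, hu₂, e₂⟩ := key t₂ h₂
  obtain ⟨u, hu, hX, hY⟩ := hc u₁ hu₁ (fun i hi => (e₁ i (Finset.mem_union_left _ hi)).2) u₂ hu₂
    (fun i hi => (e₂ i (Finset.mem_union_right _ hi)).2)
  obtain ⟨t, ht, hut⟩ := S.exists_grounding_mem hrg hu
  have hX' : ∀ i ∈ X, u i = t₁ i ∧ u i ≠ none := by
    intro i hi
    rw [hX i hi]
    exact e₁ i (Finset.mem_union_left _ hi)
  have hY' : ∀ i ∈ Y, u i = t₂ i ∧ u i ≠ none := by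
    intro i hi
    rw [hY i hi]
    exact e₂ i (Finset.mem_union_right _ hi)
  exact ⟨t, ht, fun i hi => (hut.eq_of_ne_none (hX' i hi).2).trans (hX' i hi).1,
    fun i hi => (hut.eq_of_ne_none (hY' i hi).2).trans (hY' i hi).1⟩

theorem Schema.satCIA_iff {S : Schema ι V} {X Y : Finset ι} {r : Multiset (Tuple ι V)}
    (hr : S.IsRelation r) :
    S.SatCIA X Y r ↔
      ConstOn X r ∨ ConstOn Y r ∨ (Combines X Y r ∧ S.ContainsGroundings (X ∪ Y) r) := by
  constructor
  · intro h
    by_cases hX : ConstOn X r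
    · exact Or.inl hX
    by_cases hY : ConstOn Y r
    · exact Or.inr (Or.inl hY)
    exact Or.inr (Or.inr ⟨h.combines hr, h.containsGroundings hr hX hY⟩)
  · rintro (h | h | ⟨h1, h2⟩)
    · exact S.satCIA_of_constOn h
    · exact Schema.satCIA_comm.1 (S.satCIA_of_constOn h)
    · exact S.satCIA_of_containsGroundings h1 h2

omit [DecidableEq ι] in
theorem combines_iff {X Y : Finset ι} {r : Multiset (Tuple ι V)} :
    Combines X Y r ↔ ∀ t ∈ proj X r, t.IsComplete → ∀ t' ∈ proj Y r, t'.IsComplete →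
      ∃ t'' ∈ r, t''.proj X = t ∧ t''.proj Y = t' := by
  simp only [Combines, proj, Multiset.mem_map, forall_exists_index, and_imp,
    forall_apply_eq_imp_iff₂, isComplete_proj_iff, Tuple.proj_eq_iff]

/-- A grounding of one tuple extends to a grounding of the whole projection, by filling the
remaining tuples arbitrarily. -/
theorem Schema.containsGroundings_iff {S : Schema ι V} {Z : Finset ι} {r : Multiset (Tuple ι V)}
    (hr : S.IsRelation r) :
    S.ContainsGroundings Z r ↔
      ∀ g, (S.restrict Z).Grounding (proj Z r) g → ∀ s ∈ g, s ∈ proj Z r := by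
  constructor
  · intro h g hg s hs
    obtain ⟨t', ht', hts⟩ := (S.restrict Z).exists_mem_of_grounding hg hs
    obtain ⟨t, ht, rfl⟩ := Multiset.mem_map.1 ht'
    choose b hb1 hb2 hb3 using hts
    obtain ⟨d, hd, -⟩ := S.exists_avoid fun _ => none
    obtain ⟨u, hu, hus⟩ := h t ht (fun i => if hi : i ∈ Z then b ⟨i, hi⟩ else d i) (by
      intro i hi
      simp only [dif_pos hi]
      exact ⟨hb1 ⟨i, hi⟩, hb3 ⟨i, hi⟩⟩)
    refine Multiset.mem_map.2 ⟨u, hu, funext fun i => ?_⟩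
    rw [hb2 i]
    simpa [i.2, Tuple.proj] using hus i i.2
  · intro h t ht s hs
    obtain ⟨d, hd, -⟩ := S.exists_avoid fun _ => none
    have hrel : (S.restrict Z).IsRelation (proj Z r) := by
      intro t' ht' i a hia
      obtain ⟨t, ht, rfl⟩ := Multiset.mem_map.1 ht'
      exact hr t ht i a hia
    obtain ⟨r', rfl⟩ := Multiset.exists_cons_of_mem ht
    have hg : (S.restrict Z).Grounding (proj Z (t ::ₘ r'))
        ((fun i : Z => some (s i)) ::ₘ (proj Z r').map fun t => t.fill fun i => d i) := by
      have hp : proj Z (t ::ₘ r') = t.proj Z ::ₘ proj Z r' := Multiset.map_cons _ _ _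
      rw [hp] at hrel ⊢
      refine Multiset.Rel.cons (fun i => ⟨s i, (hs i i.2).1, rfl, (hs i i.2).2⟩)
        (Schema.IsRelation.grounding_map_fill
          (fun s hs => hrel s (Multiset.mem_cons_of_mem hs)) fun i => hd i)
    obtain ⟨u, hu, hus⟩ := Multiset.mem_map.1 (h _ hg _ (Multiset.mem_cons_self _ _))
    exact ⟨u, hu, fun i hi => congrFun hus ⟨i, hi⟩⟩

end Characterisation

/-! ### First-order definability in the structures of relations. -/

section FirstOrderDefinability

open FirstOrder Language

variable {n : ℕ}

/-- A property of relations with elements of the universe as parameters is defined by one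
first-order formula in the structures of all relations. -/
def UniformlyDefinable {α : Type}
    (P : ∀ {V : Type u} (S : Schema (Fin n) V) (r : Multiset (Tuple (Fin n) V)),
      (α → RelUniverse S r) → Prop) : Prop :=
  ∃ φ : (relLanguage n).Formula α,
    ∀ (V : Type u) (S : Schema (Fin n) V) (r : Multiset (Tuple (Fin n) V)), S.IsRelation r →
      ∀ v : α → RelUniverse S r,
        (@Formula.Realize (relLanguage n) (RelUniverse S r) (relStructure S r) α φ v ↔ P S r v)

/-- The null symbol as an element of the universe. -/
def nullElem {V : Type u} (S : Schema (Fin n) V) (r : Multiset (Tuple (Fin n) V)) :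
    RelUniverse S r :=
  Sum.inl ⟨none, Or.inl rfl⟩

/-- The number `k` as an element of the universe. -/
def numElem {V : Type u} (S : Schema (Fin n) V) {r : Multiset (Tuple (Fin n) V)} (k : ℕ)
    (h : k ≤ maxMult r) : RelUniverse S r :=
  Sum.inr ⟨k, h⟩

/-- The predicate `D i`. -/
def InDom {V : Type u} (S : Schema (Fin n) V) (r : Multiset (Tuple (Fin n) V)) (i : Fin n)
    (x : RelUniverse S r) : Prop :=
  ∃ a : Symbol S, x = Sum.inl a ∧ (a.1 = none ∨ ∃ b ∈ S.dom i, a.1 = some b)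

namespace UniformlyDefinable

variable {α : Type}
  {P Q : ∀ {V : Type u} (S : Schema (Fin n) V) (r : Multiset (Tuple (Fin n) V)),
    (α → RelUniverse S r) → Prop}

theorem congr (h : UniformlyDefinable.{u} P)
    (hPQ : ∀ (V : Type u) (S : Schema (Fin n) V) (r : Multiset (Tuple (Fin n) V)),
      S.IsRelation r → ∀ v : α → RelUniverse S r, P S r v ↔ Q S r v) :
    UniformlyDefinable.{u} Q := by
  obtain ⟨φ, hφ⟩ := h
  exact ⟨φ, fun V S r hr v => (hφ V S r hr v).trans (hPQ V S r hr v)⟩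

theorem not (h : UniformlyDefinable.{u} P) :
    UniformlyDefinable.{u} fun S r (v : α → RelUniverse S r) => ¬ P S r v := by
  obtain ⟨φ, hφ⟩ := h
  refine ⟨φ.not, fun V S r hr v => ?_⟩
  let := relStructure S r
  rw [Formula.realize_not, hφ V S r hr v]

theorem and (h : UniformlyDefinable.{u} P) (h' : UniformlyDefinable.{u} Q) :
    UniformlyDefinable.{u} fun S r (v : α → RelUniverse S r) => P S r v ∧ Q S r v := by
  obtain ⟨φ, hφ⟩ := h
  obtain ⟨ψ, hψ⟩ := h'
  refine ⟨φ ⊓ ψ, fun V S r hr v => ?_⟩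
  let := relStructure S r
  rw [Formula.realize_inf, hφ V S r hr v, hψ V S r hr v]

theorem or (h : UniformlyDefinable.{u} P) (h' : UniformlyDefinable.{u} Q) :
    UniformlyDefinable.{u} fun S r (v : α → RelUniverse S r) => P S r v ∨ Q S r v := by
  refine (h.not.and h'.not).not.congr fun V S r _ v => ?_
  tauto

theorem imp (h : UniformlyDefinable.{u} P) (h' : UniformlyDefinable.{u} Q) :
    UniformlyDefinable.{u} fun S r (v : α → RelUniverse S r) => P S r v → Q S r v := by
  refine (h.and h'.not).not.congr fun V S r _ v => ?_
  tauto

theorem const (p : Prop) :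
    UniformlyDefinable.{u} (n := n) fun S r (_ : α → RelUniverse S r) => p := by
  by_cases hp : p
  · refine ⟨⊤, fun V S r hr v => ?_⟩
    let := relStructure S r
    simp [hp]
  · refine ⟨⊥, fun V S r hr v => ?_⟩
    let := relStructure S r
    simp [hp]

/-- A block of quantifiers at once: `β = Fin n` gives quantification over a sequence that may be a
tuple. -/
theorem all {β : Type} [Finite β]
    {R : ∀ {V : Type u} (S : Schema (Fin n) V) (r : Multiset (Tuple (Fin n) V)),
      (α → RelUniverse S r) → (β → RelUniverse S r) → Prop}
    (h : UniformlyDefinable.{u} fun S r (v : α ⊕ β → RelUniverse S r) =>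
      R S r (fun a => v (Sum.inl a)) fun b => v (Sum.inr b)) :
    UniformlyDefinable.{u} fun S r (v : α → RelUniverse S r) =>
      ∀ x : β → RelUniverse S r, R S r v x := by
  obtain ⟨φ, hφ⟩ := h
  refine ⟨φ.iAlls β, fun V S r hr v => ?_⟩
  let := relStructure S r
  rw [Formula.realize_iAlls]
  exact forall_congr' fun x => hφ V S r hr _

theorem ex {β : Type} [Finite β]
    {R : ∀ {V : Type u} (S : Schema (Fin n) V) (r : Multiset (Tuple (Fin n) V)),
      (α → RelUniverse S r) → (β → RelUniverse S r) → Prop}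
    (h : UniformlyDefinable.{u} fun S r (v : α ⊕ β → RelUniverse S r) =>
      R S r (fun a => v (Sum.inl a)) fun b => v (Sum.inr b)) :
    UniformlyDefinable.{u} fun S r (v : α → RelUniverse S r) =>
      ∃ x : β → RelUniverse S r, R S r v x := by
  refine (all (R := fun S r v x => ¬ R S r v x) h.not).not.congr fun V S r _ v => ?_
  simp

theorem forallFinset {κ : Type} (s : Finset κ)
    {R : κ → ∀ {V : Type u} (S : Schema (Fin n) V) (r : Multiset (Tuple (Fin n) V)),
      (α → RelUniverse S r) → Prop}
    (h : ∀ k, UniformlyDefinable.{u} (R k)) :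
    UniformlyDefinable.{u} fun S r (v : α → RelUniverse S r) => ∀ k ∈ s, R k S r v := by
  classical
  induction s using Finset.induction_on with
  | empty => exact (const (n := n) True).congr fun V S r _ v => by simp
  | insert k s _ ih => exact ((h k).and ih).congr fun V S r _ v => by simp

/-- The atom by which formulas refer to rows: by `multOf_ne_zero_iff`, a nonzero multiplicity means
that the sequence is a tuple of `r`. -/
theorem multOf_ne_zero (x : Fin n → α) :
    UniformlyDefinable.{u} fun S r (v : α → RelUniverse S r) => multOf (fun i => v (x i)) ≠ 0 := by
  refine ⟨(Term.equal (L := relLanguage n)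
    (Term.func (l := n) RelFunctions.mult fun i => Term.var (x i))
    (Term.func (l := 0) RelFunctions.zero Fin.elim0)).not, fun V S r hr v => ?_⟩
  let := relStructure S r
  rw [Formula.realize_not, Formula.realize_equal]
  refine not_congr ((Sum.inr_injective.eq_iff).trans Subtype.ext_iff)

theorem eq (a b : α) :
    UniformlyDefinable.{u} (n := n) fun S r (v : α → RelUniverse S r) => v a = v b := by
  refine ⟨Term.equal (L := relLanguage n) (Term.var a) (Term.var b), fun V S r hr v => ?_⟩
  let := relStructure S r
  rw [Formula.realize_equal]
  rfl

theorem eq_null (a : α) :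
    UniformlyDefinable.{u} (n := n) fun S r (v : α → RelUniverse S r) => v a = nullElem S r := by
  refine ⟨Term.equal (L := relLanguage n) (Term.var a)
    (Term.func (l := 0) RelFunctions.null Fin.elim0), fun V S r hr v => ?_⟩
  let := relStructure S r
  rw [Formula.realize_equal]
  rfl

theorem eq_zero (a : α) :
    UniformlyDefinable.{u} (n := n) fun S r (v : α → RelUniverse S r) =>
      v a = numElem S 0 (Nat.zero_le _) := by
  refine ⟨Term.equal (L := relLanguage n) (Term.var a)
    (Term.func (l := 0) RelFunctions.zero Fin.elim0), fun V S r hr v => ?_⟩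
  let := relStructure S r
  rw [Formula.realize_equal]
  rfl

theorem eq_multOf (a : α) (x : Fin n → α) :
    UniformlyDefinable.{u} fun S r (v : α → RelUniverse S r) =>
      v a = numElem S (multOf fun i => v (x i)) (multOf_le _) := by
  refine ⟨Term.equal (L := relLanguage n) (Term.var a)
    (Term.func (l := n) RelFunctions.mult fun i => Term.var (x i)), fun V S r hr v => ?_⟩
  let := relStructure S r
  rw [Formula.realize_equal]
  rfl

theorem inDom (i : Fin n) (a : α) :
    UniformlyDefinable.{u} fun S r (v : α → RelUniverse S r) => InDom S r i (v a) := by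
  refine ⟨Relations.formula (L := relLanguage n) (n := 1) (RelPredicates.dom i)
    fun _ => Term.var a, fun V S r hr v => ?_⟩
  let := relStructure S r
  exact Formula.realize_rel (L := relLanguage n) (R := (RelPredicates.dom i : RelPredicates n 1))

end UniformlyDefinable

theorem UniformlyDefinable.inFO
    {Q : ∀ {V : Type u}, Schema (Fin n) V → Multiset (Tuple (Fin n) V) → Prop}
    (h : UniformlyDefinable.{u} fun S r (_ : Empty → RelUniverse S r) => Q S r) :
    InFO.{u} Q := by
  obtain ⟨φ, hφ⟩ := h
  exact ⟨φ, fun V S r hr => hφ V S r hr _⟩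

section Elements

variable {V : Type u} {S : Schema (Fin n) V} {r : Multiset (Tuple (Fin n) V)}

theorem symbol_inj {a b : Symbol S} :
    (Sum.inl a : RelUniverse S r) = Sum.inl b ↔ a.1 = b.1 :=
  Sum.inl_injective.eq_iff.trans Subtype.ext_iff

theorem numElem_inj {k l : ℕ} {h : k ≤ maxMult r} {h' : l ≤ maxMult r} :
    numElem S k h = numElem S l h' ↔ k = l :=
  Sum.inr_injective.eq_iff.trans Subtype.ext_iff

theorem multOf_ne_zero_iff {x : Fin n → RelUniverse S r} :
    multOf x ≠ 0 ↔ ∃ t ∈ r, IsTuple x t := by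
  classical
  unfold multOf
  rw [← Nat.pos_iff_ne_zero, Multiset.countP_pos]

theorem IsTuple.eq_iff {x y : Fin n → RelUniverse S r} {t s : Tuple (Fin n) V}
    (hx : IsTuple x t) (hy : IsTuple y s) (i j : Fin n) : x i = y j ↔ t i = s j := by
  obtain ⟨a, h1, h2⟩ := hx i
  obtain ⟨b, h3, h4⟩ := hy j
  rw [h1, h2, h3, h4]
  exact symbol_inj

theorem IsTuple.eq_null_iff {x : Fin n → RelUniverse S r} {t : Tuple (Fin n) V}
    (hx : IsTuple x t) (i : Fin n) : x i = nullElem S r ↔ t i = none := by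
  obtain ⟨a, h1, h2⟩ := hx i
  rw [h1, h2]
  exact symbol_inj

theorem IsTuple.tuple_unique {x : Fin n → RelUniverse S r} {t s : Tuple (Fin n) V}
    (hx : IsTuple x t) (hy : IsTuple x s) : t = s :=
  funext fun i => (hx.eq_iff hy i i).1 rfl

theorem Schema.IsRelation.exists_isTuple (hr : S.IsRelation r) {t : Tuple (Fin n) V}
    (ht : t ∈ r) : ∃ x : Fin n → RelUniverse S r, IsTuple x t := by
  have h : ∀ i, t i = none ∨ ∃ j, ∃ b ∈ S.dom j, t i = some b := by
    intro i
    cases hi : t i with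
    | none => exact Or.inl rfl
    | some a => exact Or.inr ⟨i, a, hr t ht i a hi, rfl⟩
  exact ⟨fun i => Sum.inl ⟨t i, h i⟩, fun i => ⟨⟨t i, h i⟩, rfl, rfl⟩⟩

/-- Entries of tuples of `r` lie in the domains, so every such tuple is represented in the universe,
and relativised quantifiers over sequences become quantifiers over `r`. -/
theorem Schema.IsRelation.forall_row_iff (hr : S.IsRelation r)
    {A : (Fin n → RelUniverse S r) → Prop} {B : Tuple (Fin n) V → Prop}
    (h : ∀ x, ∀ t ∈ r, IsTuple x t → (A x ↔ B t)) :
    (∀ x : Fin n → RelUniverse S r, multOf x ≠ 0 → A x) ↔ ∀ t ∈ r, B t := by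
  constructor
  · intro H t ht
    obtain ⟨x, hx⟩ := hr.exists_isTuple ht
    exact (h x t ht hx).1 (H x (multOf_ne_zero_iff.2 ⟨t, ht, hx⟩))
  · intro H x hx
    obtain ⟨t, ht, hxt⟩ := multOf_ne_zero_iff.1 hx
    exact (h x t ht hxt).2 (H t ht)

theorem Schema.IsRelation.exists_row_iff (hr : S.IsRelation r)
    {A : (Fin n → RelUniverse S r) → Prop} {B : Tuple (Fin n) V → Prop}
    (h : ∀ x, ∀ t ∈ r, IsTuple x t → (A x ↔ B t)) :
    (∃ x : Fin n → RelUniverse S r, multOf x ≠ 0 ∧ A x) ↔ ∃ t ∈ r, B t := by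
  have := hr.forall_row_iff (A := fun x => ¬ A x) (B := fun t => ¬ B t)
    fun x t ht hx => not_congr (h x t ht hx)
  rw [← not_iff_not]
  push Not
  exact this

theorem IsTuple.multOf_eq [DecidableEq (Tuple (Fin n) V)] {x : Fin n → RelUniverse S r}
    {t : Tuple (Fin n) V} (hx : IsTuple x t) : multOf x = r.count t := by
  classical
  unfold multOf Multiset.count
  exact Multiset.countP_congr rfl fun s _ => propext
    ⟨fun hs => hx.tuple_unique hs, fun h => h ▸ hx⟩

/-- The clause about the null matters only for `n = 0`, where no domain predicate covers it. -/
theorem isNumber_iff {x : RelUniverse S r} :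
    ((∀ i ∈ Finset.univ, ¬ InDom S r i x) ∧ x ≠ nullElem S r) ↔
      ∃ k h, x = numElem S k h := by
  constructor
  · rintro ⟨h1, h2⟩
    rcases x with a | ⟨k, hk⟩
    · exfalso
      rcases a with ⟨a, rfl | ⟨i, b, hb, rfl⟩⟩
      · exact h2 rfl
      · exact h1 i (Finset.mem_univ _) ⟨_, rfl, Or.inr ⟨b, hb, rfl⟩⟩
    · exact ⟨k, hk, rfl⟩
  · rintro ⟨k, h, rfl⟩
    refine ⟨fun i _ => ?_, ?_⟩
    · rintro ⟨a, ha, -⟩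
      cases ha
    · intro h
      cases h

theorem inDom_and_ne_null_iff {x : RelUniverse S r} {i : Fin n} :
    (InDom S r i x ∧ x ≠ nullElem S r) ↔
      ∃ b, ∃ hb : b ∈ S.dom i, x = Sum.inl ⟨some b, Or.inr ⟨i, b, hb, rfl⟩⟩ := by
  constructor
  · rintro ⟨⟨⟨a, ha⟩, rfl, h | ⟨b, hb, h⟩⟩, h2⟩
    · obtain rfl : a = none := h
      exact absurd rfl h2
    · obtain rfl : a = some b := h
      exact ⟨b, hb, rfl⟩
  · rintro ⟨b, hb, rfl⟩
    refine ⟨⟨_, rfl, Or.inr ⟨b, hb, rfl⟩⟩, ?_⟩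
    intro h
    have := congrArg Subtype.val (Sum.inl_injective h)
    cases this

theorem maxMult_eq [DecidableEq (Tuple (Fin n) V)] :
    maxMult r = r.toFinset.sup fun t => r.count t := by
  unfold maxMult
  congr!

/-- Cardinality is reached through the numbers in the universe, which are all those up to the
largest multiplicity: if all tuples are `t`, then there is one copy exactly when only `0` and the
multiplicity of `t` occur. -/
theorem card_le_one_iff [DecidableEq (Tuple (Fin n) V)] :
    r.card ≤ 1 ↔ ∀ t ∈ r, ∀ t' ∈ r, t = t' ∧ ∀ k ≤ maxMult r, k = 0 ∨ k = r.count t := by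
  constructor
  · intro h t ht t' ht'
    refine ⟨eq_of_mem_of_card_le_one h ht ht', fun k hk => ?_⟩
    have h1 : maxMult r ≤ 1 := by
      rw [maxMult_eq]
      exact Finset.sup_le fun s _ => (Multiset.count_le_card s r).trans h
    have h2 : 0 < r.count t := Multiset.count_pos.2 ht
    have h3 : r.count t ≤ 1 := (Multiset.count_le_card t r).trans h
    omega
  · intro h
    rcases r.empty_or_exists_mem with rfl | ⟨t, ht⟩
    · simp
    · have h1 : r = Multiset.replicate r.card t :=
        Multiset.eq_replicate_card.2 fun s hs => ((h t ht s hs).1).symm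
      have h2 : 0 < r.count t := Multiset.count_pos.2 ht
      have h3 : r.count t = r.card := by
        conv_lhs => rw [h1]
        rw [Multiset.count_replicate_self]
      have h4 : r.count t ≤ maxMult r := by
        rw [maxMult_eq]
        exact Finset.le_sup (f := fun t => r.count t) (Multiset.mem_toFinset.2 ht)
      -- The number `1` occurs because `t` has positive multiplicity, and being nonzero it must be
      -- that multiplicity.
      have := (h t ht t ht).2 1 (by omega)
      omega

end Elements

theorem satIA_inFO (X Y : Finset (Fin n)) :
    InFO.{u} (n := n) fun _ r => SatIA X Y r := by
  apply UniformlyDefinable.inFO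
  have h1 : UniformlyDefinable.{u} fun S r (_ : Empty → RelUniverse S r) =>
      ∀ x : Fin n → RelUniverse S r, multOf x ≠ 0 → ∀ i ∈ X ∪ Y, ¬ x i = nullElem S r :=
    .all (.imp (.multOf_ne_zero _) (.forallFinset _ fun i => (.not (.eq_null _))))
  have h2 : UniformlyDefinable.{u} fun S r (_ : Empty → RelUniverse S r) =>
      ∀ x : Fin n → RelUniverse S r, multOf x ≠ 0 → ∀ y : Fin n → RelUniverse S r,
        multOf y ≠ 0 → ∃ z : Fin n → RelUniverse S r, multOf z ≠ 0 ∧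
          (∀ i ∈ X, z i = x i) ∧ ∀ i ∈ Y, z i = y i :=
    .all (.imp (.multOf_ne_zero _) (.all (.imp (.multOf_ne_zero _) (.ex (.and (.multOf_ne_zero _)
      (.and (.forallFinset _ fun i => .eq _ _) (.forallFinset _ fun i => .eq _ _)))))))
  refine (h1.and h2).congr fun V S r hr v => ?_
  rw [satIA_iff]
  refine and_congr (hr.forall_row_iff fun x t ht hx => ?_)
    (hr.forall_row_iff fun x t ht hx => hr.forall_row_iff fun y s hs hy =>
      hr.exists_row_iff fun z u hu hz => ?_)
  · exact forall₂_congr fun i _ => not_congr (hx.eq_null_iff i)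
  · exact and_congr (forall₂_congr fun i _ => hz.eq_iff hx i i)
      (forall₂_congr fun i _ => hz.eq_iff hy i i)

theorem UniformlyDefinable.constOn (X : Finset (Fin n)) :
    UniformlyDefinable.{u} fun S r (_ : Empty → RelUniverse S r) => ConstOn X r := by
  have h1 : UniformlyDefinable.{u} fun S r (_ : Empty → RelUniverse S r) =>
      ∀ x : Fin n → RelUniverse S r, multOf x ≠ 0 → ∀ y : Fin n → RelUniverse S r,
        multOf y ≠ 0 → (∀ i ∈ Finset.univ, x i = y i) ∧ ∀ z : Unit → RelUniverse S r,
          ((∀ i ∈ Finset.univ, ¬ InDom S r i (z ())) ∧ ¬ z () = nullElem S r) →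
            (z () = numElem S 0 (Nat.zero_le _) ∨ z () = numElem S (multOf x) (multOf_le x)) :=
    .all (.imp (.multOf_ne_zero _) (.all (.imp (.multOf_ne_zero _)
      (.and (.forallFinset _ fun i => .eq _ _)
        (.all (.imp (.and (.forallFinset _ fun i => (.not (.inDom _ _))) (.not (.eq_null _)))
          (.or (.eq_zero _) (.eq_multOf _ _))))))))
  have h2 : UniformlyDefinable.{u} fun S r (_ : Empty → RelUniverse S r) =>
      ∀ x : Fin n → RelUniverse S r, multOf x ≠ 0 → ∀ y : Fin n → RelUniverse S r,
        multOf y ≠ 0 → ∀ i ∈ X, ¬ x i = nullElem S r ∧ x i = y i :=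
    .all (.imp (.multOf_ne_zero _) (.all (.imp (.multOf_ne_zero _)
      (.forallFinset _ fun i => .and (.not (.eq_null _)) (.eq _ _)))))
  refine (h1.or h2).congr fun V S r hr v => ?_
  classical
  refine or_congr ?_ ?_
  · rw [card_le_one_iff]
    refine hr.forall_row_iff fun x t ht hx => hr.forall_row_iff fun y s hs hy => and_congr ?_ ?_
    · rw [funext_iff]
      simp only [Finset.mem_univ, true_imp_iff]
      exact forall_congr' fun i => hx.eq_iff hy i i
    · constructor
      · intro H k hk
        have := H (fun _ => numElem S k hk) (isNumber_iff.2 ⟨k, hk, rfl⟩)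
        rwa [numElem_inj, numElem_inj, hx.multOf_eq] at this
      · intro H z hz
        obtain ⟨k, hk, hzk⟩ := isNumber_iff.1 hz
        rw [hzk, numElem_inj, numElem_inj, hx.multOf_eq]
        exact H k hk
  · exact hr.forall_row_iff fun x t ht hx => hr.forall_row_iff fun y s hs hy =>
      forall₂_congr fun i _ => and_congr (not_congr (hx.eq_null_iff i)) (hx.eq_iff hy i i)

theorem UniformlyDefinable.combines (X Y : Finset (Fin n)) :
    UniformlyDefinable.{u} fun S r (_ : Empty → RelUniverse S r) => Combines X Y r := by
  have h : UniformlyDefinable.{u} fun S r (_ : Empty → RelUniverse S r) =>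
      ∀ x : Fin n → RelUniverse S r, multOf x ≠ 0 → (∀ i ∈ X, ¬ x i = nullElem S r) →
        ∀ y : Fin n → RelUniverse S r, multOf y ≠ 0 → (∀ i ∈ Y, ¬ y i = nullElem S r) →
          ∃ z : Fin n → RelUniverse S r, multOf z ≠ 0 ∧
            (∀ i ∈ X, z i = x i) ∧ ∀ i ∈ Y, z i = y i :=
    .all (.imp (.multOf_ne_zero _) (.imp (.forallFinset _ fun i => .not (.eq_null _))
      (.all (.imp (.multOf_ne_zero _) (.imp (.forallFinset _ fun i => .not (.eq_null _))
        (.ex (.and (.multOf_ne_zero _)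
          (.and (.forallFinset _ fun i => .eq _ _) (.forallFinset _ fun i => .eq _ _)))))))))
  refine h.congr fun V S r hr v => ?_
  exact hr.forall_row_iff fun x t ht hx =>
    imp_congr (forall₂_congr fun i _ => not_congr (hx.eq_null_iff i))
      (hr.forall_row_iff fun y s hs hy =>
        imp_congr (forall₂_congr fun i _ => not_congr (hy.eq_null_iff i))
          (hr.exists_row_iff fun z u hu hz =>
            and_congr (forall₂_congr fun i _ => hz.eq_iff hx i i)
              (forall₂_congr fun i _ => hz.eq_iff hy i i)))

theorem UniformlyDefinable.containsGroundings (Z : Finset (Fin n)) :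
    UniformlyDefinable.{u} fun S r (_ : Empty → RelUniverse S r) =>
      S.ContainsGroundings Z r := by
  have h : UniformlyDefinable.{u} fun S r (_ : Empty → RelUniverse S r) =>
      ∀ x : Fin n → RelUniverse S r, multOf x ≠ 0 → ∀ y : Fin n → RelUniverse S r,
        (∀ i ∈ Z, (InDom S r i (y i) ∧ ¬ y i = nullElem S r) ∧
          (x i = nullElem S r ∨ x i = y i)) →
          ∃ z : Fin n → RelUniverse S r, multOf z ≠ 0 ∧ ∀ i ∈ Z, z i = y i :=
    .all (.imp (.multOf_ne_zero _) (.all (.imp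
      (.forallFinset _ fun i => .and (.and (.inDom _ _) (.not (.eq_null _)))
        (.or (.eq_null _) (.eq _ _)))
      (.ex (.and (.multOf_ne_zero _) (.forallFinset _ fun i => .eq _ _))))))
  refine h.congr fun V S r hr v => ?_
  refine hr.forall_row_iff fun x t ht hx => ?_
  have hval : ∀ (z : Fin n → RelUniverse S r) (u : Tuple (Fin n) V), IsTuple z u →
      ∀ i j b (hb : b ∈ S.dom j),
        z i = Sum.inl ⟨some b, Or.inr ⟨j, b, hb, rfl⟩⟩ ↔ u i = some b := by
    intro z u hz i j b hb
    obtain ⟨a, h1, h2⟩ := hz i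
    rw [h1, h2]
    exact symbol_inj
  -- Defaults outside `Z`, where `s` may leave the domains and the entries of `y` may even be
  -- numbers.
  obtain ⟨d, hd, -⟩ := S.exists_avoid fun _ => none
  constructor
  · intro H s hs
    have hs' : ∀ i, (if i ∈ Z then s i else d i) ∈ S.dom i := by
      intro i
      split_ifs with hi
      · exact (hs i hi).1
      · exact hd i
    obtain ⟨z, hz, hzZ⟩ := H (fun i => Sum.inl ⟨some (if i ∈ Z then s i else d i),
        Or.inr ⟨i, _, hs' i, rfl⟩⟩) (by
      intro i hi
      refine ⟨inDom_and_ne_null_iff.2 ⟨_, hs' i, rfl⟩, ?_⟩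
      refine Or.imp (hx.eq_null_iff i).2 (fun h => ?_) (hs i hi).2
      rw [hval x t hx i i _ (hs' i), h, if_pos hi])
    obtain ⟨u, hu, hzu⟩ := multOf_ne_zero_iff.1 hz
    refine ⟨u, hu, fun i hi => ?_⟩
    have := (hval z u hzu i i _ (hs' i)).1 (hzZ i hi)
    rwa [if_pos hi] at this
  · intro H y hy
    have hy' : ∀ i, ∃ b, ∃ hb : b ∈ S.dom i, i ∈ Z →
        y i = Sum.inl ⟨some b, Or.inr ⟨i, b, hb, rfl⟩⟩ := by
      intro i
      by_cases hi : i ∈ Z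
      · obtain ⟨b, hb, h⟩ := inDom_and_ne_null_iff.1 (hy i hi).1
        exact ⟨b, hb, fun _ => h⟩
      · exact ⟨d i, hd i, fun h => absurd h hi⟩
    choose b hb hyb using hy'
    obtain ⟨u, hu, hub⟩ := H b fun i hi => ⟨hb i,
      Or.imp (hx.eq_null_iff i).1 (fun h => (hval x t hx i i _ (hb i)).1
        (h.trans (hyb i hi))) (hy i hi).2⟩
    obtain ⟨z, hz⟩ := hr.exists_isTuple hu
    refine ⟨z, multOf_ne_zero_iff.2 ⟨u, hu, hz⟩, fun i hi => ?_⟩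
    rw [hyb i hi, hval z u hz i i _ (hb i)]
    exact hub i hi

theorem satCIA_inFO (X Y : Finset (Fin n)) :
    InFO.{u} (n := n) fun S r => S.SatCIA X Y r := by
  apply UniformlyDefinable.inFO
  exact ((UniformlyDefinable.constOn X).or ((UniformlyDefinable.constOn Y).or
    ((UniformlyDefinable.combines X Y).and
      (UniformlyDefinable.containsGroundings (X ∪ Y))))).congr
    fun V S r hr v => (Schema.satCIA_iff hr).symm

end FirstOrderDefinability

end IncompleteRel

/-! ### Logic with counting on words, and the stacks of a machine that evaluates it. -/

/-- Formulas about a word over the alphabet `A` whose variables denote positions and numbers up to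
the length of the word. In `letCount i φ ψ` the variable `i` is bound: it ranges over the positions
of the word in `φ`, and it denotes the number of positions satisfying `φ` in `ψ`. -/
inductive WordFormula (A : Type) (m : ℕ) : Type
  | sym (i : Fin m) (a : A)
  | lt (i j : Fin m)
  | not (φ : WordFormula A m)
  | and (φ ψ : WordFormula A m)
  | letCount (i : Fin m) (φ ψ : WordFormula A m)

namespace WordFormula

variable {A : Type} {m : ℕ}

open Classical in
/-- Truth of a formula in a word under an assignment. -/
noncomputable def Holds (w : List A) : (Fin m → ℕ) → WordFormula A m → Prop
  | v, sym i a => w[v i]? = some a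
  | v, lt i j => v i < v j
  | v, not φ => ¬ Holds w v φ
  | v, and φ ψ => Holds w v φ ∧ Holds w v ψ
  | v, letCount i φ ψ =>
    Holds w (Function.update v i
      (Nat.count (fun p => Holds w (Function.update v i p) φ) w.length)) ψ

/-- The variables that are bound under `d` binders are named `d`, and no variable is compared with
itself. -/
def WellFormed : ℕ → WordFormula A m → Prop
  | _, sym _ _ => True
  | _, lt i j => i ≠ j
  | d, not φ => φ.WellFormed d
  | d, and φ ψ => φ.WellFormed d ∧ ψ.WellFormed d
  | d, letCount i φ ψ => i.val = d ∧ φ.WellFormed (d + 1) ∧ ψ.WellFormed (d + 1)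

/-- The heads of the machine: each has its own copy of the input word. There is one head for each
variable, one for counting in the scope of each variable, and one for auxiliary use. -/
inductive Head (m : ℕ) : Type
  | var (i : Fin m)
  | ctr (i : Fin m)
  | aux
  deriving DecidableEq, Fintype

/-- The stacks of the machine: input, output, and for each head the part of the word to its left
(reversed) and the part of the word to its right. -/
inductive Stack (m : ℕ) : Type
  | inp
  | out
  | left (h : Head m)
  | right (h : Head m)
  deriving DecidableEq, Fintype

/-- The alphabets of the stacks. -/
abbrev StackSym (A : Type) {m : ℕ} : Stack m → Type
  | .inp => A
  | .out => Bool
  | .left _ => A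
  | .right _ => A

/-- Local memory: a register for a symbol, and a truth value. -/
abbrev Mem (A : Type) : Type := Option A × Bool

/-- Statements of the machine. -/
abbrev Code (A : Type) (m : ℕ) (Λ : Type) : Type := TM2.Stmt (StackSym A (m := m)) Λ (Mem A)

/-- The contents of all stacks. -/
def fam (I : List A) (O : List Bool) (L R : Head m → List A) : ∀ k : Stack m, List (StackSym A k)
  | .inp => I
  | .out => O
  | .left h => L h
  | .right h => R h

/-- The contents of the headStacks when the heads are at the given positions of the word. -/
def headStacks (w : List A) (pos : Head m → ℕ) : ∀ k : Stack m, List (StackSym A k) :=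
  fam [] [] (fun h => (w.take (pos h)).reverse) (fun h => w.drop (pos h))

section Updates

variable {I : List A} {O : List Bool} {L R : Head m → List A}

theorem update_fam_inp (l : List A) :
    Function.update (fam I O L R) .inp l = fam l O L R := by
  funext k; cases k <;> simp [Function.update, fam]

theorem update_fam_out (l : List Bool) :
    Function.update (fam I O L R) .out l = fam I l L R := by
  funext k; cases k <;> simp [Function.update, fam]

theorem update_fam_left (h : Head m) (l : List A) :
    Function.update (fam I O L R) (.left h) l = fam I O (Function.update L h l) R := by
  funext k
  cases k with
  | left h' =>
    by_cases e : h' = h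
    · subst e; simp [fam]
    · simp [fam, e]
  | _ => simp [Function.update, fam]

theorem update_fam_right (h : Head m) (l : List A) :
    Function.update (fam I O L R) (.right h) l = fam I O L (Function.update R h l) := by
  funext k
  cases k with
  | right h' =>
    by_cases e : h' = h
    · subst e; simp [fam]
    · simp [fam, e]
  | _ => simp [Function.update, fam]

end Updates

/-! ### Moving and testing heads. -/

section Instructions

variable [Inhabited A] {Λ : Type}

/-- Forget the content of the register. -/
def clear (q : Code A m Λ) : Code A m Λ := .load (fun s => (none, s.2)) q

/-- Move a head to the left. -/
def moveLeft (h : Head m) (q : Code A m Λ) : Code A m Λ :=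
  .pop (.left h) (fun s x => (x, s.2)) (.push (.right h) (fun s => s.1.getD (default : A)) (clear q))

/-- Move a head to the right. -/
def moveRight (h : Head m) (q : Code A m Λ) : Code A m Λ :=
  .pop (.right h) (fun s x => (x, s.2)) (.push (.left h) (fun s => s.1.getD (default : A)) (clear q))

/-- Test whether a head is at the left end. -/
def ifStart (h : Head m) (q₁ q₂ : Code A m Λ) : Code A m Λ :=
  .peek (.left h) (fun s x => (x, s.2)) (.branch (fun s => s.1.isNone) (clear q₁) (clear q₂))

/-- Test whether a head is at the right end. -/
def ifEnd (h : Head m) (q₁ q₂ : Code A m Λ) : Code A m Λ :=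
  .peek (.right h) (fun s x => (x, s.2)) (.branch (fun s => s.1.isNone) (clear q₁) (clear q₂))

/-- Jump to a label. -/
def jump (l : Λ) : Code A m Λ := .goto fun _ => l

/-- Set the truth value. -/
def setFlag (b : Bool) (q : Code A m Λ) : Code A m Λ := .load (fun s => (s.1, b)) q

variable {w : List A} {pos : Head m → ℕ} {b : Bool}

/-- A head is a cut of the word into two stacks, and moving it carries one symbol across. The
register is empty before and after, so a configuration is described by positions and the truth
value. -/
theorem stepAux_moveLeft {h : Head m} {q : Code A m Λ} (h0 : 0 < pos h) (h1 : pos h ≤ w.length) :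
    TM2.stepAux (moveLeft h q) (none, b) (headStacks w pos) =
      TM2.stepAux q (none, b) (headStacks w (Function.update pos h (pos h - 1))) := by
  obtain ⟨n, hn⟩ : ∃ n, pos h = n + 1 := ⟨pos h - 1, by omega⟩
  have hlt : n < w.length := by omega
  have e1 : (w.take (pos h)).reverse = w[n] :: (w.take n).reverse := by
    rw [hn, List.take_succ_eq_append_getElem hlt]; simp
  have e2 : w.drop n = w[n] :: w.drop (pos h) := by
    rw [hn, List.drop_eq_getElem_cons hlt]
  have hS : Function.update (Function.update (headStacks w pos) (.left h) (w.take n).reverse)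
      (.right h) (w.drop n) = headStacks w (Function.update pos h (pos h - 1)) := by
    rw [headStacks, update_fam_left, update_fam_right, headStacks]
    congr 1 <;> funext k <;> by_cases e : k = h <;> simp [e, hn]
  rw [← hS]
  simp only [moveLeft, clear, TM2.stepAux]
  have e3 : headStacks w pos (.left h) = w[n] :: (w.take n).reverse := e1
  have e4 : headStacks w pos (.right h) = w.drop (pos h) := rfl
  rw [e3]
  simp only [List.head?_cons, List.tail_cons, Option.getD_some]
  rw [Function.update_of_ne (by simp), e4, e2]

theorem stepAux_moveRight {h : Head m} {q : Code A m Λ} (h1 : pos h < w.length) :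
    TM2.stepAux (moveRight h q) (none, b) (headStacks w pos) =
      TM2.stepAux q (none, b) (headStacks w (Function.update pos h (pos h + 1))) := by
  have e1 : (w.take (pos h + 1)).reverse = w[pos h] :: (w.take (pos h)).reverse := by
    rw [List.take_succ_eq_append_getElem h1]; simp
  have e2 : w.drop (pos h) = w[pos h] :: w.drop (pos h + 1) := List.drop_eq_getElem_cons h1
  have hS : Function.update (Function.update (headStacks w pos) (.right h) (w.drop (pos h + 1)))
      (.left h) (w.take (pos h + 1)).reverse =
        headStacks w (Function.update pos h (pos h + 1)) := by
    rw [headStacks, update_fam_right, update_fam_left, headStacks]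
    congr 1 <;> funext k <;> by_cases e : k = h <;> simp [e]
  rw [← hS]
  simp only [moveRight, clear, TM2.stepAux]
  have e3 : headStacks w pos (.right h) = w[pos h] :: w.drop (pos h + 1) := e2
  have e4 : headStacks w pos (.left h) = (w.take (pos h)).reverse := rfl
  rw [e3]
  simp only [List.head?_cons, List.tail_cons, Option.getD_some]
  rw [Function.update_of_ne (by simp), e4, e1]

omit [Inhabited A] in
theorem stepAux_ifStart {h : Head m} {q₁ q₂ : Code A m Λ} (h1 : pos h ≤ w.length) :
    TM2.stepAux (ifStart h q₁ q₂) (none, b) (headStacks w pos) =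
      if pos h = 0 then TM2.stepAux q₁ (none, b) (headStacks w pos)
      else TM2.stepAux q₂ (none, b) (headStacks w pos) := by
  have e : headStacks w pos (.left h) = (w.take (pos h)).reverse := rfl
  simp only [ifStart, clear, TM2.stepAux]
  rw [e]
  split_ifs with h0
  · simp [h0]
  · have : (w.take (pos h)).reverse.head?.isNone = false := by
      rw [List.head?_reverse]
      rw [Bool.eq_false_iff]
      simp only [ne_eq, Option.isNone_iff_eq_none, List.getLast?_eq_none_iff, List.take_eq_nil_iff]
      rintro (h2 | h2)
      · exact h0 h2
      · simp [h2] at h1; exact h0 h1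
    rw [this]
    rfl

omit [Inhabited A] in
theorem stepAux_ifEnd {h : Head m} {q₁ q₂ : Code A m Λ} :
    TM2.stepAux (ifEnd h q₁ q₂) (none, b) (headStacks w pos) =
      if w.length ≤ pos h then TM2.stepAux q₁ (none, b) (headStacks w pos)
      else TM2.stepAux q₂ (none, b) (headStacks w pos) := by
  have e : headStacks w pos (.right h) = w.drop (pos h) := rfl
  simp only [ifEnd, clear, TM2.stepAux]
  rw [e]
  split_ifs with h0
  · simp [List.drop_eq_nil_of_le h0]
  · have : (w.drop (pos h)).head?.isNone = false := by
      simp [Bool.eq_false_iff, h0]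
    rw [this]
    rfl

theorem stepAux_foldr_moveRight {hs : List (Head m)} {q : Code A m Λ} (hnd : hs.Nodup)
    (h1 : ∀ h ∈ hs, pos h < w.length) :
    TM2.stepAux (hs.foldr moveRight q) (none, b) (headStacks w pos) =
      TM2.stepAux q (none, b) (headStacks w fun h => if h ∈ hs then pos h + 1 else pos h) := by
  induction hs generalizing pos with
  | nil => simp
  | cons a hs ih =>
    rw [List.foldr_cons, stepAux_moveRight (h1 a (by simp)), ih (List.nodup_cons.1 hnd).2]
    · congr 2
      funext h
      by_cases e : h = a
      · subst e; simp [(List.nodup_cons.1 hnd).1]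
      · simp [e]
    · intro h hh
      have : h ≠ a := by
        rintro rfl
        exact (List.nodup_cons.1 hnd).1 hh
      rw [Function.update_of_ne this]
      exact h1 h (by simp [hh])

end Instructions

/-! ### Reachability within a number of steps. -/

section Running

variable {K : Type} [DecidableEq K] {Γ : K → Type} {Λ σ : Type}

/-- The machine gets from one configuration to the other in at most `t` steps. -/
def ReachesIn (M : Λ → TM2.Stmt Γ Λ σ) (t : ℕ) (c c' : TM2.Cfg Γ Λ σ) : Prop :=
  ∃ k ≤ t, (flip bind (TM2.step M))^[k] (some c) = some c'

variable {M : Λ → TM2.Stmt Γ Λ σ} {c c' c'' : TM2.Cfg Γ Λ σ} {s t : ℕ}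

theorem ReachesIn.refl : ReachesIn M 0 c c := ⟨0, le_rfl, rfl⟩

theorem ReachesIn.trans (h : ReachesIn M s c c') (h' : ReachesIn M t c' c'') :
    ReachesIn M (s + t) c c'' := by
  obtain ⟨k, hk, e⟩ := h
  obtain ⟨l, hl, e'⟩ := h'
  exact ⟨l + k, by omega, by rw [Function.iterate_add_apply, e, e']⟩

theorem ReachesIn.mono (h : ReachesIn M s c c') (hst : s ≤ t) : ReachesIn M t c c' := by
  obtain ⟨k, hk, e⟩ := h
  exact ⟨k, hk.trans hst, e⟩

theorem ReachesIn.step {l : Λ} {x : σ} {S : ∀ k, List (Γ k)}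
    (h : TM2.stepAux (M l) x S = c) : ReachesIn M 1 ⟨some l, x, S⟩ c :=
  ⟨1, le_rfl, by simp [flip, h]⟩

end Running

/-! ### Compilation of formulas to programs. -/

section Compilation

variable [Inhabited A]

/-- The loop that moves the head `a` to the left end, and the heads `hs` to the right by the same
number of positions. -/
theorem reachesIn_drain {Λ : Type} {M : Λ → Code A m Λ} {w : List A} {a : Head m}
    {hs : List (Head m)} {l y : Λ}
    (hM : M l = ifStart a (jump y) (moveLeft a (hs.foldr moveRight (jump l))))
    (hnd : hs.Nodup) (ha : a ∉ hs) {b : Bool} (pos : Head m → ℕ) (hle : pos a ≤ w.length)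
    (h1 : ∀ h ∈ hs, pos h + pos a ≤ w.length) :
    ReachesIn M (pos a + 1) ⟨some l, (none, b), headStacks w pos⟩ ⟨some y, (none, b), headStacks w fun h =>
      if h = a then 0 else if h ∈ hs then pos h + pos a else pos h⟩ := by
  induction hn : pos a generalizing pos with
  | zero =>
    apply ReachesIn.step
    rw [hM, stepAux_ifStart hle, if_pos hn]
    simp only [jump, TM2.stepAux, TM2.Cfg.mk.injEq, true_and]
    congr 1
    funext h
    by_cases e : h = a
    · subst e; simp [hn]
    · simp [e]
  | succ n ih =>
    have hstep : ReachesIn M 1 ⟨some l, (none, b), headStacks w pos⟩ ⟨some l, (none, b), headStacks w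
        fun h => if h ∈ hs then Function.update pos a n h + 1 else Function.update pos a n h⟩ := by
      apply ReachesIn.step
      rw [hM, stepAux_ifStart hle, if_neg (by omega), stepAux_moveLeft (by omega) hle,
        stepAux_foldr_moveRight hnd]
      · simp [jump, hn]
      · intro h hh
        have hne : h ≠ a := fun e => ha (e ▸ hh)
        have := h1 h hh
        rw [Function.update_of_ne hne]
        omega
    have := ih (fun h => if h ∈ hs then Function.update pos a n h + 1
      else Function.update pos a n h) (by simp [ha]; omega) (by
        intro h hh
        have hne : h ≠ a := fun e => ha (e ▸ hh)
        have := h1 h hh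
        simp [hh, ha, hne]
        omega) (by simp [ha])
    have H := (hstep.trans this).mono (t := n + 1 + 1) (by omega)
    convert H using 3
    funext h
    by_cases e : h = a
    · simp [e]
    · by_cases hh : h ∈ hs
      · simp [e, hh]; omega
      · simp [e, hh]

variable [DecidableEq A]

/-- The labels of the program of a formula. -/
abbrev Label : WordFormula A m → Type
  | sym _ _ => Unit
  | lt _ _ => Bool
  | not φ => Label φ ⊕ Unit
  | and φ ψ => Label φ ⊕ Label ψ ⊕ Unit
  | letCount _ φ ψ => Label φ ⊕ Label ψ ⊕ Fin 5

omit [Inhabited A] [DecidableEq A] in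
theorem finite_label (φ : WordFormula A m) : Finite (Label φ) := by
  induction φ with
  | sym => exact inferInstanceAs (Finite Unit)
  | lt => exact inferInstanceAs (Finite Bool)
  | not φ ih => exact @Finite.instSum _ _ ih _
  | and φ ψ ih ih' => exact @Finite.instSum _ _ ih (@Finite.instSum _ _ ih' _)
  | letCount i φ ψ ih ih' => exact @Finite.instSum _ _ ih (@Finite.instSum _ _ ih' _)

/-- The label where the program of a formula starts. -/
def entry : (φ : WordFormula A m) → Label φ
  | sym _ _ => ()
  | lt _ _ => false
  | not φ => Sum.inl (entry φ)
  | and φ _ => Sum.inl (entry φ)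
  | letCount _ _ _ => Sum.inr (Sum.inr 0)

/-- The program of a formula, as part of a program with labels `Λ`: it evaluates the formula, leaves
its truth value in the local memory, and jumps to `x`. -/
def code {Λ : Type} : (φ : WordFormula A m) → (Label φ → Λ) → Λ → Label φ → Code A m Λ
  | sym i a, _, x, _ =>
    .peek (.right (.var i)) (fun _ (y : Option A) => (none, decide (y = some a))) (jump x)
  | lt i j, e, x, l => match l with
    | false =>
      ifStart (.var j) (setFlag false (jump (e true)))
        (ifStart (.var i) (setFlag true (jump (e true)))
          (moveLeft (.var i) (moveLeft (.var j) (moveRight .aux (jump (e false))))))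
    | true => ifStart .aux (jump x)
        (moveLeft .aux ([.var i, .var j].foldr moveRight (jump (e true))))
  | not φ, e, x, l => match l with
    | .inl l => code φ (fun l => e (.inl l)) (e (.inr ())) l
    | .inr () => .load (fun s => (s.1, !s.2)) (jump x)
  | and φ ψ, e, x, l => match l with
    | .inl l => code φ (fun l => e (.inl l)) (e (.inr (.inr ()))) l
    | .inr (.inl l) => code ψ (fun l => e (.inr (.inl l))) x l
    | .inr (.inr ()) => .branch (fun s => s.2) (jump (e (.inr (.inl (entry ψ))))) (jump x)
  | letCount i φ ψ, e, x, l => match l with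
    | .inl l => code φ (fun l => e (.inl l)) (e (.inr (.inr 1))) l
    | .inr (.inl l) => code ψ (fun l => e (.inr (.inl l))) (e (.inr (.inr 4))) l
    | .inr (.inr 0) => ifEnd (.var i) (jump (e (.inr (.inr 2)))) (jump (e (.inl (entry φ))))
    | .inr (.inr 1) => .branch (fun s => s.2)
        (moveRight (.ctr i) (moveRight (.var i) (jump (e (.inr (.inr 0))))))
        (moveRight (.var i) (jump (e (.inr (.inr 0)))))
    | .inr (.inr 2) => ifStart (.var i) (jump (e (.inr (.inr 3))))
        (moveLeft (.var i) ([].foldr moveRight (jump (e (.inr (.inr 2))))))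
    | .inr (.inr 3) => ifStart (.ctr i) (jump (e (.inr (.inl (entry ψ)))))
        (moveLeft (.ctr i) ([.var i].foldr moveRight (jump (e (.inr (.inr 3))))))
    | .inr (.inr 4) => ifStart (.var i) (jump x)
        (moveLeft (.var i) ([].foldr moveRight (jump (e (.inr (.inr 4))))))

/-- A bound for the running time of the program of a formula. -/
noncomputable def timeBound : WordFormula A m → Polynomial ℕ
  | sym _ _ => 1
  | lt _ _ => 2 * .X + 2
  | not φ => timeBound φ + 1
  | and φ ψ => timeBound φ + timeBound ψ + 1
  | letCount _ φ ψ => .X * (timeBound φ + 2) + timeBound ψ + 3 * .X + 4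

open Classical in
-- Both heads step left together until one reaches the left end. The head of `j` is tested first, so
-- a tie counts as false. The distance travelled is the minimum of the two positions, and `aux`
-- records it for the way back. If `i` and `j` were equal, the one head would move twice in a round.
theorem reachesIn_lt {Λ : Type} {M : Λ → Code A m Λ} {w : List A} {i j : Fin m} {e : Bool → Λ}
    {x : Λ} (hM : ∀ l, M (e l) = code (lt i j) e x l) (hij : i ≠ j) {b : Bool}
    (pos : Head m → ℕ) (hle : ∀ h, pos h ≤ w.length)
    (hi : pos .aux + pos (.var i) ≤ w.length) (hj : pos .aux + pos (.var j) ≤ w.length) :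
    ReachesIn M (pos (.var j) + 1) ⟨some (e false), (none, b), headStacks w pos⟩
      ⟨some (e true), (none, decide (pos (.var i) < pos (.var j))), headStacks w fun h =>
        if h = .var i ∨ h = .var j then pos h - min (pos (.var i)) (pos (.var j))
        else if h = .aux then pos h + min (pos (.var i)) (pos (.var j)) else pos h⟩ := by
  induction hn : pos (.var j) generalizing pos with
  | zero =>
    apply ReachesIn.step
    rw [hM]
    simp only [code]
    rw [stepAux_ifStart (hle _), if_pos hn]
    simp [setFlag, jump]
  | succ n ih =>
    by_cases h0 : pos (.var i) = 0
    · refine (ReachesIn.step ?_).mono (by omega : 1 ≤ n + 1 + 1)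
      rw [hM]
      simp only [code]
      rw [stepAux_ifStart (hle _), if_neg (by omega), stepAux_ifStart (hle _), if_pos h0]
      simp [setFlag, jump, h0]
    · have hne : (Head.var j : Head m) ≠ .var i := by simpa using hij.symm
      set pos' : Head m → ℕ := fun h => if h = .var i ∨ h = .var j then pos h - 1 else
        if h = .aux then pos h + 1 else pos h with hpos'
      have hstep : ReachesIn M 1 ⟨some (e false), (none, b), headStacks w pos⟩
          ⟨some (e false), (none, b), headStacks w pos'⟩ := by
        apply ReachesIn.step
        rw [hM]
        simp only [code]
        rw [stepAux_ifStart (hle _), if_neg (by omega), stepAux_ifStart (hle _), if_neg h0,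
          stepAux_moveLeft (by omega) (hle _), stepAux_moveLeft, stepAux_moveRight]
        · simp only [jump, TM2.stepAux, TM2.Cfg.mk.injEq, true_and]
          congr 1
          funext h
          simp only [hpos', Function.update_apply]
          by_cases e1 : h = .var i
          · subst e1; simp [hne.symm]
          · by_cases e2 : h = .var j
            · subst e2; simp [hne]
            · by_cases e3 : h = .aux <;> simp [e1, e2, e3]
        · simp [Function.update_apply]; omega
        · rw [Function.update_of_ne hne]; omega
        · rw [Function.update_of_ne hne]; exact hle _
      have hi' : pos' (.var i) = pos (.var i) - 1 := by simp [hpos']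
      have hj' : pos' (.var j) = n := by simp [hpos', hn]
      have ha' : pos' .aux = pos .aux + 1 := by simp [hpos']
      have := ih pos' (by
          intro h
          have := hle h
          simp only [hpos']
          split_ifs with e1 e2
          · omega
          · subst e2; omega
          · omega)
        (by omega) (by omega) hj'
      have H := (hstep.trans this).mono (t := n + 1 + 1) (by omega)
      rw [hi'] at H
      have hd : decide (pos (.var i) < n + 1) = decide (pos (.var i) - 1 < n) := by
        simp only [decide_eq_decide]; omega
      rw [hd]
      convert H using 3
      funext h
      by_cases e1 : h = .var i
      · subst e1; simp [hpos']; omega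
      · by_cases e2 : h = .var j
        · subst e2; simp [hpos', hn]; omega
        · by_cases e3 : h = .aux
          · subst e3; simp [hpos']; omega
          · simp [e1, e2, e3, hpos']

open Classical in
-- Invariant of the induction: a program restores all heads and changes only the truth value. As
-- bound variables are named by depth, the heads with index at least `d` are free and stand at the
-- left end, where a counting loop has to start. The position `w.length` is allowed because a count
-- may take this value; a symbol test then meets an empty stack and fails.
theorem reachesIn_code {Λ : Type} {M : Λ → Code A m Λ} {w : List A} (φ : WordFormula A m) {d : ℕ}
    (hφ : φ.WellFormed d) {e : Label φ → Λ} {x : Λ} (hM : ∀ l, M (e l) = code φ e x l) {b : Bool}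
    (pos : Head m → ℕ) (hle : ∀ h, pos h ≤ w.length)
    (h0 : ∀ i : Fin m, d ≤ i → pos (.var i) = 0 ∧ pos (.ctr i) = 0) (haux : pos .aux = 0) :
    ReachesIn M (φ.timeBound.eval w.length) ⟨some (e (entry φ)), (none, b), headStacks w pos⟩
      ⟨some x, (none, decide (φ.Holds w fun i => pos (.var i))), headStacks w pos⟩ := by
  induction φ generalizing d x b pos with
  | sym i a =>
    refine (ReachesIn.step ?_).mono (by simp [timeBound])
    rw [hM]
    have e1 : headStacks w pos (.right (.var i)) = w.drop (pos (.var i)) := rfl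
    simp only [code, jump, TM2.stepAux]
    rw [e1]
    simp only [Holds, List.head?_drop]
    congr!
    exact decide_eq_decide.2 Iff.rfl
  | lt i j =>
    have hij : i ≠ j := hφ
    have hne : (Head.var j : Head m) ≠ .var i := by simpa using hij.symm
    have h1 := reachesIn_lt (b := b) hM hij pos hle (by have := hle (.var i); omega)
      (by have := hle (.var j); omega)
    -- `aux` holds the minimum, so draining it returns both heads to their places.
    have h2 := reachesIn_drain (w := w) (a := .aux) (hs := [.var i, .var j]) (hM true)
      (by simpa using hij) (by simp) (b := decide (pos (.var i) < pos (.var j))) (fun h =>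
        if h = .var i ∨ h = .var j then pos h - min (pos (.var i)) (pos (.var j))
        else if h = .aux then pos h + min (pos (.var i)) (pos (.var j)) else pos h)
      (by simp [haux]; exact Or.inl (hle _))
      (by
        have := hle (.var i)
        have := hle (.var j)
        simp [haux]
        omega)
    have H := (h1.trans h2).mono (t := (lt (A := A) i j).timeBound.eval w.length) (by
      have := hle (.var j)
      simp [haux, timeBound]
      omega)
    have hd : decide ((lt i j).Holds w fun i => pos (.var i)) =
        decide (pos (.var i) < pos (.var j)) := decide_eq_decide.2 Iff.rfl
    rw [hd]
    refine Eq.mp ?_ H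
    congr 2
    refine congrArg _ (funext fun h => ?_)
    by_cases e1 : h = .var i
    · subst e1; simp [haux]
    · by_cases e2 : h = .var j
      · subst e2; simp [haux]
      · by_cases e3 : h = .aux
        · subst e3; simp [haux]
        · simp [e1, e2, e3]
  | not φ ih =>
    have h1 := ih (x := e (.inr ())) (e := fun l => e (.inl l)) (b := b) hφ
      (fun l => hM (.inl l)) pos hle h0 haux
    refine (h1.trans (ReachesIn.step ?_)).mono ?_ (t := (not φ).timeBound.eval w.length)
    · rw [hM]
      by_cases hp : φ.Holds w fun i => pos (.var i) <;> simp [code, jump, Holds, hp]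
    · simp [timeBound]
  | and φ ψ ih ih' =>
    have h1 := ih (x := e (.inr (.inr ()))) (e := fun l => e (.inl l)) (b := b) hφ.1
      (fun l => hM (.inl l)) pos hle h0 haux
    by_cases hp : φ.Holds w fun i => pos (.var i)
    · have h2 := ih' (x := x) (e := fun l => e (.inr (.inl l))) (b := true) hφ.2
        (fun l => hM (.inr (.inl l))) pos hle h0 haux
      have h3 : ReachesIn M 1 ⟨some (e (.inr (.inr ()))),
          (none, decide (φ.Holds w fun i => pos (.var i))), headStacks w pos⟩
          ⟨some (e (.inr (.inl (entry ψ)))), (none, true), headStacks w pos⟩ := by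
        apply ReachesIn.step
        rw [hM]
        simp [code, jump, hp]
      have H := ((h1.trans h3).trans h2).mono (t := (and φ ψ).timeBound.eval w.length) (by
        simp [timeBound]; omega)
      have h4 : (and φ ψ).Holds w (fun i => pos (.var i)) ↔ ψ.Holds w fun i => pos (.var i) :=
        and_iff_right hp
      simp only [h4]
      exact H
    · refine (h1.trans (ReachesIn.step ?_)).mono ?_ (t := (and φ ψ).timeBound.eval w.length)
      · rw [hM]
        simp [code, jump, hp, Holds]
      · simp [timeBound]
  | letCount i φ ψ ih ih' =>
    obtain ⟨hid, hφ1, hφ2⟩ := hφ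
    obtain ⟨hv0, hc0⟩ := h0 i hid.ge
    set v : Fin m → ℕ := fun i => pos (.var i) with hv
    set P : ℕ → Prop := fun p => φ.Holds w (Function.update v i p) with hP
    -- the positions of the heads after `k` rounds of the counting loop
    set posK : ℕ → Head m → ℕ := fun k =>
      Function.update (Function.update pos (.var i) k) (.ctr i) (Nat.count P k) with hposK
    have hvar : ∀ k, (fun j => posK k (.var j)) = Function.update v i k := by
      intro k
      funext j
      by_cases hj : j = i
      · subst hj; simp [hposK]
      · simp [hposK, hj, hv]
    have hposle : ∀ k ≤ w.length, ∀ h, posK k h ≤ w.length := by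
      intro k hk h
      simp only [hposK, Function.update_apply]
      split_ifs
      · exact (Nat.count_le _).trans hk
      · exact hk
      · exact hle h
    -- The two extra steps of a round are the end test and the update of the counter; `b'` is left
    -- over from the last evaluation.
    have hloop : ∀ k ≤ w.length, ∃ b', ReachesIn M (k * (φ.timeBound.eval w.length + 2))
        ⟨some (e (.inr (.inr 0))), (none, b), headStacks w pos⟩
        ⟨some (e (.inr (.inr 0))), (none, b'), headStacks w (posK k)⟩ := by
      intro k
      induction k with
      | zero =>
        intro _
        refine ⟨b, ?_⟩
        have : posK 0 = pos := by
          funext h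
          simp only [hposK, Function.update_apply, Nat.count_zero]
          split_ifs with e1 e2
          · rw [e1, hc0]
          · rw [e2, hv0]
          · rfl
        rw [this]
        exact ReachesIn.refl.mono (by simp)
      | succ k ihk =>
        intro hk
        obtain ⟨b', hb'⟩ := ihk (by omega)
        have hstart : ReachesIn M 1
            ⟨some (e (.inr (.inr 0))), (none, b'), headStacks w (posK k)⟩
            ⟨some (e (.inl (entry φ))), (none, b'), headStacks w (posK k)⟩ := by
          apply ReachesIn.step
          rw [hM]
          simp only [code]
          rw [stepAux_ifEnd, if_neg (by simp [hposK]; omega)]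
          rfl
        have heval := ih (x := e (.inr (.inr 1))) (e := fun l => e (.inl l)) (b := b') hφ1
          (fun l => hM (.inl l)) (posK k) (hposle k (by omega)) (by
            intro j hj
            have hji : j ≠ i := by
              rintro rfl
              omega
            obtain ⟨h1, h2⟩ := h0 j (by omega)
            simp [hposK, hji, h1, h2]) (by simp [hposK, haux])
        rw [hvar k] at heval
        have hend : ReachesIn M 1
            ⟨some (e (.inr (.inr 1))), (none, decide (P k)), headStacks w (posK k)⟩
            ⟨some (e (.inr (.inr 0))), (none, decide (P k)), headStacks w (posK (k + 1))⟩ := by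
          apply ReachesIn.step
          rw [hM]
          simp only [code, TM2.stepAux]
          have hv1 : posK k (.var i) = k := by simp [hposK]
          have hc1 : posK k (.ctr i) = Nat.count P k := by simp [hposK]
          have hcle : Nat.count P k ≤ k := Nat.count_le _
          by_cases hPk : P k
          · simp only [hPk, decide_true, cond_true]
            rw [stepAux_moveRight (by omega), stepAux_moveRight (by simp [hv1]; omega)]
            simp only [jump, TM2.stepAux, TM2.Cfg.mk.injEq, true_and]
            congr 1
            funext h
            by_cases e1 : h = .var i
            · subst e1; simp [hposK]
            · by_cases e2 : h = .ctr i
              · subst e2; simp [hposK, Nat.count_succ, hPk]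
              · simp [hposK, e1, e2]
          · simp only [hPk, decide_false, cond_false]
            rw [stepAux_moveRight (by omega)]
            simp only [jump, TM2.stepAux, TM2.Cfg.mk.injEq, true_and]
            congr 1
            funext h
            by_cases e1 : h = .var i
            · subst e1; simp [hposK]
            · by_cases e2 : h = .ctr i
              · subst e2; simp [hposK, Nat.count_succ, hPk]
              · simp [hposK, e1, e2]
        refine ⟨decide (P k), ((hb'.trans hstart).trans (heval.trans hend)).mono ?_⟩
        rw [Nat.succ_mul]
        omega
    obtain ⟨b', hcount⟩ := hloop w.length le_rfl
    set N := w.length with hN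
    set C := Nat.count P N with hC
    have hCle : C ≤ N := Nat.count_le _
    have hleave : ReachesIn M 1 ⟨some (e (.inr (.inr 0))), (none, b'), headStacks w (posK N)⟩
        ⟨some (e (.inr (.inr 2))), (none, b'), headStacks w (posK N)⟩ := by
      apply ReachesIn.step
      rw [hM]
      simp only [code]
      rw [stepAux_ifEnd, if_pos (by simp [hposK, hN])]
      rfl
    -- The head of `i` is rewound and then takes over the count while the counter is emptied
    -- (`htr`).
    have hrew := reachesIn_drain (hM (.inr (.inr 2))) (by simp) (by simp) (b := b') (posK N)
      (hposle N le_rfl _) (by simp)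
    have hrew' : (fun h => if h = Head.var i then 0 else
        if h ∈ ([] : List (Head m)) then posK N h + posK N (Head.var i) else posK N h) =
        Function.update pos (.ctr i) C := by
      funext h
      by_cases e1 : h = .var i
      · subst e1; simp [hv0]
      · by_cases e2 : h = .ctr i
        · subst e2; simp [hposK, hC]
        · simp [hposK, e1, e2]
    rw [hrew'] at hrew
    have htr := reachesIn_drain (w := w) (hM (.inr (.inr 3))) (by simp) (by simp) (b := b')
      (Function.update pos (.ctr i) C) (by simpa using hCle) (by simpa [hv0] using hCle)
    have htr' : (fun h => if h = Head.ctr i then 0 else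
        if h ∈ [Head.var i] then Function.update pos (.ctr i) C h +
          Function.update pos (.ctr i) C (Head.ctr i) else Function.update pos (.ctr i) C h) =
        Function.update pos (.var i) C := by
      funext h
      by_cases e1 : h = .var i
      · subst e1; simp [hv0]
      · by_cases e2 : h = .ctr i
        · subst e2; simp [hc0]
        · simp [e1, e2]
    rw [htr'] at htr
    have heval := ih' (x := e (.inr (.inr 4))) (e := fun l => e (.inr (.inl l))) (b := b') hφ2
      (fun l => hM (.inr (.inl l))) (Function.update pos (.var i) C) (by
        intro h
        rw [Function.update_apply]
        split_ifs
        · exact hCle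
        · exact hle h) (by
        intro j hj
        have hji : j ≠ i := by
          rintro rfl
          omega
        obtain ⟨h1, h2⟩ := h0 j (by omega)
        simp [hji, h1, h2]) (by simp [haux])
    have hvar' : (fun j => Function.update pos (.var i) C (.var j)) = Function.update v i C := by
      funext j
      by_cases hj : j = i
      · subst hj; simp
      · simp [hj, hv]
    rw [hvar'] at heval
    -- Rewinding restores the invariant and keeps the truth value of `ψ`.
    have hback := reachesIn_drain (w := w) (hM (.inr (.inr 4))) (by simp) (by simp)
      (b := decide (ψ.Holds w (Function.update v i C))) (Function.update pos (.var i) C)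
      (by simpa using hCle) (by simp)
    have hback' : (fun h => if h = Head.var i then 0 else
        if h ∈ ([] : List (Head m)) then Function.update pos (.var i) C h +
          Function.update pos (.var i) C (Head.var i) else Function.update pos (.var i) C h) =
        pos := by
      funext h
      by_cases e1 : h = .var i
      · subst e1; simp [hv0]
      · simp [e1]
    rw [hback'] at hback
    have hall := (((hcount.trans hleave).trans hrew).trans htr).trans (heval.trans hback)
    -- Leaving the loop takes one step and each of the three drains at most `N + 1`, in total `3 * N
    -- + 4`.
    refine hall.mono ?_
    have h1 : posK N (.var i) = N := by simp [hposK]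
    rw [h1]
    simp [timeBound]
    omega

end Compilation

/-! ### The complete machine: loading, evaluating, cleaning up. -/

section Machine

variable [Inhabited A]

/-- Push the symbol in the register on the right stacks of some heads. -/
def pushRights {Λ : Type} (hs : List (Head m)) (q : Code A m Λ) : Code A m Λ :=
  hs.foldr (fun h q => .push (.right h) (fun s => s.1.getD (default : A)) q) q

/-- Pop a symbol from the right stacks of some heads. -/
def popRights {Λ : Type} (hs : List (Head m)) (q : Code A m Λ) : Code A m Λ :=
  hs.foldr (fun h q => .pop (.right h) (fun s _ => s) q) q

variable {I : List A} {O : List Bool} {L R : Head m → List A} {Λ : Type}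

theorem stepAux_pushRights {hs : List (Head m)} (hnd : hs.Nodup) {q : Code A m Λ} {s : Mem A} :
    TM2.stepAux (pushRights hs q) s (fam I O L R) =
      TM2.stepAux q s (fam I O L fun h => if h ∈ hs then s.1.getD default :: R h else R h) := by
  induction hs generalizing R with
  | nil => simp [pushRights]
  | cons a hs ih =>
    have h1 : TM2.stepAux (pushRights (a :: hs) q) s (fam I O L R) =
        TM2.stepAux (pushRights hs q) s
          (Function.update (fam I O L R) (.right a) (s.1.getD default :: R a)) := rfl
    rw [h1, update_fam_right, ih (List.nodup_cons.1 hnd).2]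
    congr 2
    funext h
    by_cases e : h = a
    · subst e; simp [(List.nodup_cons.1 hnd).1]
    · simp [e]

omit [Inhabited A] in
theorem stepAux_popRights {hs : List (Head m)} (hnd : hs.Nodup) {q : Code A m Λ} {s : Mem A} :
    TM2.stepAux (popRights hs q) s (fam I O L R) =
      TM2.stepAux q s (fam I O L fun h => if h ∈ hs then (R h).tail else R h) := by
  induction hs generalizing R with
  | nil => simp [popRights]
  | cons a hs ih =>
    have h1 : TM2.stepAux (popRights (a :: hs) q) s (fam I O L R) =
        TM2.stepAux (popRights hs q) s
          (Function.update (fam I O L R) (.right a) (R a).tail) := rfl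
    rw [h1, update_fam_right, ih (List.nodup_cons.1 hnd).2]
    congr 2
    funext h
    by_cases e : h = a
    · subst e; simp [(List.nodup_cons.1 hnd).1]
    · simp [e]

variable [DecidableEq A]

/-- The program that decides a formula: the input is copied to all heads (at labels `0` and `1`),
the formula is evaluated, the stacks are emptied and the truth value is returned (at label `2`). -/
noncomputable def program (φ : WordFormula A m) : Label φ ⊕ Fin 3 → Code A m (Label φ ⊕ Fin 3)
  | .inl l => code φ .inl (.inr 2) l
  | .inr 0 => .pop .inp (fun s x => (x, s.2)) (.branch (fun s => s.1.isNone)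
      (clear (jump (.inr 1)))
      (.push (.left .aux) (fun s => s.1.getD (default : A)) (clear (jump (.inr 0)))))
  | .inr 1 => .pop (.left .aux) (fun s x => (x, s.2)) (.branch (fun s => s.1.isNone)
      (clear (jump (.inl (entry φ))))
      (pushRights Finset.univ.toList (clear (jump (.inr 1)))))
  | .inr 2 => .peek (.right .aux) (fun s x => (x, s.2)) (.branch (fun s => s.1.isNone)
      (.push .out (fun s => s.2) (.load (fun _ => (none, false)) .halt))
      (popRights Finset.univ.toList (clear (jump (.inr 2)))))

/-- Moving a word between stacks reverses it, so the input makes a detour over the left stack of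
`aux` before it is distributed to the right stacks. -/
theorem reachesIn_load (φ : WordFormula A m) (u v : List A) {b : Bool} :
    ReachesIn φ.program (u.length + 1)
      ⟨some (.inr 0), (none, b), fam u [] (Function.update (fun _ => []) .aux v) fun _ => []⟩
      ⟨some (.inr 1), (none, b),
        fam [] [] (Function.update (fun _ => []) .aux (u.reverse ++ v)) fun _ => []⟩ := by
  induction u generalizing v with
  | nil =>
    apply ReachesIn.step
    have h1 : ∀ S : ∀ k : Stack m, List (StackSym A k), S .inp = [] →
        TM2.stepAux (φ.program (.inr 0)) (none, b) S =
          ⟨some (.inr 1), (none, b), Function.update S .inp []⟩ := by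
      intro S hS
      simp [program, clear, jump, hS]
    rw [h1 _ rfl, update_fam_inp]
    simp
  | cons a u ih =>
    have hstep : ReachesIn φ.program 1
        ⟨some (.inr 0), (none, b),
          fam (a :: u) [] (Function.update (fun _ => []) .aux v) fun _ => []⟩
        ⟨some (.inr 0), (none, b),
          fam u [] (Function.update (fun _ => []) .aux (a :: v)) fun _ => []⟩ := by
      apply ReachesIn.step
      have h1 : ∀ S : ∀ k : Stack m, List (StackSym A k), S .inp = a :: u →
          S (.left .aux) = v → TM2.stepAux (φ.program (.inr 0)) (none, b) S =
            ⟨some (.inr 0), (none, b),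
              Function.update (Function.update S .inp u) (.left .aux) (a :: v)⟩ := by
        intro S hS hS'
        simp [program, clear, jump, hS, hS']
      rw [h1 _ rfl (by simp [fam]), update_fam_inp, update_fam_left, Function.update_idem]
    have := hstep.trans (ih (a :: v))
    simp only [List.reverse_cons, List.append_assoc, List.singleton_append]
    exact this.mono (by simp; omega)

theorem reachesIn_copy (φ : WordFormula A m) (u v : List A) {b : Bool} :
    ReachesIn φ.program (u.length + 1)
      ⟨some (.inr 1), (none, b), fam [] [] (Function.update (fun _ => []) .aux u) fun _ => v⟩
      ⟨some (.inl (entry φ)), (none, b),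
        fam [] [] (fun _ => []) fun _ => u.reverse ++ v⟩ := by
  induction u generalizing v with
  | nil =>
    apply ReachesIn.step
    have h1 : ∀ S : ∀ k : Stack m, List (StackSym A k), S (.left .aux) = [] →
        TM2.stepAux (φ.program (.inr 1)) (none, b) S =
          ⟨some (.inl (entry φ)), (none, b), Function.update S (.left .aux) []⟩ := by
      intro S hS
      simp [program, clear, jump, hS]
    rw [h1 _ (by simp [fam]), update_fam_left, Function.update_idem, Function.update_eq_self]
    simp
  | cons a u ih =>
    have hstep : ReachesIn φ.program 1
        ⟨some (.inr 1), (none, b),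
          fam [] [] (Function.update (fun _ => []) .aux (a :: u)) fun _ => v⟩
        ⟨some (.inr 1), (none, b),
          fam [] [] (Function.update (fun _ => []) .aux u) fun _ => a :: v⟩ := by
      apply ReachesIn.step
      have h1 : ∀ S : ∀ k : Stack m, List (StackSym A k), S (.left .aux) = a :: u →
          TM2.stepAux (φ.program (.inr 1)) (none, b) S =
            TM2.stepAux (pushRights Finset.univ.toList (clear (jump (.inr 1)))) (some a, b)
              (Function.update S (.left .aux) u) := by
        intro S hS
        simp [program, hS]
      rw [h1 _ (by simp [fam]), update_fam_left, Function.update_idem,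
        stepAux_pushRights (Finset.nodup_toList _)]
      simp [clear, jump]
    have := hstep.trans (ih (a :: v))
    simp only [List.reverse_cons, List.append_assoc, List.singleton_append]
    exact this.mono (by simp; omega)

/-- A halting configuration must have its initial memory back and all stacks but the output empty.
The right stacks have equal contents, so `aux` alone shows when they are exhausted. -/
theorem reachesIn_finish (φ : WordFormula A m) (u : List A) {b : Bool} :
    ReachesIn φ.program (u.length + 1)
      ⟨some (.inr 2), (none, b), fam [] [] (fun _ => []) fun _ => u⟩
      ⟨none, (none, false), fam [] [b] (fun _ => []) fun _ => []⟩ := by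
  induction u with
  | nil =>
    apply ReachesIn.step
    have h1 : ∀ S : ∀ k : Stack m, List (StackSym A k), S (.right .aux) = [] → S .out = [] →
        TM2.stepAux (φ.program (.inr 2)) (none, b) S =
          ⟨none, (none, false), Function.update S .out [b]⟩ := by
      intro S hS hS'
      simp [program, hS, hS']
    rw [h1 _ (by simp [fam]) rfl, update_fam_out]
  | cons a u ih =>
    have hstep : ReachesIn φ.program 1
        ⟨some (.inr 2), (none, b), fam [] [] (fun _ => []) fun _ => a :: u⟩
        ⟨some (.inr 2), (none, b), fam [] [] (fun _ => []) fun _ => u⟩ := by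
      apply ReachesIn.step
      have h1 : ∀ S : ∀ k : Stack m, List (StackSym A k), S (.right .aux) = a :: u →
          TM2.stepAux (φ.program (.inr 2)) (none, b) S =
            TM2.stepAux (popRights Finset.univ.toList (clear (jump (.inr 2)))) (some a, b) S := by
        intro S hS
        simp [program, hS]
      rw [h1 _ (by simp [fam]), stepAux_popRights (Finset.nodup_toList _)]
      simp [clear, jump]
    exact (hstep.trans ih).mono (by simp; omega)

open Classical in
theorem reachesIn_machine (φ : WordFormula A m) (hφ : φ.WellFormed 0) (w : List A) :
    ReachesIn φ.program ((φ.timeBound + 3 * .X + 3).eval w.length)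
      ⟨some (.inr 0), (none, false), fam w [] (fun _ => []) fun _ => []⟩
      ⟨none, (none, false), fam [] [decide (φ.Holds w fun _ => 0)] (fun _ => []) fun _ => []⟩ := by
  have h1 := reachesIn_load φ w [] (b := false)
  have h2 := reachesIn_copy φ w.reverse [] (b := false)
  rw [Function.update_eq_self] at h1
  rw [List.append_nil] at h1
  rw [List.reverse_reverse, List.append_nil] at h2
  have h3 := reachesIn_code (w := w) φ hφ (e := Sum.inl) (x := Sum.inr 2) (M := φ.program)
    (fun l => rfl) (b := false) (fun _ => 0) (fun _ => Nat.zero_le _) (fun _ _ => ⟨rfl, rfl⟩) rfl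
  have hs : headStacks w (fun _ : Head m => 0) = fam [] [] (fun _ => []) fun _ => w := by
    simp [headStacks]
  rw [hs] at h3
  refine (((h1.trans h2).trans h3).trans (reachesIn_finish φ w)).mono ?_
  simp
  omega

variable [Fintype A]

/-- The Turing machine that decides a formula. -/
noncomputable def machine (φ : WordFormula A m) : FinTM2 where
  K := Stack m
  k₀ := .inp
  k₁ := .out
  Γ := StackSym A
  Λ := Label φ ⊕ Fin 3
  main := .inr 0
  ΛFin := by
    have := φ.finite_label
    exact Fintype.ofFinite _
  σ := Mem A
  initialState := (none, false)
  Γk₀Fin := inferInstanceAs (Fintype A)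
  m := φ.program

theorem initList_machine (φ : WordFormula A m) (u : List A) :
    initList φ.machine u = (⟨some (.inr 0), (none, false), fam u [] (fun _ => []) fun _ => []⟩ :
      TM2.Cfg (StackSym A) (Label φ ⊕ Fin 3) (Mem A)) := by
  unfold initList
  congr 1
  funext k
  cases k <;> rfl

theorem haltList_machine (φ : WordFormula A m) (b : List Bool) :
    haltList φ.machine b = (⟨none, (none, false), fam [] b (fun _ => []) fun _ => []⟩ :
      TM2.Cfg (StackSym A) (Label φ ⊕ Fin 3) (Mem A)) := by
  unfold haltList
  congr 1
  funext k
  cases k <;> rfl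

/-- Every property of words that is defined by a formula is decidable in polynomial time. -/
theorem nonempty_computableInPolyTime {α : Type} (φ : WordFormula A m) (hφ : φ.WellFormed 0)
    (enc : α → List A) (f : α → Bool)
    (hf : ∀ a, f a = true ↔ φ.Holds (enc a) fun _ => 0) :
    Nonempty (TM2ComputableInPolyTime enc Computability.encodeBool f) := by
  classical
  have key : ∀ a, Nonempty (TM2OutputsInTime φ.machine (enc a) (some [f a])
      ((φ.timeBound + 3 * .X + 3).eval (enc a).length)) := by
    intro a
    obtain ⟨k, hk, e⟩ := reachesIn_machine φ hφ (enc a)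
    have hfa : decide (φ.Holds (enc a) fun _ => 0) = f a := by
      rw [Bool.eq_iff_iff, decide_eq_true_iff, hf a]
    rw [hfa] at e
    have e' : (flip bind φ.machine.step)^[k] (some (initList φ.machine (enc a))) =
        some (haltList φ.machine [f a]) :=
      (congrArg (fun c => (flip bind φ.machine.step)^[k] (some c)) (initList_machine φ _)).trans
        (e.trans (congrArg some (haltList_machine φ [f a]).symm))
    exact ⟨⟨⟨k, e'⟩, hk⟩⟩
  have hmap : ∀ u : List A, List.map (Equiv.refl A).invFun u = u := fun u => List.map_id u
  refine ⟨{ tm := φ.machine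
            inputAlphabet := Equiv.refl A
            outputAlphabet := Equiv.refl Bool
            time := φ.timeBound + 3 * .X + 3
            outputsFun := fun a => ?_ }⟩
  -- The input arrives mapped along the identity of alphabets; `hmap` removes this.
  exact cast (congrArg (fun u => TM2OutputsInTime φ.machine u (some [f a]) _) (hmap (enc a)).symm)
    (key a).some

end Machine

/-! ### Counting positions, and closure properties of definability. -/

open Classical in
/-- The number of positions of the word `w` that satisfy `P`. -/
noncomputable def numPos (w : List A) (P : ℕ → Prop) : ℕ := Nat.count P w.length

/-- Counting supplies the arithmetic: a distance is the number of positions in an interval. -/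
theorem numPos_Ico {w : List A} {P : ℕ → Prop} {a b : ℕ} (hb : b ≤ w.length)
    (h : ∀ x < w.length, P x ↔ a ≤ x ∧ x < b) : numPos w P = b - a := by
  classical
  rw [numPos, Nat.count_eq_card_filter_range, ← Nat.card_Ico]
  congr 1
  ext x
  simp only [Finset.mem_filter, Finset.mem_range, Finset.mem_Ico]
  constructor
  · rintro ⟨h1, h2⟩
    exact (h x h1).1 h2
  · intro h1
    exact ⟨by omega, (h x (by omega)).2 h1⟩

theorem count_getElem (p : A → Bool) (s : List A) (P : ℕ → Prop) [DecidablePred P]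
    (h : ∀ k (hk : k < s.length), P k ↔ p s[k] = true) : Nat.count P s.length = s.countP p := by
  induction s using List.reverseRecOn with
  | nil => simp
  | append_singleton s a ih =>
    rw [List.length_append, List.length_singleton, Nat.count_succ, List.countP_append,
      ih fun k hk => ?_]
    · have := h s.length (by simp)
      simp only [List.getElem_append_right (le_refl _), Nat.sub_self,
        List.getElem_cons_zero] at this
      simp [this, List.countP_cons]
    · rw [h k (by simp; omega), List.getElem_append_left hk]

theorem numPos_segment {u s t : List A} {P : ℕ → Prop} (p : A → Bool)
    (h : ∀ x, P x → u.length ≤ x ∧ x < u.length + s.length)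
    (hs : ∀ k (hk : k < s.length), P (u.length + k) ↔ p s[k] = true) :
    numPos (u ++ (s ++ t)) P = s.countP p := by
  classical
  rw [numPos, List.length_append, List.length_append, Nat.count_add, Nat.count_add,
    count_getElem p s _ hs]
  have h1 : Nat.count P u.length = 0 :=
    Nat.count_iff_forall_not.2 fun x hx hP => by have := h x hP; omega
  have h2 : Nat.count (fun k => P (u.length + (s.length + k))) t.length = 0 :=
    Nat.count_iff_forall_not.2 fun x hx hP => by have := h _ hP; omega
  rw [h1, h2]
  omega

/-- The property `P` of words and `d` numbers is defined by formulas. -/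
def Definable (d : ℕ) (P : List A → (Fin d → ℕ) → Prop) : Prop :=
  ∀ᶠ m in Filter.atTop, ∀ hm : d ≤ m, ∃ φ : WordFormula A m, φ.WellFormed d ∧
    ∀ w (v : Fin m → ℕ), φ.Holds w v ↔ P w fun i => v (Fin.castLE hm i)

namespace Definable

variable {d : ℕ} {P Q : List A → (Fin d → ℕ) → Prop}

theorem congr (h : Definable d P) (hPQ : ∀ w v, P w v ↔ Q w v) : Definable d Q := by
  filter_upwards [h] with m hm hd
  obtain ⟨φ, h1, h2⟩ := hm hd
  exact ⟨φ, h1, fun w v => (h2 w v).trans (hPQ _ _)⟩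

theorem sym (i : Fin d) (a : A) : Definable d fun w v => w[v i]? = some a :=
  .of_forall fun _ hd => ⟨.sym (Fin.castLE hd i) a, trivial, fun _ _ => Iff.rfl⟩

theorem not (h : Definable d P) : Definable d fun w v => ¬ P w v := by
  filter_upwards [h] with m hm hd
  obtain ⟨φ, h1, h2⟩ := hm hd
  exact ⟨.not φ, h1, fun w v => not_congr (h2 w v)⟩

theorem and (h : Definable d P) (h' : Definable d Q) : Definable d fun w v => P w v ∧ Q w v := by
  filter_upwards [h, h'] with m hm hm' hd
  obtain ⟨φ, h1, h2⟩ := hm hd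
  obtain ⟨ψ, h3, h4⟩ := hm' hd
  exact ⟨.and φ ψ, ⟨h1, h3⟩, fun w v => and_congr (h2 w v) (h4 w v)⟩

theorem or (h : Definable d P) (h' : Definable d Q) : Definable d fun w v => P w v ∨ Q w v :=
  (h.not.and h'.not).not.congr fun w v => by tauto

theorem imp (h : Definable d P) (h' : Definable d Q) : Definable d fun w v => P w v → Q w v :=
  (h.and h'.not).not.congr fun w v => by tauto

theorem iff (h : Definable d P) (h' : Definable d Q) : Definable d fun w v => P w v ↔ Q w v :=
  ((h.imp h').and (h'.imp h)).congr fun w v => by tauto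

/-- The bound variable is named `d`, so more than `d` variables are needed. Demanding formulas for
all large `m` in `Definable` lets parts be combined over a common number of variables. -/
theorem letCount {R S : List A → (Fin d → ℕ) → ℕ → Prop}
    (h : Definable (d + 1) fun w v => R w (fun i => v i.castSucc) (v (Fin.last d)))
    (h' : Definable (d + 1) fun w v => S w (fun i => v i.castSucc) (v (Fin.last d))) :
    Definable d fun w v => S w v (numPos w fun p => R w v p) := by
  filter_upwards [h, h', Filter.eventually_gt_atTop d] with m hm hm' hdm hd
  obtain ⟨φ, h1, h2⟩ := hm hdm
  obtain ⟨ψ, h3, h4⟩ := hm' hdm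
  refine ⟨.letCount ⟨d, hdm⟩ φ ψ, ⟨rfl, h1, h3⟩, fun w v => ?_⟩
  have hold : ∀ (x : ℕ) (i : Fin d), Function.update v ⟨d, hdm⟩ x (Fin.castLE hdm i.castSucc) =
      v (Fin.castLE hd i) := by
    intro x i
    rw [Function.update_of_ne]
    · rfl
    · intro h
      have := congrArg Fin.val h
      simp at this
      omega
  have hnew : ∀ x : ℕ, Function.update v ⟨d, hdm⟩ x (Fin.castLE hdm (Fin.last d)) = x :=
    fun x => Function.update_self _ _ _
  have e1 : ∀ x : ℕ, φ.Holds w (Function.update v ⟨d, hdm⟩ x) ↔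
      R w (fun i => v (Fin.castLE hd i)) x := by
    intro x
    rw [h2]
    simp only [hold, hnew]
  have e2 : (WordFormula.letCount ⟨d, hdm⟩ φ ψ).Holds w v ↔ ψ.Holds w (Function.update v ⟨d, hdm⟩
      (numPos w fun p => φ.Holds w (Function.update v ⟨d, hdm⟩ p))) := Iff.rfl
  simp only [e2, h4, hold, hnew, e1]

variable [Inhabited A]

/-- A variable may not be compared with itself; in that case a contradiction about some symbol takes
the place of the comparison. -/
theorem lt (i j : Fin d) : Definable d fun (_ : List A) v => v i < v j := by
  by_cases hij : i = j
  · have h0 := sym (A := A) i default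
    exact (h0.and h0.not).congr fun w v => by simp [hij]
  · exact .of_forall fun m hd => ⟨.lt (Fin.castLE hd i) (Fin.castLE hd j),
      fun h => hij (Fin.castLE_injective hd h), fun _ _ => Iff.rfl⟩

theorem eq (i j : Fin d) : Definable d fun (_ : List A) v => v i = v j :=
  ((lt i j).not.and (lt j i).not).congr fun w v => by omega

/-- Zero is available as the number of positions `p` with `p < p`. -/
theorem ne_zero (i : Fin d) : Definable d fun (_ : List A) v => v i ≠ 0 := by
  have h := letCount (A := A) (d := d) (R := fun _ _ p => p < p) (S := fun _ v c => c < v i)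
    (lt _ _) (lt _ _)
  refine h.congr fun w v => ?_
  have : numPos w (fun p => p < p) = 0 := by
    rw [numPos_Ico (a := 0) (b := 0) (Nat.zero_le _) (by simp)]
  rw [this]
  omega

theorem ex {R : List A → (Fin d → ℕ) → ℕ → Prop}
    (h : Definable (d + 1) fun w v => R w (fun i => v i.castSucc) (v (Fin.last d))) :
    Definable d fun w v => ∃ x < w.length, R w v x := by
  classical
  refine (letCount (S := fun _ _ c => c ≠ 0) h (ne_zero _)).congr fun w v => ?_
  rw [numPos]
  exact Nat.count_ne_iff_exists

theorem all {R : List A → (Fin d → ℕ) → ℕ → Prop}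
    (h : Definable (d + 1) fun w v => R w (fun i => v i.castSucc) (v (Fin.last d))) :
    Definable d fun w v => ∀ x < w.length, R w v x :=
  (ex (R := fun w v x => ¬ R w v x) h.not).not.congr fun w v => by push Not; rfl

theorem lt_numPos {R : List A → (Fin d → ℕ) → ℕ → Prop} (i : Fin d)
    (h : Definable (d + 1) fun w v => R w (fun i => v i.castSucc) (v (Fin.last d))) :
    Definable d fun w v => v i < numPos w (R w v) :=
  letCount (S := fun _ v c => v i < c) h (lt _ _)

theorem numPos_eq {R : List A → (Fin d → ℕ) → ℕ → Prop} (i : Fin d)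
    (h : Definable (d + 1) fun w v => R w (fun i => v i.castSucc) (v (Fin.last d))) :
    Definable d fun w v => numPos w (R w v) = v i :=
  letCount (S := fun _ v c => c = v i) h (eq _ _)

/-- The second count lies in the scope of the first, so its formula has one more parameter, which
`R'` ignores. -/
theorem numPos_eq_numPos {R R' : List A → (Fin d → ℕ) → ℕ → Prop}
    (h : Definable (d + 1) fun w v => R w (fun i => v i.castSucc) (v (Fin.last d)))
    (h' : Definable (d + 2) fun w v =>
      R' w (fun i => v i.castSucc.castSucc) (v (Fin.last (d + 1)))) :
    Definable d fun w v => numPos w (R w v) = numPos w (R' w v) := by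
  refine letCount (R := R) (S := fun w v c => c = numPos w (R' w v)) h ?_
  exact letCount (R := fun w v => R' w fun i => v i.castSucc)
    (S := fun w v c => v (Fin.last d) = c) h' (eq _ _)

omit [Inhabited A] in
theorem forallFinite {κ : Type} (s : Finset κ) {R : κ → List A → (Fin d → ℕ) → Prop}
    (h : ∀ k, Definable d (R k)) (h0 : Definable d fun (_ : List A) _ => True) :
    Definable d fun w v => ∀ k ∈ s, R k w v := by
  classical
  induction s using Finset.induction_on with
  | empty => exact h0.congr fun w v => by simp
  | insert k s _ ih => exact ((h k).and ih).congr fun w v => by simp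

/-- A property of words that is defined by a formula is decidable in polynomial time. -/
theorem nonempty_computableInPolyTime [DecidableEq A] [Fintype A]
    {P : List A → (Fin 0 → ℕ) → Prop} (h : Definable 0 P) {α : Type}
    (enc : α → List A) (f : α → Bool) (hf : ∀ a, f a = true ↔ P (enc a) Fin.elim0) :
    Nonempty (TM2ComputableInPolyTime enc Computability.encodeBool f) := by
  obtain ⟨m, hm⟩ := h.exists
  obtain ⟨φ, h1, h2⟩ := hm (Nat.zero_le _)
  refine WordFormula.nonempty_computableInPolyTime φ h1 enc f fun a => ?_
  rw [hf a, h2]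
  exact iff_of_eq (congrArg _ (Subsingleton.elim _ _))

end Definable

end WordFormula

namespace IncompleteRel

/-! ### The characterisation as a formula about the input word. -/

section WordPredicates

open Computability WordFormula

/-- The position `δ` in `w` is that of a symbol in front of a field. -/
def Delim (w : List Γ') (δ : ℕ) : Prop := w[δ]? = some Γ'.bra ∨ w[δ]? = some Γ'.comma

/-- A row begins at `q`, where `K` is the position of the first closing bracket. -/
def RowStart (w : List Γ') (K q : ℕ) : Prop :=
  w[q]? = some Γ'.bra ∧ K < numPos w fun x => x < q ∧ w[x]? = some Γ'.ket

/-- The domain of the attribute with the position `α` begins at `q`. -/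
def DomStart (w : List Γ') (α q : ℕ) : Prop :=
  w[q]? = some Γ'.bra ∧
    (numPos w fun x => x < q ∧ w[x]? = some Γ'.ket) = numPos w fun x => ¬ α < x

/-- In the block that begins at `q` there is a field with the delimiter `δ` in front. -/
def FieldAt (w : List Γ') (q δ : ℕ) : Prop :=
  ¬ δ < q ∧ Delim w δ ∧ ∀ x < w.length, ¬ x < q → x < δ → ¬ w[x]? = some Γ'.ket

/-- The field with the delimiter `δ` is the `j`-th of the block that begins at `q`. -/
def FieldNo (w : List Γ') (q j δ : ℕ) : Prop :=
  FieldAt w q δ ∧ (numPos w fun x => ¬ x < q ∧ ¬ δ < x ∧ Delim w x) = j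

/-- The fields with the delimiters `δ` and `ε` are equal. -/
def SameField (w : List Γ') (δ ε : ℕ) : Prop :=
  ∀ x < w.length, ∀ y < w.length, δ < x → ε < y →
    (numPos w fun z => δ < z ∧ z < x) = (numPos w fun z => ε < z ∧ z < y) →
    (∀ z < w.length, δ < z → z < x → ¬ w[z]? = some Γ'.comma) →
    (∀ z < w.length, ε < z → z < y → ¬ w[z]? = some Γ'.comma) →
    ∀ c ∈ Finset.univ, w[x]? = some c ↔ w[y]? = some c

/-- The symbol after the position `δ` is `c`. -/
def NextIs (w : List Γ') (δ : ℕ) (c : Γ') : Prop :=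
  ∃ x < w.length, δ < x ∧ (∀ z < w.length, ¬ (δ < z ∧ z < x)) ∧ w[x]? = some c

/-- The second symbol after the position `δ` is a closing bracket. -/
def ClosesAfterOne (w : List Γ') (δ : ℕ) : Prop :=
  ∃ x < w.length, δ < x ∧ (∀ z < w.length, ¬ (δ < z ∧ z < x)) ∧ NextIs w x Γ'.ket

/-- The row that begins at `q` has a null in the attribute with the position `α`. -/
def NullAt (w : List Γ') (q α : ℕ) : Prop :=
  ∃ δ < w.length, FieldNo w q α δ ∧ NextIs w δ Γ'.blank

/-- The rows that begin at `q` and `q'` agree in the attribute with the position `α`. -/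
def AgreeAt (w : List Γ') (q q' α : ℕ) : Prop :=
  ∃ δ < w.length, FieldNo w q α δ ∧ ∃ ε < w.length, FieldNo w q' α ε ∧ SameField w δ ε

/-- The row that begins at `q` has in the attribute with the position `α` the value with the
delimiter `ε`. -/
def HasValueAt (w : List Γ') (q α ε : ℕ) : Prop :=
  ∃ δ < w.length, FieldNo w q α δ ∧ SameField w δ ε

/-- A value with the delimiter `δ` is in the domain of the attribute with the position `α`. -/
def ValueAt (w : List Γ') (α δ : ℕ) : Prop :=
  ∃ q < w.length, DomStart w α q ∧ FieldAt w q δ ∧ ¬ NextIs w δ Γ'.ket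

/-- The row that begins at `q` has multiplicity one. -/
def SingleRow (w : List Γ') (K q : ℕ) : Prop :=
  ∃ δ < w.length, FieldNo w q K δ ∧ ClosesAfterOne w δ

/-- There is an attribute with the position `α`. -/
def AttrAt (_ : List Γ') (K α : ℕ) : Prop := α < K ∧ α ≠ 0

/-- The attribute with the position `α` is in the first attribute set. -/
def FstAt (w : List Γ') (K α : ℕ) : Prop := α < K ∧ w[α]? = some (Γ'.bit true)

/-- The attribute with the position `α` is in the second attribute set. -/
def SndAt (w : List Γ') (K α : ℕ) : Prop :=
  α < K ∧ ∃ y < w.length, (numPos w fun x => ¬ x < α ∧ x < y) = (numPos w fun x => ¬ K < x) ∧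
    w[y]? = some (Γ'.bit true)

/-- The attribute with the position `α` is in one of the attribute sets. -/
def UnionAt (w : List Γ') (K α : ℕ) : Prop := FstAt w K α ∨ SndAt w K α

/-- The input word satisfies `ConstOn`, for the attributes with positions in `Z`. -/
def ConstOnWord (w : List Γ') (K : ℕ) (Z : List Γ' → ℕ → ℕ → Prop) : Prop :=
  (∀ q < w.length, RowStart w K q → ∀ q' < w.length, RowStart w K q' →
    (∀ α < w.length, AttrAt w K α → AgreeAt w q q' α) ∧ SingleRow w K q) ∨
  ∀ q < w.length, RowStart w K q → ∀ q' < w.length, RowStart w K q' →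
    ∀ α < w.length, Z w K α → ¬ NullAt w q α ∧ AgreeAt w q q' α

/-- The input word satisfies `Combines`. -/
def CombinesWord (w : List Γ') (K : ℕ) : Prop :=
  ∀ q < w.length, RowStart w K q → (∀ α < w.length, FstAt w K α → ¬ NullAt w q α) →
    ∀ q' < w.length, RowStart w K q' → (∀ α < w.length, SndAt w K α → ¬ NullAt w q' α) →
      ∃ u < w.length, RowStart w K u ∧ (∀ α < w.length, FstAt w K α → AgreeAt w u q α) ∧
        ∀ α < w.length, SndAt w K α → AgreeAt w u q' α

/-- The row that begins at `u` is complete and compatible with the one that begins at `q`. -/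
def CompatibleWord (w : List Γ') (K q u : ℕ) : Prop :=
  (∀ α < w.length, UnionAt w K α → ¬ NullAt w u α) ∧
    ∀ α < w.length, UnionAt w K α → NullAt w q α ∨ AgreeAt w q u α

/-- The input word satisfies `ContainsGroundings`, in the form of
`Schema.containsGroundings_iff_step`. -/
def ContainsGroundingsWord (w : List Γ') (K : ℕ) : Prop :=
  ∀ q < w.length, RowStart w K q →
    (∃ u < w.length, RowStart w K u ∧ CompatibleWord w K q u) ∧
    ∀ u < w.length, RowStart w K u → CompatibleWord w K q u →
      ∀ α < w.length, UnionAt w K α → NullAt w q α → ∀ δ < w.length, ValueAt w α δ →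
        ∃ u' < w.length, RowStart w K u' ∧ HasValueAt w u' α δ ∧
          ∀ β < w.length, UnionAt w K β → ¬ β = α → AgreeAt w u' u β

/-- The input word satisfies the characterisation of certain independence. -/
def SatCIAWord (w : List Γ') : Prop :=
  ∃ K < w.length, w[K]? = some Γ'.ket ∧ (∀ x < w.length, x < K → ¬ w[x]? = some Γ'.ket) ∧
    (ConstOnWord w K FstAt ∨ ConstOnWord w K SndAt ∨
      (CombinesWord w K ∧ ContainsGroundingsWord w K))

namespace Definable

open WordFormula.Definable

variable {d : ℕ}

theorem delim (i : Fin d) : WordFormula.Definable d fun w v => Delim w (v i) :=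
  or (sym _ _) (sym _ _)

theorem rowStart (i j : Fin d) : WordFormula.Definable d fun w v => RowStart w (v i) (v j) :=
  and (sym _ _) (lt_numPos _ (and (lt _ _) (sym _ _)))

theorem domStart (i j : Fin d) : WordFormula.Definable d fun w v => DomStart w (v i) (v j) :=
  and (sym _ _) (numPos_eq_numPos (and (lt _ _) (sym _ _)) (not (lt _ _)))

theorem fieldAt (i j : Fin d) : WordFormula.Definable d fun w v => FieldAt w (v i) (v j) :=
  and (not (lt _ _)) (and (delim _) (all (imp (not (lt _ _)) (imp (lt _ _) (not (sym _ _))))))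

theorem fieldNo (i j k : Fin d) :
    WordFormula.Definable d fun w v => FieldNo w (v i) (v j) (v k) :=
  and (fieldAt _ _) (numPos_eq _ (and (not (lt _ _)) (and (not (lt _ _)) (delim _))))

theorem sameField (i j : Fin d) : WordFormula.Definable d fun w v => SameField w (v i) (v j) :=
  all (all (imp (lt _ _) (imp (lt _ _) (imp
    (numPos_eq_numPos (and (lt _ _) (lt _ _)) (and (lt _ _) (lt _ _)))
    (imp (all (imp (lt _ _) (imp (lt _ _) (not (sym _ _)))))
      (imp (all (imp (lt _ _) (imp (lt _ _) (not (sym _ _)))))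
        (forallFinite _ (fun _ => iff (sym _ _) (sym _ _))
          -- The empty conjunction is written as the equality of a variable with itself.
          ((eq i.castSucc.castSucc i.castSucc.castSucc).congr fun _ _ => by simp))))))))

theorem nextIs (i : Fin d) (c : Γ') : WordFormula.Definable d fun w v => NextIs w (v i) c :=
  ex (and (lt _ _) (and (all (not (and (lt _ _) (lt _ _)))) (sym _ _)))

theorem closesAfterOne (i : Fin d) :
    WordFormula.Definable d fun w v => ClosesAfterOne w (v i) :=
  ex (and (lt _ _) (and (all (not (and (lt _ _) (lt _ _)))) (nextIs _ _)))

theorem nullAt (i j : Fin d) : WordFormula.Definable d fun w v => NullAt w (v i) (v j) :=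
  ex (and (fieldNo _ _ _) (nextIs _ _))

theorem agreeAt (i j k : Fin d) :
    WordFormula.Definable d fun w v => AgreeAt w (v i) (v j) (v k) :=
  ex (and (fieldNo _ _ _) (ex (and (fieldNo _ _ _) (sameField _ _))))

theorem hasValueAt (i j k : Fin d) :
    WordFormula.Definable d fun w v => HasValueAt w (v i) (v j) (v k) :=
  ex (and (fieldNo _ _ _) (sameField _ _))

theorem valueAt (i j : Fin d) : WordFormula.Definable d fun w v => ValueAt w (v i) (v j) :=
  ex (and (domStart _ _) (and (fieldAt _ _) (not (nextIs _ _))))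

theorem singleRow (i j : Fin d) : WordFormula.Definable d fun w v => SingleRow w (v i) (v j) :=
  ex (and (fieldNo _ _ _) (closesAfterOne _))

theorem attrAt (i j : Fin d) : WordFormula.Definable d fun w v => AttrAt w (v i) (v j) :=
  and (lt _ _) (ne_zero _)

theorem fstAt {d : ℕ} (i j : Fin d) : WordFormula.Definable d fun w v => FstAt w (v i) (v j) :=
  and (lt _ _) (sym _ _)

theorem sndAt {d : ℕ} (i j : Fin d) : WordFormula.Definable d fun w v => SndAt w (v i) (v j) :=
  and (lt _ _) (ex (and (numPos_eq_numPos (and (not (lt _ _)) (lt _ _)) (not (lt _ _))) (sym _ _)))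

theorem unionAt (i j : Fin d) : WordFormula.Definable d fun w v => UnionAt w (v i) (v j) :=
  or (fstAt _ _) (sndAt _ _)

theorem constOnWord {Z : List Γ' → ℕ → ℕ → Prop}
    (hZ : ∀ {d : ℕ} (i j : Fin d), WordFormula.Definable d fun w v => Z w (v i) (v j))
    (i : Fin d) : WordFormula.Definable d fun w v => ConstOnWord w (v i) Z :=
  or
    (all (imp (rowStart _ _) (all (imp (rowStart _ _)
      (and (all (imp (attrAt _ _) (agreeAt _ _ _))) (singleRow _ _))))))
    (all (imp (rowStart _ _) (all (imp (rowStart _ _)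
      (all (imp (hZ _ _) (and (not (nullAt _ _)) (agreeAt _ _ _))))))))

theorem combinesWord (i : Fin d) : WordFormula.Definable d fun w v => CombinesWord w (v i) :=
  all (imp (rowStart _ _) (imp (all (imp (fstAt _ _) (not (nullAt _ _))))
    (all (imp (rowStart _ _) (imp (all (imp (sndAt _ _) (not (nullAt _ _))))
      (ex (and (rowStart _ _) (and (all (imp (fstAt _ _) (agreeAt _ _ _)))
        (all (imp (sndAt _ _) (agreeAt _ _ _)))))))))))

theorem compatibleWord (i j k : Fin d) :
    WordFormula.Definable d fun w v => CompatibleWord w (v i) (v j) (v k) :=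
  and (all (imp (unionAt _ _) (not (nullAt _ _))))
    (all (imp (unionAt _ _) (or (nullAt _ _) (agreeAt _ _ _))))

theorem containsGroundingsWord (i : Fin d) :
    WordFormula.Definable d fun w v => ContainsGroundingsWord w (v i) :=
  all (imp (rowStart _ _) (and (ex (and (rowStart _ _) (compatibleWord _ _ _)))
    (all (imp (rowStart _ _) (imp (compatibleWord _ _ _) (all (imp (unionAt _ _)
      (imp (nullAt _ _) (all (imp (valueAt _ _) (ex (and (rowStart _ _) (and (hasValueAt _ _ _)
        (all (imp (unionAt _ _) (imp (not (eq _ _)) (agreeAt _ _ _)))))))))))))))))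

/-- On input words `K` is `n + 1`, and attribute `a` is represented by the position `a + 1` of its
bit in the first vector. These positions double as numbers: the entry of `a` is field `a + 1` of a
row, the multiplicity is field `K`, and `K + 1` blocks precede the rows. -/
theorem satCIAWord : WordFormula.Definable 0 fun w _ => SatCIAWord w :=
  ex (and (sym _ _) (and (all (imp (lt _ _) (not (sym _ _)))) (or (constOnWord fstAt _)
    (or (constOnWord sndAt _) (and (combinesWord _) (containsGroundingsWord _))))))

end Definable

end WordPredicates

/-! ### Fields and blocks of words. -/

section Words

open Computability WordFormula

theorem nextIs_iff {w : List Γ'} {δ : ℕ} {c : Γ'} : NextIs w δ c ↔ w[δ + 1]? = some c := by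
  constructor
  · rintro ⟨x, hx, h1, h2, h3⟩
    obtain rfl : x = δ + 1 := by
      by_contra hne
      exact h2 (δ + 1) (by omega) (by omega)
    exact h3
  · intro h
    have hlt : δ + 1 < w.length := (List.getElem?_eq_some_iff.1 h).1
    exact ⟨δ + 1, hlt, by omega, fun z _ => by omega, h⟩

theorem closesAfterOne_iff {w : List Γ'} {δ : ℕ} :
    ClosesAfterOne w δ ↔ w[δ + 2]? = some Γ'.ket := by
  constructor
  · rintro ⟨x, hx, h1, h2, h3⟩
    obtain rfl : x = δ + 1 := by
      by_contra hne
      exact h2 (δ + 1) (by omega) (by omega)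
    exact nextIs_iff.1 h3
  · intro h
    have hlt : δ + 2 < w.length := (List.getElem?_eq_some_iff.1 h).1
    exact ⟨δ + 1, by omega, by omega, fun z _ => by omega, nextIs_iff.2 h⟩

/-- Where the shorter word ends, its terminator `s` is compared with a symbol of the other word,
which cannot be `s`; so the lengths agree as well. -/
theorem eq_of_getElem?_eq {A : Type*} {s : A} {f g r r' : List A} (hf : s ∉ f) (hg : s ∉ g)
    (h : ∀ l ≤ f.length, l ≤ g.length → (f ++ s :: r)[l]? = (g ++ s :: r')[l]?) : f = g := by
  induction f generalizing g with
  | nil =>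
    cases g with
    | nil => rfl
    | cons b g =>
      have := h 0 (by simp) (by simp)
      simp at this
      simp [this] at hg
  | cons a f ih =>
    cases g with
    | nil =>
      have := h 0 (by simp) (by simp)
      simp at this
      simp [this] at hf
    | cons b g =>
      have h0 := h 0 (by simp) (by simp)
      simp at h0
      have hfg : f = g := by
        refine ih (fun hm => hf (List.mem_cons_of_mem _ hm))
          (fun hm => hg (List.mem_cons_of_mem _ hm)) fun l h1 h2 => ?_
        have := h (l + 1) (by simpa using h1) (by simpa using h2)
        simpa using this
      rw [h0, hfg]

theorem getElem?_of_drop {A : Type*} {w s : List A} {k : ℕ} (h : w.drop k = s) (l : ℕ) :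
    w[k + l]? = s[l]? := by
  rw [← h, List.getElem?_drop]

/-- The comparison runs over equal offsets as long as neither field has ended earlier. It includes
the terminating commas, which rules out proper prefixes. -/
theorem sameField_iff {w f g r r' : List Γ'} {δ ε : ℕ} (hf : Γ'.comma ∉ f) (hg : Γ'.comma ∉ g)
    (hδ : w.drop (δ + 1) = f ++ Γ'.comma :: r) (hε : w.drop (ε + 1) = g ++ Γ'.comma :: r') :
    SameField w δ ε ↔ f = g := by
  have hlenδ : δ + 1 + f.length < w.length := by
    have := congrArg List.length hδ
    simp at this
    omega
  have hlenε : ε + 1 + g.length < w.length := by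
    have := congrArg List.length hε
    simp at this
    omega
  have hdist : ∀ {η x : ℕ}, x < w.length →
      (numPos w fun z => η < z ∧ z < x) = x - (η + 1) := by
    intro η x hx
    exact numPos_Ico hx.le fun z _ => Iff.rfl
  have hnot : ∀ {η : ℕ} {e s : List Γ'}, Γ'.comma ∉ e → w.drop (η + 1) = e ++ Γ'.comma :: s →
      ∀ l ≤ e.length, ∀ z < w.length, η < z → z < η + 1 + l → ¬ w[z]? = some Γ'.comma := by
    intro η e s he hη l hl z _ h1 h2 h3
    have := getElem?_of_drop hη (z - (η + 1))
    rw [show η + 1 + (z - (η + 1)) = z by omega, h3,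
      List.getElem?_append_left (by omega)] at this
    exact he (List.mem_of_getElem? this.symm)
  constructor
  · intro h
    refine eq_of_getElem?_eq hf hg (r := r) (r' := r') fun l h1 h2 => ?_
    rw [← getElem?_of_drop hδ, ← getElem?_of_drop hε]
    have key := h (δ + 1 + l) (by omega) (ε + 1 + l) (by omega) (by omega) (by omega)
      (by rw [hdist (by omega), hdist (by omega)]; omega) (hnot hf hδ l h1) (hnot hg hε l h2)
    refine Option.ext fun c => ?_
    simpa using key c (Finset.mem_univ _)
  · rintro rfl x hx y hy h1 h2 h3 h4 h5 c _
    rw [hdist hx, hdist hy] at h3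
    have hcomma : w[δ + 1 + f.length]? = some Γ'.comma := by
      rw [getElem?_of_drop hδ]
      simp
    -- Beyond the comma that ends the field, the premise of `SameField` fails.
    have hle : x - (δ + 1) ≤ f.length := by
      by_contra hlt
      exact h4 (δ + 1 + f.length) (by omega) (by omega) (by omega) hcomma
    have e1 := getElem?_of_drop hδ (x - (δ + 1))
    have e2 := getElem?_of_drop hε (y - (ε + 1))
    rw [show δ + 1 + (x - (δ + 1)) = x by omega] at e1
    rw [show ε + 1 + (y - (ε + 1)) = y by omega, ← h3] at e2
    rw [e1, e2]
    rcases hle.lt_or_eq with hlt | heq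
    · rw [List.getElem?_append_left hlt, List.getElem?_append_left hlt]
    · rw [heq]
      simp

/-- A bracketed part of an input word: its comma-terminated fields, and the rest. -/
abbrev Block : Type := List (List Γ') × List Γ'

/-- The concatenation of comma-terminated fields. -/
def fieldsWord (fs : List (List Γ')) : List Γ' := fs.flatMap fun f => f ++ [Γ'.comma]

/-- The word of a block. -/
def Block.word (b : Block) : List Γ' := Γ'.bra :: (fieldsWord b.1 ++ (b.2 ++ [Γ'.ket]))

/-- The symbol is neither a bracket nor a comma. -/
def Plain (c : Γ') : Prop := c ≠ Γ'.bra ∧ c ≠ Γ'.ket ∧ c ≠ Γ'.comma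

/-- The fields and the rest of the block contain neither brackets nor commas. -/
def Block.Good (b : Block) : Prop := (∀ f ∈ b.1, ∀ c ∈ f, Plain c) ∧ ∀ c ∈ b.2, Plain c

theorem fieldsWord_cons (f : List Γ') (fs : List (List Γ')) :
    fieldsWord (f :: fs) = f ++ Γ'.comma :: fieldsWord fs := by
  simp [fieldsWord]

theorem fieldsWord_append (fs gs : List (List Γ')) :
    fieldsWord (fs ++ gs) = fieldsWord fs ++ fieldsWord gs := by
  simp [fieldsWord]

theorem mem_fieldsWord {fs : List (List Γ')} (h : ∀ f ∈ fs, ∀ c ∈ f, Plain c) {c : Γ'}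
    (hc : c ∈ fieldsWord fs) : c ≠ Γ'.bra ∧ c ≠ Γ'.ket := by
  simp only [fieldsWord, List.mem_flatMap, List.mem_append, List.mem_singleton] at hc
  obtain ⟨f, hf, hc | rfl⟩ := hc
  · exact ⟨(h f hf c hc).1, (h f hf c hc).2.1⟩
  · simp

theorem count_bra_ket_word {b : Block} (hb : b.Good) :
    Γ'.bra ∉ fieldsWord b.1 ++ (b.2 ++ [Γ'.ket]) ∧ b.word.count Γ'.ket = 1 := by
  have h1 : Γ'.bra ∉ fieldsWord b.1 := fun h => (mem_fieldsWord hb.1 h).1 rfl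
  have h2 : Γ'.ket ∉ fieldsWord b.1 := fun h => (mem_fieldsWord hb.1 h).2 rfl
  have h3 : Γ'.bra ∉ b.2 := fun h => (hb.2 _ h).1 rfl
  have h4 : Γ'.ket ∉ b.2 := fun h => (hb.2 _ h).2.1 rfl
  constructor
  · simp [h1, h3]
  · simp [Block.word, List.count_eq_zero_of_not_mem h2,
      List.count_eq_zero_of_not_mem h4]

theorem getElem?_append_of_notMem {A : Type*} {s t : List A} {a : A} {k : ℕ} (h : a ∉ s)
    (hk : (s ++ t)[k]? = some a) : s.length ≤ k ∧ t[k - s.length]? = some a := by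
  rcases lt_or_ge k s.length with hlt | hge
  · rw [List.getElem?_append_left hlt] at hk
    exact absurd (List.mem_of_getElem? hk) h
  · rw [List.getElem?_append_right hge] at hk
    exact ⟨hge, hk⟩

/-- A good block has no opening bracket besides its first symbol. -/
theorem bra_of_flatMap_word {bs : List Block} (hbs : ∀ b ∈ bs, b.Good) {t : List Γ'} {q : ℕ}
    (h : (bs.flatMap Block.word ++ t)[q]? = some Γ'.bra) :
    (∃ l b r, bs = l ++ b :: r ∧ q = (l.flatMap Block.word).length) ∨
      ((bs.flatMap Block.word).length ≤ q ∧
        t[q - (bs.flatMap Block.word).length]? = some Γ'.bra) := by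
  induction bs generalizing q with
  | nil => exact Or.inr (by simpa using h)
  | cons b bs ih =>
    rcases q with _ | q
    · exact Or.inl ⟨[], b, bs, rfl, rfl⟩
    · have hb := (count_bra_ket_word (hbs b (by simp))).1
      have h' : ((fieldsWord b.1 ++ (b.2 ++ [Γ'.ket])) ++ (bs.flatMap Block.word ++ t))[q]? =
          some Γ'.bra := by
        simpa [Block.word] using h
      obtain ⟨h1, h2⟩ := getElem?_append_of_notMem hb h'
      have hlen : b.word.length = (fieldsWord b.1 ++ (b.2 ++ [Γ'.ket])).length + 1 := rfl
      rcases ih (fun b hb => hbs b (by simp [hb])) h2 with ⟨l, b', r, rfl, h3⟩ | ⟨h3, h4⟩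
      · refine Or.inl ⟨b :: l, b', r, rfl, ?_⟩
        rw [List.flatMap_cons, List.length_append, hlen, ← h3]
        omega
      · refine Or.inr ?_
        rw [List.flatMap_cons, List.length_append, hlen]
        refine ⟨by omega, ?_⟩
        rw [← h4]
        congr 1
        omega

/-- The block `b` begins at `q`. -/
def BlockAt (w : List Γ') (q : ℕ) (b : Block) : Prop :=
  ∃ pre post, w = pre ++ (b.word ++ post) ∧ pre.length = q

theorem BlockAt.bra {w : List Γ'} {q : ℕ} {b : Block} (h : BlockAt w q b) :
    w[q]? = some Γ'.bra := by
  obtain ⟨pre, post, rfl, rfl⟩ := h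
  simp [Block.word]

theorem BlockAt.lt_length {w : List Γ'} {q : ℕ} {b : Block} (h : BlockAt w q b) :
    q < w.length :=
  (List.getElem?_eq_some_iff.1 h.bra).1

theorem numPos_kets (u t : List Γ') :
    (numPos (u ++ t) fun x => x < u.length ∧ (u ++ t)[x]? = some Γ'.ket) = u.count Γ'.ket := by
  have := numPos_segment (u := []) (s := u) (t := t)
    (P := fun x => x < u.length ∧ (u ++ t)[x]? = some Γ'.ket) (· == Γ'.ket)
    (fun x hx => ⟨Nat.zero_le _, by simpa using hx.1⟩) (fun k hk => by
      have h : (u ++ t)[k]? = some u[k] := by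
        rw [List.getElem?_append_left hk, List.getElem?_eq_getElem hk]
      simp only [List.length_nil, Nat.zero_add, h, hk, true_and,
        Option.some.injEq, beq_iff_eq])
  simpa [List.count] using this

theorem count_flatMap_word {bs : List Block} (hbs : ∀ b ∈ bs, b.Good) :
    (bs.flatMap Block.word).count Γ'.ket = bs.length := by
  induction bs with
  | nil => rfl
  | cons b bs ih =>
    rw [List.flatMap_cons, List.count_append, (count_bra_ket_word (hbs b (by simp))).2,
      ih fun b hb => hbs b (by simp [hb]), List.length_cons, Nat.add_comm]

/-- The word of two lists of blocks that are separated by a comma. -/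
def blocksWord (bs cs : List Block) : List Γ' :=
  bs.flatMap Block.word ++ Γ'.comma :: cs.flatMap Block.word

section Blocks

variable {bs cs : List Block}

theorem blocksWord_left (l : List Block) (b : Block) (r cs : List Block) :
    blocksWord (l ++ b :: r) cs = l.flatMap Block.word ++
      (b.word ++ (r.flatMap Block.word ++ Γ'.comma :: cs.flatMap Block.word)) := by
  simp [blocksWord]

theorem blocksWord_right (bs l : List Block) (b : Block) (r : List Block) :
    blocksWord bs (l ++ b :: r) = (bs.flatMap Block.word ++ Γ'.comma :: l.flatMap Block.word) ++
      (b.word ++ r.flatMap Block.word) := by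
  simp [blocksWord]

/-- Every good block has exactly one closing bracket, so the number of closing brackets before a
block is its index; this is how formulas identify blocks. -/
theorem bra_of_blocksWord (hbs : ∀ b ∈ bs, b.Good) (hcs : ∀ b ∈ cs, b.Good) {q : ℕ}
    (h : (blocksWord bs cs)[q]? = some Γ'.bra) :
    (∃ l b r, bs = l ++ b :: r ∧ BlockAt (blocksWord bs cs) q b ∧
      (numPos (blocksWord bs cs) fun x => x < q ∧ (blocksWord bs cs)[x]? = some Γ'.ket) =
        l.length) ∨
    ∃ l b r, cs = l ++ b :: r ∧ BlockAt (blocksWord bs cs) q b ∧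
      (numPos (blocksWord bs cs) fun x => x < q ∧ (blocksWord bs cs)[x]? = some Γ'.ket) =
        bs.length + l.length := by
  rcases bra_of_flatMap_word hbs h with ⟨l, b, r, rfl, rfl⟩ | ⟨h1, h2⟩
  · refine Or.inl ⟨l, b, r, rfl, ⟨_, _, blocksWord_left l b r cs, rfl⟩, ?_⟩
    rw [blocksWord_left, numPos_kets, count_flatMap_word fun b hb => hbs b (by simp [hb])]
  · obtain ⟨k, hk⟩ : ∃ k, q - (bs.flatMap Block.word).length = k + 1 := by
      rcases hk : q - (bs.flatMap Block.word).length with _ | k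
      · rw [hk] at h2
        simp at h2
      · exact ⟨k, rfl⟩
    rw [hk, List.getElem?_cons_succ] at h2
    rcases bra_of_flatMap_word hcs (t := []) (by simpa using h2) with
      ⟨l, b, r, rfl, h3⟩ | ⟨-, h3⟩
    · have hq : q = (bs.flatMap Block.word ++ Γ'.comma :: l.flatMap Block.word).length := by
        rw [List.length_append, List.length_cons]
        omega
      refine Or.inr ⟨l, b, r, rfl, ⟨_, _, blocksWord_right bs l b r, hq.symm⟩, ?_⟩
      rw [hq, blocksWord_right, numPos_kets, List.count_append, List.count_cons,
        count_flatMap_word hbs, count_flatMap_word fun b hb => hcs b (by simp [hb])]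
      simp
    · simp at h3

theorem RowStart.exists_blockAt (hbs : ∀ b ∈ bs, b.Good) (hcs : ∀ b ∈ cs, b.Good) {K q : ℕ}
    (hK : bs.length = K + 1) (h : RowStart (blocksWord bs cs) K q) :
    ∃ b ∈ cs, BlockAt (blocksWord bs cs) q b := by
  obtain ⟨h1, h2⟩ := h
  rcases bra_of_blocksWord hbs hcs h1 with ⟨l, b, r, rfl, -, h3⟩ | ⟨l, b, r, rfl, h4, -⟩
  · rw [h3] at h2
    simp at hK
    omega
  · exact ⟨b, by simp, h4⟩

theorem exists_rowStart (hbs : ∀ b ∈ bs, b.Good) (hcs : ∀ b ∈ cs, b.Good) {K : ℕ}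
    (hK : bs.length = K + 1) {b : Block} (hb : b ∈ cs) :
    ∃ q, RowStart (blocksWord bs cs) K q ∧ BlockAt (blocksWord bs cs) q b := by
  obtain ⟨l, r, rfl⟩ := List.append_of_mem hb
  have hblock : BlockAt (blocksWord bs (l ++ b :: r)) _ b :=
    ⟨_, _, blocksWord_right bs l b r, rfl⟩
  refine ⟨_, ⟨hblock.bra, ?_⟩, hblock⟩
  rw [blocksWord_right, numPos_kets, List.count_append, List.count_cons,
    count_flatMap_word hbs, count_flatMap_word fun b hb => hcs b (by simp [hb])]
  omega

theorem numPos_le {w : List Γ'} {α : ℕ} (h : α < w.length) :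
    (numPos w fun x => ¬ α < x) = α + 1 := by
  rw [numPos_Ico (a := 0) (b := α + 1) (by omega) fun x _ => by omega]
  omega

/-- For attribute `a` the position is `α = a + 1`, and the index `α + 1` accounts for the two
attribute sets in front of the domains. -/
theorem DomStart.blockAt (hbs : ∀ b ∈ bs, b.Good) (hcs : ∀ b ∈ cs, b.Good) {α q : ℕ}
    (hα : α < (blocksWord bs cs).length) {b : Block} (hb : bs[α + 1]? = some b)
    (h : DomStart (blocksWord bs cs) α q) : BlockAt (blocksWord bs cs) q b := by
  obtain ⟨h1, h2⟩ := h
  have hlt : α + 1 < bs.length := (List.getElem?_eq_some_iff.1 hb).1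
  rw [numPos_le hα] at h2
  rcases bra_of_blocksWord hbs hcs h1 with ⟨l, b', r, rfl, h3, h4⟩ | ⟨l, b', r, rfl, -, h4⟩
  · rw [h4] at h2
    rw [List.getElem?_append_right (by omega), h2] at hb
    simp at hb
    exact hb ▸ h3
  · omega

theorem exists_domStart (hbs : ∀ b ∈ bs, b.Good) {α : ℕ}
    (hα : α < (blocksWord bs cs).length) {b : Block} (hb : bs[α + 1]? = some b) :
    ∃ q, DomStart (blocksWord bs cs) α q ∧ BlockAt (blocksWord bs cs) q b := by
  obtain ⟨hlt, rfl⟩ := List.getElem?_eq_some_iff.1 hb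
  have hsplit : bs = bs.take (α + 1) ++ bs[α + 1] :: bs.drop (α + 1 + 1) := by
    rw [← List.drop_eq_getElem_cons hlt, List.take_append_drop]
  have hw : blocksWord bs cs = (bs.take (α + 1)).flatMap Block.word ++ (bs[α + 1].word ++
      ((bs.drop (α + 1 + 1)).flatMap Block.word ++ Γ'.comma :: cs.flatMap Block.word)) := by
    rw [← blocksWord_left, ← hsplit]
  have hblock : BlockAt (blocksWord bs cs) _ bs[α + 1] := ⟨_, _, hw, rfl⟩
  refine ⟨_, ⟨hblock.bra, ?_⟩, hblock⟩
  rw [numPos_le hα, hw, numPos_kets,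
    count_flatMap_word fun b hb => hbs b (List.mem_of_mem_take hb), List.length_take]
  omega

end Blocks

/-- Before the first closing bracket the only possible delimiters are the commas that end fields. -/
theorem delim_split {fs : List (List Γ')} {m post : List Γ'} (hfs : ∀ f ∈ fs, ∀ c ∈ f, Plain c)
    (hm : ∀ c ∈ m, Plain c) {l : ℕ}
    (hl : (fieldsWord fs ++ (m ++ Γ'.ket :: post))[l]? = some Γ'.bra ∨
      (fieldsWord fs ++ (m ++ Γ'.ket :: post))[l]? = some Γ'.comma)
    (hk : ∀ x < l, ¬ (fieldsWord fs ++ (m ++ Γ'.ket :: post))[x]? = some Γ'.ket) :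
    ∃ f₁ f₂, fs = f₁ ++ f₂ ∧ l + 1 = (fieldsWord f₁).length := by
  have hplain : ∀ (s t : List Γ'), (∀ c ∈ s, Plain c) → ∀ k, k < s.length →
      ¬ ((s ++ t)[k]? = some Γ'.bra ∨ (s ++ t)[k]? = some Γ'.comma) := by
    intro s t hs k hk h
    rw [List.getElem?_append_left hk] at h
    rcases h with h | h
    · exact (hs _ (List.mem_of_getElem? h)).1 rfl
    · exact (hs _ (List.mem_of_getElem? h)).2.2 rfl
  induction fs generalizing l with
  | nil =>
    exfalso
    have e : fieldsWord [] ++ (m ++ Γ'.ket :: post) = m ++ Γ'.ket :: post := rfl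
    rw [e] at hl hk
    rcases lt_trichotomy l m.length with h | h | h
    · exact hplain _ _ hm l h hl
    · subst h
      simp at hl
    · exact hk _ h (by simp)
  | cons f fs ih =>
    have e : fieldsWord (f :: fs) ++ (m ++ Γ'.ket :: post) =
        f ++ Γ'.comma :: (fieldsWord fs ++ (m ++ Γ'.ket :: post)) := by
      simp [fieldsWord_cons]
    rw [e] at hl hk
    rcases lt_trichotomy l f.length with h | h | h
    · exact absurd hl (hplain _ _ (hfs f (by simp)) l h)
    · exact ⟨[f], fs, rfl, by simp [fieldsWord, h]⟩
    · obtain ⟨k, rfl⟩ : ∃ k, l = f.length + (k + 1) := ⟨l - f.length - 1, by omega⟩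
      have e' : ∀ x, (f ++ Γ'.comma :: (fieldsWord fs ++ (m ++ Γ'.ket :: post)))[f.length +
          (x + 1)]? = (fieldsWord fs ++ (m ++ Γ'.ket :: post))[x]? := by
        intro x
        rw [List.getElem?_append_right (by omega)]
        simp
      rw [e'] at hl
      obtain ⟨f₁, f₂, rfl, h2⟩ := ih (fun f hf => hfs f (by simp [hf])) hl fun x hx => by
        rw [← e']
        exact hk _ (by omega)
      refine ⟨f :: f₁, f₂, rfl, ?_⟩
      rw [fieldsWord_cons, List.length_append, List.length_cons]
      omega

theorem exists_bra_fieldsWord_eq (fs : List (List Γ')) :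
    ∃ s c, Γ'.bra :: fieldsWord fs = s ++ [c] ∧ (c = Γ'.bra ∨ c = Γ'.comma) := by
  rcases fs.eq_nil_or_concat with rfl | ⟨fs, f, rfl⟩
  · exact ⟨[], Γ'.bra, rfl, Or.inl rfl⟩
  · refine ⟨Γ'.bra :: (fieldsWord fs ++ f), Γ'.comma, ?_, Or.inr rfl⟩
    simp [fieldsWord]

/-- The delimiters in a block correspond to the splittings of its list of fields. -/
theorem BlockAt.fieldNo_iff {w : List Γ'} {q : ℕ} {b : Block} (h : BlockAt w q b) (hb : b.Good)
    {j δ : ℕ} :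
    FieldNo w q j δ ↔ ∃ f₁ f₂, b.1 = f₁ ++ f₂ ∧ δ = q + (fieldsWord f₁).length ∧
      j = f₁.length + 1 := by
  obtain ⟨pre, post, hw, rfl⟩ := h
  have hw' : ∀ f₁ f₂, b.1 = f₁ ++ f₂ → w = pre ++ ((Γ'.bra :: fieldsWord f₁) ++
      (fieldsWord f₂ ++ (b.2 ++ Γ'.ket :: post))) := by
    intro f₁ f₂ hf
    rw [hw, Block.word, hf, fieldsWord_append]
    simp
  have hseg : ∀ f₁ f₂, b.1 = f₁ ++ f₂ → ∀ k (hk : k < (Γ'.bra :: fieldsWord f₁).length),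
      w[pre.length + k]? = some (Γ'.bra :: fieldsWord f₁)[k] := by
    intro f₁ f₂ hf k hk
    rw [hw' f₁ f₂ hf, List.getElem?_append_right (by omega), Nat.add_sub_cancel_left,
      List.getElem?_append_left hk, List.getElem?_eq_getElem hk]
  have hcount : ∀ f₁ f₂, b.1 = f₁ ++ f₂ →
      (numPos w fun x => ¬ x < pre.length ∧ ¬ pre.length + (fieldsWord f₁).length < x ∧
        Delim w x) = f₁.length + 1 := by
    intro f₁ f₂ hf
    have h1 := numPos_segment (u := pre) (s := Γ'.bra :: fieldsWord f₁)
      (t := fieldsWord f₂ ++ (b.2 ++ Γ'.ket :: post))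
      (P := fun x => ¬ x < pre.length ∧ ¬ pre.length + (fieldsWord f₁).length < x ∧ Delim w x)
      (fun c => c == Γ'.bra || c == Γ'.comma)
      (fun x hx => ⟨by omega, by simp; omega⟩) (fun k hk => by
        have h2 := hseg f₁ f₂ hf k hk
        simp only [List.length_cons] at hk
        simp only [Delim, h2, Option.some.injEq, Bool.or_eq_true, beq_iff_eq]
        refine ⟨fun h => h.2.2, fun h => ⟨by omega, by omega, h⟩⟩)
    rw [← hw' f₁ f₂ hf] at h1
    rw [h1, List.countP_cons]
    have hgood : ∀ f ∈ f₁, ∀ c ∈ f, Plain c := fun f hf' => hb.1 f (by simp [hf, hf'])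
    have h3 : ∀ fs : List (List Γ'), (∀ f ∈ fs, ∀ c ∈ f, Plain c) →
        (fieldsWord fs).countP (fun c => c == Γ'.bra || c == Γ'.comma) = fs.length := by
      intro fs
      induction fs with
      | nil => intro _; rfl
      | cons f fs ih =>
        intro hfs
        have h4 : f.countP (fun c => c == Γ'.bra || c == Γ'.comma) = 0 := by
          rw [List.countP_eq_zero]
          intro c hc
          have := hfs f (by simp) c hc
          simp [this.1, this.2.2]
        rw [fieldsWord_cons, List.countP_append, List.countP_cons, h4,
          ih fun f hf => hfs f (by simp [hf])]
        simp
    rw [h3 _ hgood]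
    simp
  constructor
  · rintro ⟨⟨h1, h2, h3⟩, h4⟩
    have key : ∃ f₁ f₂, b.1 = f₁ ++ f₂ ∧ δ = pre.length + (fieldsWord f₁).length := by
      -- The opening bracket delimits the first field; every later delimiter is a comma.
      rcases Nat.eq_or_lt_of_le (not_lt.1 h1) with heq | hlt
      · exact ⟨[], b.1, rfl, by simp [← heq, fieldsWord]⟩
      · obtain ⟨l, rfl⟩ : ∃ l, δ = pre.length + (l + 1) := ⟨δ - pre.length - 1, by omega⟩
        have e : ∀ x, w[pre.length + (x + 1)]? =
            (fieldsWord b.1 ++ (b.2 ++ Γ'.ket :: post))[x]? := by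
          intro x
          rw [hw' [] b.1 rfl, List.getElem?_append_right (by omega), Nat.add_sub_cancel_left]
          simp [fieldsWord]
        have hδ : pre.length + (l + 1) < w.length := by
          rcases h2 with h2 | h2 <;> exact (List.getElem?_eq_some_iff.1 h2).1
        obtain ⟨f₁, f₂, h5, h6⟩ := delim_split (post := post) (l := l) hb.1 hb.2
          (by rw [← e]; exact h2) (fun x hx => by
            rw [← e]
            exact h3 _ (by omega) (by omega) (by omega))
        exact ⟨f₁, f₂, h5, by omega⟩
    obtain ⟨f₁, f₂, h5, rfl⟩ := key
    exact ⟨f₁, f₂, h5, rfl, by rw [← h4, hcount f₁ f₂ h5]⟩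
  · rintro ⟨f₁, f₂, hf, rfl, rfl⟩
    refine ⟨⟨by omega, ?_, ?_⟩, hcount f₁ f₂ hf⟩
    · obtain ⟨s, c, h1, h2⟩ := exists_bra_fieldsWord_eq f₁
      have h3 := hseg f₁ f₂ hf (fieldsWord f₁).length (by simp)
      have h4 : (fieldsWord f₁).length = s.length := by
        have := congrArg List.length h1
        simpa using this
      have h5 : (Γ'.bra :: fieldsWord f₁)[(fieldsWord f₁).length]'(by simp) = c := by
        have : (Γ'.bra :: fieldsWord f₁)[(fieldsWord f₁).length]? = some c := by
          rw [h1, h4]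
          simp
        exact (List.getElem?_eq_some_iff.1 this).2
      rw [h5] at h3
      unfold Delim
      rw [h3]
      simpa using h2
    · intro x _ h1 h2 h3
      obtain ⟨k, rfl⟩ : ∃ k, x = pre.length + k := ⟨x - pre.length, by omega⟩
      rw [hseg f₁ f₂ hf k (by simp; omega)] at h3
      have hmem : Γ'.ket ∈ Γ'.bra :: fieldsWord f₁ := by
        rw [← Option.some.inj h3]
        exact List.getElem_mem _
      have hgood : ∀ f ∈ f₁, ∀ c ∈ f, Plain c := fun f hf' => hb.1 f (by simp [hf, hf'])
      rcases List.mem_cons.1 hmem with h | h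
      · cases h
      · exact (mem_fieldsWord hgood h).2 rfl

theorem BlockAt.drop_eq {w : List Γ'} {q : ℕ} {b : Block} (h : BlockAt w q b)
    {f₁ f₂ : List (List Γ')} (hf : b.1 = f₁ ++ f₂) :
    ∃ post, w.drop (q + (fieldsWord f₁).length + 1) =
      fieldsWord f₂ ++ (b.2 ++ Γ'.ket :: post) := by
  obtain ⟨pre, post, hw, rfl⟩ := h
  refine ⟨post, ?_⟩
  have hw' : w = (pre ++ Γ'.bra :: fieldsWord f₁) ++
      (fieldsWord f₂ ++ (b.2 ++ Γ'.ket :: post)) := by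
    rw [hw, Block.word, hf, fieldsWord_append]
    simp
  rw [hw', List.drop_left' (by simp; omega)]

/-- The fields of a block, one by one. -/
theorem BlockAt.fieldNo_field {w : List Γ'} {q : ℕ} {b : Block} (h : BlockAt w q b)
    (hb : b.Good) {a : ℕ} {f : List Γ'} (hf : b.1[a]? = some f) :
    (∃ δ < w.length, FieldNo w q (a + 1) δ) ∧
      ∀ δ, FieldNo w q (a + 1) δ → ∃ r, w.drop (δ + 1) = f ++ Γ'.comma :: r := by
  obtain ⟨hlt, rfl⟩ := List.getElem?_eq_some_iff.1 hf
  constructor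
  · have hsplit : b.1 = b.1.take a ++ b.1.drop a := (List.take_append_drop _ _).symm
    have hδ := (h.fieldNo_iff hb).2 ⟨_, _, hsplit, rfl, rfl⟩
    refine ⟨_, ?_, by rwa [List.length_take_of_le hlt.le] at hδ⟩
    rcases hδ.1.2.1 with h2 | h2 <;> exact (List.getElem?_eq_some_iff.1 h2).1
  · intro δ hδ
    obtain ⟨f₁, f₂, h1, rfl, h2⟩ := (h.fieldNo_iff hb).1 hδ
    obtain ⟨post, h3⟩ := h.drop_eq h1
    obtain rfl : a = f₁.length := by omega
    have h4 : f₂ = b.1[f₁.length] :: f₂.tail := by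
      cases f₂ with
      | nil => simp [h1] at hlt
      | cons g f₂ => simp [h1]
    rw [h3]
    refine ⟨fieldsWord f₂.tail ++ (b.2 ++ Γ'.ket :: post), ?_⟩
    conv_lhs => rw [h4]
    rw [fieldsWord_cons]
    simp

/-- The part of a block after the fields. -/
theorem BlockAt.fieldNo_last {w : List Γ'} {q : ℕ} {b : Block} (h : BlockAt w q b)
    (hb : b.Good) :
    (∃ δ < w.length, FieldNo w q (b.1.length + 1) δ) ∧
      ∀ δ, FieldNo w q (b.1.length + 1) δ → ∃ r, w.drop (δ + 1) = b.2 ++ Γ'.ket :: r := by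
  constructor
  · have hδ := (h.fieldNo_iff hb).2 ⟨b.1, [], by simp, rfl, rfl⟩
    refine ⟨_, ?_, hδ⟩
    rcases hδ.1.2.1 with h2 | h2 <;> exact (List.getElem?_eq_some_iff.1 h2).1
  · intro δ hδ
    obtain ⟨f₁, f₂, h1, rfl, h2⟩ := (h.fieldNo_iff hb).1 hδ
    obtain ⟨post, h3⟩ := h.drop_eq h1
    have h4 : f₂ = [] := by
      have := congrArg List.length h1
      simp at this
      exact List.eq_nil_of_length_eq_zero (by omega)
    subst h4
    exact ⟨post, by rw [h3]; rfl⟩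

/-- The fields of a block, all at once. -/
theorem BlockAt.fieldAt_iff {w : List Γ'} {q : ℕ} {b : Block} (h : BlockAt w q b) (hb : b.Good)
    {P : ℕ → Prop} {Q : List Γ' → Prop} (hlast : b.2 = [])
    (hPQ : ∀ f ∈ b.1, ∀ δ < w.length, (∃ r, w.drop (δ + 1) = f ++ Γ'.comma :: r) → (P δ ↔ Q f)) :
    (∀ δ < w.length, FieldAt w q δ ∧ ¬ NextIs w δ Γ'.ket → P δ) ↔ ∀ f ∈ b.1, Q f := by
  constructor
  · intro H f hf
    obtain ⟨a, ha⟩ := List.getElem?_of_mem hf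
    obtain ⟨⟨δ, hδ, h1⟩, h2⟩ := h.fieldNo_field hb ha
    obtain ⟨r, hr⟩ := h2 δ h1
    refine (hPQ f hf δ hδ ⟨r, hr⟩).1 (H δ hδ ⟨h1.1, ?_⟩)
    rw [nextIs_iff]
    have h3 := getElem?_of_drop hr 0
    rw [Nat.add_zero] at h3
    rw [h3]
    -- An empty field, such as the code of `0`, still shows its comma and is not mistaken for the
    -- end of the block.
    cases f with
    | nil => simp
    | cons c f =>
      have := (hb.1 _ hf c (by simp)).2.1
      simpa using this
  · rintro H δ hδ ⟨h1, h2⟩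
    obtain ⟨f₁, f₂, h3, rfl, h4⟩ := (h.fieldNo_iff hb).1 ⟨h1, rfl⟩
    obtain ⟨post, h5⟩ := h.drop_eq h3
    cases f₂ with
    -- The last comma has no field behind it: since `b.2` is empty, the closing bracket follows at
    -- once.
    | nil =>
      refine absurd ?_ h2
      rw [nextIs_iff]
      have := getElem?_of_drop h5 0
      rw [Nat.add_zero] at this
      rw [this, hlast]
      simp [fieldsWord]
    | cons f f₂ =>
      refine (hPQ f (by simp [h3]) _ hδ ⟨fieldsWord f₂ ++ (b.2 ++ Γ'.ket :: post), ?_⟩).2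
        (H f (by simp [h3]))
      rw [h5, fieldsWord_cons]
      simp

end Words

/-! ### Closure under groundings, one null at a time. -/

section Step

variable {ι : Type v} {V : Type u} [DecidableEq ι]

/-- A local form of `Schema.ContainsGroundings`: on `Z`, each tuple has some complete version, and
its complete versions are closed under changes of the value of a null. -/
theorem Schema.containsGroundings_iff_step {S : Schema ι V} {Z : Finset ι}
    {r : Multiset (Tuple ι V)} (hr : S.IsRelation r) :
    S.ContainsGroundings Z r ↔ ∀ t ∈ r,
      (∃ u ∈ r, (∀ a ∈ Z, u a ≠ none) ∧ ∀ a ∈ Z, t a = none ∨ t a = u a) ∧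
      ∀ u ∈ r, ((∀ a ∈ Z, u a ≠ none) ∧ ∀ a ∈ Z, t a = none ∨ t a = u a) →
        ∀ a ∈ Z, t a = none → ∀ b ∈ S.dom a,
          ∃ u' ∈ r, u' a = some b ∧ ∀ i ∈ Z, i ≠ a → u' i = u i := by
  constructor
  · intro h t ht
    constructor
    · obtain ⟨c, hc, -⟩ := S.exists_avoid t
      obtain ⟨u, hu, h1⟩ := h t ht (fun i => (t i).getD (c i)) fun i _ => by
        cases hi : t i with
        | none => exact ⟨hc i, Or.inl rfl⟩
        | some x => exact ⟨hr t ht i x hi, Or.inr rfl⟩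
      refine ⟨u, hu, fun i hi => by simp [h1 i hi], fun i hi => ?_⟩
      rw [h1 i hi]
      cases t i <;> simp
    · rintro u hu ⟨h1, h2⟩ a ha hta b hb
      obtain ⟨c, hc, -⟩ := S.exists_avoid t
      obtain ⟨u', hu', h3⟩ := h t ht (fun i => if i = a then b else (u i).getD (c i))
        fun i hi => by
          by_cases hia : i = a
          · subst hia
            simpa using ⟨hb, Or.inl hta⟩
          · obtain ⟨x, hx⟩ := Option.ne_none_iff_exists'.1 (h1 i hi)
            have := h2 i hi
            rw [hx] at this
            simpa [hia, hx] using ⟨hr u hu i x hx, this⟩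
      refine ⟨u', hu', by simp [h3 a ha], fun i hi hia => ?_⟩
      obtain ⟨x, hx⟩ := Option.ne_none_iff_exists'.1 (h1 i hi)
      simp [h3 i hi, hia, hx]
  · intro h t ht s hs
    obtain ⟨⟨u₀, hu₀, h1, h2⟩, hstep⟩ := h t ht
    -- From one complete version the nulls of `t` are given their wanted values attribute by
    -- attribute; where `t` has a value, the version agrees with `s` already.
    have key : ∀ D ⊆ Z, ∃ u ∈ r, ((∀ a ∈ Z, u a ≠ none) ∧ ∀ a ∈ Z, t a = none ∨ t a = u a) ∧
        ∀ i ∈ D, u i = some (s i) := by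
      intro D
      induction D using Finset.induction_on with
      | empty => exact fun _ => ⟨u₀, hu₀, ⟨h1, h2⟩, by simp⟩
      | insert a D _ ih =>
        intro hD
        obtain ⟨u, hu, ⟨h3, h4⟩, h5⟩ := ih fun i hi => hD (Finset.mem_insert_of_mem hi)
        have ha : a ∈ Z := hD (Finset.mem_insert_self a D)
        rcases (hs a ha).2 with hta | hta
        · obtain ⟨u', hu', h6, h7⟩ := hstep u hu ⟨h3, h4⟩ a ha hta (s a) (hs a ha).1
          refine ⟨u', hu', ⟨fun i hi => ?_, fun i hi => ?_⟩, fun i hi => ?_⟩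
          · by_cases hia : i = a
            · simp [hia, h6]
            · rw [h7 i hi hia]
              exact h3 i hi
          · by_cases hia : i = a
            · exact Or.inl (hia ▸ hta)
            · rw [h7 i hi hia]
              exact h4 i hi
          · by_cases hia : i = a
            · rw [hia, h6]
            · rw [h7 i (hD hi) hia]
              exact h5 i ((Finset.mem_insert.1 hi).resolve_left hia)
        · refine ⟨u, hu, ⟨h3, h4⟩, fun i hi => ?_⟩
          rcases Finset.mem_insert.1 hi with rfl | hi
          · rw [← hta, ((h4 i ha).resolve_left (by simp [hta]))]
          · exact h5 i hi
    obtain ⟨u, hu, -, h3⟩ := key Z subset_rfl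
    exact ⟨u, hu, h3⟩

end Step

/-! ### The input word as a word of blocks. -/

section Input

open Computability WordFormula

theorem encodeEntry_injective : Function.Injective encodeEntry := by
  have hinj : Function.Injective (List.map Γ'.bit) :=
    List.map_injective_iff.2 fun a b h => by injection h
  have hne : ∀ k, [Γ'.blank] ≠ (encodeNat k).map Γ'.bit := by
    intro k h
    cases hk : encodeNat k <;> simp [hk] at h
  intro a b h
  cases a with
  | none =>
    cases b with
    | none => rfl
    | some b => exact absurd h (hne b)
  | some a =>
    cases b with
    | none => exact absurd h.symm (hne a)
    | some b => rw [← decode_encodeNat a, ← decode_encodeNat b, hinj h]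

theorem plain_of_mem_encodeEntry {e : Option ℕ} {c : Γ'} (h : c ∈ encodeEntry e) : Plain c := by
  cases e with
  | none =>
    rw [encodeEntry, List.mem_singleton] at h
    subst h
    simp [Plain]
  | some k =>
    simp only [encodeEntry, List.mem_map] at h
    obtain ⟨b, -, rfl⟩ := h
    simp [Plain]

theorem plain_of_mem_encode {c : MultCode} {k : ℕ} {x : Γ'} (h : x ∈ c.encode k) : Plain x := by
  cases c with
  | unary =>
    rw [List.eq_of_mem_replicate h]
    simp [Plain]
  | binary =>
    simp only [MultCode.encode, List.mem_map] at h
    obtain ⟨b, -, rfl⟩ := h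
    simp [Plain]

theorem encodePosNum_ne_nil (m : PosNum) : encodePosNum m ≠ [] := by
  cases m <;> simp [encodePosNum]

theorem length_encodePosNum_eq_one {m : PosNum} : (encodePosNum m).length = 1 ↔ m = 1 := by
  cases m with
  | one => simp [encodePosNum]; rfl
  | bit0 m => simp [encodePosNum, encodePosNum_ne_nil]
  | bit1 m => simp [encodePosNum, encodePosNum_ne_nil]

theorem encodeNat_of_pos {k : ℕ} (hk : 0 < k) :
    ∃ m : PosNum, (m : ℕ) = k ∧ encodeNat k = encodePosNum m := by
  have h : ((k : Num) : ℕ) = k := Num.to_of_nat k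
  cases hn : (k : Num) with
  | zero =>
    rw [hn] at h
    exact absurd h (by simpa using hk.ne)
  | pos m =>
    rw [hn] at h
    exact ⟨m, h, by rw [encodeNat, hn]; rfl⟩

theorem MultCode.encode_ne_nil {c : MultCode} {k : ℕ} (hk : 0 < k) : c.encode k ≠ [] := by
  cases c with
  | unary => simpa [MultCode.encode] using hk.ne'
  | binary =>
    obtain ⟨m, -, h⟩ := encodeNat_of_pos hk
    simpa [MultCode.encode, h] using encodePosNum_ne_nil m

/-- This makes one formula serve for unary and for binary multiplicities. -/
theorem MultCode.length_encode_eq_one {c : MultCode} {k : ℕ} (hk : 0 < k) :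
    (c.encode k).length = 1 ↔ k = 1 := by
  cases c with
  | unary => simp [MultCode.encode]
  | binary =>
    obtain ⟨m, rfl, h⟩ := encodeNat_of_pos hk
    rw [MultCode.encode, List.length_map, h, length_encodePosNum_eq_one]
    rw [← PosNum.cast_one (α := ℕ), PosNum.cast_inj]

/-- The block of a row of the input. -/
def rowBlock {n : ℕ} (c : MultCode) (p : Tuple (Fin n) ℕ × ℕ) : Block :=
  ((List.ofFn p.1).map encodeEntry, c.encode p.2)

/-- The block of a list of values. -/
def domBlock (d : List ℕ) : Block := (d.map fun a => encodeEntry (some a), [])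

/-- The blocks of the input in front of the rows. -/
def CIAInput.headBlocks (I : CIAInput) : List Block :=
  ([], encodeAttrs I.X) :: ([], encodeAttrs I.Y) :: (List.ofFn I.dom).map domBlock

theorem CIAInput.encode_eq (I : CIAInput) (c : MultCode) :
    I.encode c = blocksWord I.headBlocks (I.rows.map (rowBlock c)) := by
  simp [CIAInput.encode, blocksWord, headBlocks, Block.word, fieldsWord, List.flatMap_map,
    rowBlock, domBlock, -List.map_ofFn]

theorem rowBlock_good {n : ℕ} (c : MultCode) (p : Tuple (Fin n) ℕ × ℕ) : (rowBlock c p).Good := by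
  refine ⟨fun f hf x hx => ?_, fun x hx => plain_of_mem_encode hx⟩
  obtain ⟨e, -, rfl⟩ := List.mem_map.1 hf
  exact plain_of_mem_encodeEntry hx

theorem domBlock_good (d : List ℕ) : (domBlock d).Good := by
  refine ⟨fun f hf x hx => ?_, fun x hx => absurd hx List.not_mem_nil⟩
  obtain ⟨e, -, rfl⟩ := List.mem_map.1 hf
  exact plain_of_mem_encodeEntry hx

theorem attrs_good {n : ℕ} (X : Finset (Fin n)) : Block.Good ([], encodeAttrs X) := by
  refine ⟨fun f hf => absurd hf List.not_mem_nil, fun x hx => ?_⟩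
  obtain ⟨i, rfl⟩ := List.mem_ofFn.1 hx
  simp [Plain]

theorem CIAInput.headBlocks_good (I : CIAInput) : ∀ b ∈ I.headBlocks, b.Good := by
  intro b hb
  simp only [headBlocks, List.mem_cons, List.mem_map] at hb
  rcases hb with rfl | rfl | ⟨d, -, rfl⟩
  · exact attrs_good _
  · exact attrs_good _
  · exact domBlock_good d

theorem CIAInput.rows_good (I : CIAInput) (c : MultCode) :
    ∀ b ∈ I.rows.map (rowBlock c), b.Good := by
  intro b hb
  obtain ⟨p, -, rfl⟩ := List.mem_map.1 hb
  exact rowBlock_good c p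

theorem CIAInput.length_headBlocks (I : CIAInput) : I.headBlocks.length = I.n + 1 + 1 := by
  simp [headBlocks]

theorem CIAInput.mem_relation {I : CIAInput} {t : Tuple (Fin I.n) ℕ} :
    t ∈ I.relation ↔ ∃ p ∈ I.rows, p.1 = t := by
  have h : ∀ l : List (Tuple (Fin I.n) ℕ × ℕ), (∀ p ∈ l, 0 < p.2) →
      (t ∈ (l.map fun p => Multiset.replicate p.2 p.1).sum ↔ ∃ p ∈ l, p.1 = t) := by
    intro l
    induction l with
    | nil => simp
    | cons p l ih =>
      intro hl
      have hp := (hl p (by simp)).ne'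
      rw [List.map_cons, List.sum_cons, Multiset.mem_add, Multiset.mem_replicate,
        ih fun p hp => hl p (by simp [hp])]
      simp [hp, eq_comm]
  exact h I.rows I.mult_pos

theorem CIAInput.forall_mem_relation {I : CIAInput} {Q : Tuple (Fin I.n) ℕ → Prop} :
    (∀ t ∈ I.relation, Q t) ↔ ∀ p ∈ I.rows, Q p.1 := by
  simp only [mem_relation, forall_exists_index, and_imp, forall_apply_eq_imp_iff₂]

theorem CIAInput.isRelation (I : CIAInput) : I.schema.IsRelation I.relation := by
  unfold Schema.IsRelation
  rw [forall_mem_relation]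
  exact fun p hp i a h => List.mem_toFinset.2 (I.mem_dom p hp i a h)

theorem CIAInput.card_relation_le_one_iff (I : CIAInput) :
    I.relation.card ≤ 1 ↔ ∀ p ∈ I.rows, ∀ p' ∈ I.rows, p.1 = p'.1 ∧ p.2 = 1 := by
  constructor
  · intro h p hp p' hp'
    refine ⟨eq_of_mem_of_card_le_one h (mem_relation.2 ⟨p, hp, rfl⟩)
      (mem_relation.2 ⟨p', hp', rfl⟩), le_antisymm ?_ (I.mult_pos p hp)⟩
    have h1 : Multiset.replicate p.2 p.1 ≤ I.relation := by
      obtain ⟨l, r, h⟩ := List.append_of_mem hp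
      rw [relation, h]
      simp only [List.map_append, List.map_cons, List.sum_append, List.sum_cons]
      exact (Multiset.le_add_right _ _).trans (Multiset.le_add_left _ _)
    have h2 := Multiset.card_le_card h1
    rw [Multiset.card_replicate] at h2
    exact h2.trans h
  · intro h
    have hnd := I.rows_nodup
    rcases hr : I.rows with _ | ⟨p, _ | ⟨p', l⟩⟩
    · simp [relation, hr]
    · rw [hr] at h
      simp [relation, hr, (h p (by simp) p (by simp)).2]
    · rw [hr] at h hnd
      -- Two rows cannot carry the same tuple.
      simp [(h p (by simp) p' (by simp)).1] at hnd

end Input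

/-! ### From predicates on the input word to the relation. -/

section Transfer

open Computability WordFormula

/-- The field with the given number exists and what follows its delimiter is known, so the
quantifier over delimiters disappears. -/
theorem BlockAt.exists_fieldNo_iff {w : List Γ'} {q : ℕ} {b : Block} (h : BlockAt w q b)
    (hb : b.Good) {a : ℕ} {f : List Γ'} (hf : b.1[a]? = some f) {P : ℕ → Prop} {Q : Prop}
    (hPQ : ∀ δ < w.length, ∀ r, w.drop (δ + 1) = f ++ Γ'.comma :: r → (P δ ↔ Q)) :
    (∃ δ < w.length, FieldNo w q (a + 1) δ ∧ P δ) ↔ Q := by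
  obtain ⟨⟨δ, hδ, h1⟩, h2⟩ := h.fieldNo_field hb hf
  constructor
  · rintro ⟨δ, hδ, h3, h4⟩
    obtain ⟨r, hr⟩ := h2 δ h3
    exact (hPQ δ hδ r hr).1 h4
  · intro hQ
    obtain ⟨r, hr⟩ := h2 δ h1
    exact ⟨δ, hδ, h1, (hPQ δ hδ r hr).2 hQ⟩

/-- The tuple `t` is that of the row that begins at `q`. -/
def TupleAt {n : ℕ} (c : MultCode) (w : List Γ') (q : ℕ) (t : Tuple (Fin n) ℕ) : Prop :=
  ∃ k, BlockAt w q (rowBlock c (t, k))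

theorem getElem?_rowBlock {n : ℕ} (c : MultCode) (p : Tuple (Fin n) ℕ × ℕ) (a : Fin n) :
    (rowBlock c p).1[(a : ℕ)]? = some (encodeEntry (p.1 a)) := by
  simp [rowBlock]

theorem comma_notMem_encodeEntry (e : Option ℕ) : Γ'.comma ∉ encodeEntry e :=
  fun h => (plain_of_mem_encodeEntry h).2.2 rfl

section Row

variable {n : ℕ} {c : MultCode} {w : List Γ'} {q q' : ℕ} {t t' : Tuple (Fin n) ℕ}

theorem TupleAt.nullAt_iff (h : TupleAt c w q t) (a : Fin n) :
    NullAt w q (a + 1) ↔ t a = none := by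
  obtain ⟨k, h⟩ := h
  refine h.exists_fieldNo_iff (rowBlock_good c _) (getElem?_rowBlock c _ a) fun δ _ r hr => ?_
  have h0 := getElem?_of_drop hr 0
  rw [Nat.add_zero] at h0
  rw [nextIs_iff, h0]
  change (encodeEntry (t a) ++ Γ'.comma :: r)[0]? = _ ↔ _
  cases t a with
  | none => simp [encodeEntry]
  | some x => cases hx : encodeNat x <;> simp [encodeEntry, hx]

theorem TupleAt.hasValueAt_iff (h : TupleAt c w q t) (a : Fin n) {e : Option ℕ} {ε : ℕ}
    {r : List Γ'} (hε : w.drop (ε + 1) = encodeEntry e ++ Γ'.comma :: r) :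
    HasValueAt w q (a + 1) ε ↔ t a = e := by
  obtain ⟨k, h⟩ := h
  refine h.exists_fieldNo_iff (rowBlock_good c _) (getElem?_rowBlock c _ a) fun δ _ r hr => ?_
  rw [sameField_iff (comma_notMem_encodeEntry _) (comma_notMem_encodeEntry _) hr hε]
  exact encodeEntry_injective.eq_iff

theorem TupleAt.agreeAt_iff (h : TupleAt c w q t) (h' : TupleAt c w q' t') (a : Fin n) :
    AgreeAt w q q' (a + 1) ↔ t a = t' a := by
  obtain ⟨k, h⟩ := h
  obtain ⟨k', h'⟩ := h'
  refine h.exists_fieldNo_iff (rowBlock_good c _) (getElem?_rowBlock c _ a) fun δ _ r hr => ?_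
  refine h'.exists_fieldNo_iff (rowBlock_good c _) (getElem?_rowBlock c _ a) fun ε _ r' hr' => ?_
  rw [sameField_iff (comma_notMem_encodeEntry _) (comma_notMem_encodeEntry _) hr hr']
  exact encodeEntry_injective.eq_iff

/-- The multiplicity stands behind the `n` entries, as field `n + 1`; its code is nonempty, and it
has length one exactly if the closing bracket is the second symbol after the delimiter. -/
theorem singleRow_iff {p : Tuple (Fin n) ℕ × ℕ} (h : BlockAt w q (rowBlock c p)) (hp : 0 < p.2) :
    SingleRow w (n + 1) q ↔ p.2 = 1 := by
  have hlen : (rowBlock c p).1.length = n := by simp [rowBlock]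
  obtain ⟨⟨δ, hδ, h1⟩, h2⟩ := h.fieldNo_last (rowBlock_good c p)
  rw [hlen] at h1 h2
  have key : ∀ ε, FieldNo w q (n + 1) ε → (ClosesAfterOne w ε ↔ p.2 = 1) := by
    intro ε hε
    obtain ⟨r, hr⟩ := h2 ε hε
    rw [closesAfterOne_iff, ← MultCode.length_encode_eq_one (c := c) hp,
      show ε + 2 = ε + 1 + 1 from rfl, getElem?_of_drop hr]
    change (c.encode p.2 ++ Γ'.ket :: r)[1]? = _ ↔ _
    have hne := MultCode.encode_ne_nil (c := c) hp
    have hplain : Γ'.ket ∉ c.encode p.2 := fun h => (plain_of_mem_encode h).2.1 rfl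
    rcases he : c.encode p.2 with _ | ⟨x, _ | ⟨y, l⟩⟩
    · exact absurd he hne
    · simp
    · have : y ≠ Γ'.ket := fun h => hplain (by simp [he, h])
      simp [this]
  exact ⟨fun ⟨ε, _, hε, h3⟩ => (key ε hε).1 h3, fun h3 => ⟨δ, hδ, h1, (key δ h1).2 h3⟩⟩

end Row

section Quantifiers

variable {I : CIAInput} {c : MultCode}

theorem CIAInput.forall_rowStart {P : ℕ → Prop} {Q : Tuple (Fin I.n) ℕ × ℕ → Prop}
    (hPQ : ∀ q, ∀ p ∈ I.rows, BlockAt (I.encode c) q (rowBlock c p) → (P q ↔ Q p)) :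
    (∀ q < (I.encode c).length, RowStart (I.encode c) (I.n + 1) q → P q) ↔
      ∀ p ∈ I.rows, Q p := by
  rw [I.encode_eq c] at *
  constructor
  · intro h p hp
    obtain ⟨q, h1, h2⟩ := exists_rowStart I.headBlocks_good (I.rows_good c) I.length_headBlocks
      (List.mem_map_of_mem hp)
    exact (hPQ q p hp h2).1 (h q h2.lt_length h1)
  · intro h q _ hq
    obtain ⟨b, hb, h1⟩ := hq.exists_blockAt I.headBlocks_good (I.rows_good c) I.length_headBlocks
    obtain ⟨p, hp, rfl⟩ := List.mem_map.1 hb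
    exact (hPQ q p hp h1).2 (h p hp)

theorem CIAInput.forall_tuple {P : ℕ → Prop} {Q : Tuple (Fin I.n) ℕ → Prop}
    (hPQ : ∀ q t, TupleAt c (I.encode c) q t → (P q ↔ Q t)) :
    (∀ q < (I.encode c).length, RowStart (I.encode c) (I.n + 1) q → P q) ↔
      ∀ t ∈ I.relation, Q t := by
  rw [forall_mem_relation]
  exact forall_rowStart fun q p _ h => hPQ q p.1 ⟨p.2, h⟩

theorem CIAInput.exists_tuple {P : ℕ → Prop} {Q : Tuple (Fin I.n) ℕ → Prop}
    (hPQ : ∀ q t, TupleAt c (I.encode c) q t → (P q ↔ Q t)) :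
    (∃ q < (I.encode c).length, RowStart (I.encode c) (I.n + 1) q ∧ P q) ↔
      ∃ t ∈ I.relation, Q t := by
  have := forall_tuple (P := fun q => ¬ P q) (Q := fun t => ¬ Q t)
    fun q t h => not_congr (hPQ q t h)
  simpa using not_congr this

theorem CIAInput.encode_eq_append (I : CIAInput) (c : MultCode) : ∃ s,
    I.encode c = Γ'.bra :: (encodeAttrs I.X ++ Γ'.ket :: Γ'.bra ::
      (encodeAttrs I.Y ++ Γ'.ket :: s)) := by
  simp [CIAInput.encode]

theorem CIAInput.lt_length_encode (I : CIAInput) (c : MultCode) :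
    2 * I.n + 3 < (I.encode c).length := by
  obtain ⟨s, hs⟩ := I.encode_eq_append c
  rw [hs]
  simp [encodeAttrs]
  omega

theorem CIAInput.getElem?_encode_fst (I : CIAInput) (c : MultCode) (a : Fin I.n) :
    (I.encode c)[(a : ℕ) + 1]? = some (Γ'.bit (decide (a ∈ I.X))) := by
  obtain ⟨s, hs⟩ := I.encode_eq_append c
  rw [hs, List.getElem?_cons_succ, List.getElem?_append_left (by simp [encodeAttrs])]
  simp [encodeAttrs]

theorem CIAInput.getElem?_encode_snd (I : CIAInput) (c : MultCode) (a : Fin I.n) :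
    (I.encode c)[(a : ℕ) + 1 + (I.n + 2)]? = some (Γ'.bit (decide (a ∈ I.Y))) := by
  obtain ⟨s, hs⟩ := I.encode_eq_append c
  have hlen : ∀ X : Finset (Fin I.n), (encodeAttrs X).length = I.n := by simp [encodeAttrs]
  have hs' : I.encode c = (Γ'.bra :: (encodeAttrs I.X ++ [Γ'.ket, Γ'.bra])) ++
      (encodeAttrs I.Y ++ Γ'.ket :: s) := by
    rw [hs]
    simp
  have hsub : (a : ℕ) + 1 + (I.n + 2) -
      (Γ'.bra :: (encodeAttrs I.X ++ [Γ'.ket, Γ'.bra])).length = a := by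
    simp [hlen]
    omega
  rw [hs', List.getElem?_append_right (by simp [hlen]), hsub,
    List.getElem?_append_left (by simp [hlen])]
  simp [encodeAttrs]

theorem CIAInput.attrAt_iff {α : ℕ} :
    AttrAt (I.encode c) (I.n + 1) α ↔ ∃ a : Fin I.n, α = a + 1 := by
  constructor
  · rintro ⟨h1, h2⟩
    exact ⟨⟨α - 1, by omega⟩, by simp; omega⟩
  · rintro ⟨a, rfl⟩
    exact ⟨by omega, by omega⟩

theorem CIAInput.fstAt_iff {α : ℕ} :
    FstAt (I.encode c) (I.n + 1) α ↔ ∃ a ∈ I.X, α = a + 1 := by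
  constructor
  · rintro ⟨h1, h2⟩
    obtain ⟨a, rfl⟩ : ∃ a : Fin I.n, α = a + 1 := by
      rw [← attrAt_iff (c := c)]
      refine ⟨h1, ?_⟩
      rintro rfl
      obtain ⟨s, hs⟩ := I.encode_eq_append c
      simp [hs] at h2
    rw [I.getElem?_encode_fst] at h2
    exact ⟨a, by simpa using h2, rfl⟩
  · rintro ⟨a, ha, rfl⟩
    exact ⟨by omega, by simp [I.getElem?_encode_fst, ha]⟩

/-- The bits of an attribute in the two vectors are `n + 2` apart: the common length of the vectors
plus two brackets. This distance is also the number of positions up to the first closing bracket. -/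
theorem CIAInput.sndAt_iff {α : ℕ} :
    SndAt (I.encode c) (I.n + 1) α ↔ ∃ a ∈ I.Y, α = a + 1 := by
  have hlen := I.lt_length_encode c
  have hpos : ∀ y < (I.encode c).length, α < I.n + 1 →
      (((numPos (I.encode c) fun x => ¬ x < α ∧ x < y) =
        numPos (I.encode c) fun x => ¬ I.n + 1 < x) ↔ y = α + (I.n + 2)) := by
    intro y hy hα
    rw [numPos_le (by omega), numPos_Ico (a := α) (b := y) hy.le fun x _ => by omega]
    omega
  constructor
  · rintro ⟨h1, y, hy, h2, h3⟩
    rw [hpos y hy h1] at h2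
    subst h2
    obtain ⟨a, rfl⟩ : ∃ a : Fin I.n, α = a + 1 := by
      rw [← attrAt_iff (c := c)]
      refine ⟨h1, ?_⟩
      -- From `α = 0` the shift would lead to the opening bracket of the second vector, which is not
      -- a bit.
      rintro rfl
      obtain ⟨s, hs⟩ := I.encode_eq_append c
      rw [hs, Nat.zero_add, List.getElem?_cons_succ, List.getElem?_append_right
        (by simp [encodeAttrs])] at h3
      simp [encodeAttrs] at h3
    rw [I.getElem?_encode_snd] at h3
    exact ⟨a, by simpa using h3, rfl⟩
  · rintro ⟨a, ha, rfl⟩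
    refine ⟨by omega, a + 1 + (I.n + 2), by omega, (hpos _ (by omega) (by omega)).2 rfl, ?_⟩
    simp [I.getElem?_encode_snd, ha]

theorem CIAInput.unionAt_iff {α : ℕ} :
    UnionAt (I.encode c) (I.n + 1) α ↔ ∃ a ∈ I.X ∪ I.Y, α = a + 1 := by
  rw [UnionAt, fstAt_iff, sndAt_iff]
  simp only [Finset.mem_union, or_and_right, exists_or]

theorem CIAInput.forall_attr {Z : List Γ' → ℕ → ℕ → Prop} {s : Finset (Fin I.n)}
    (hZ : ∀ α, Z (I.encode c) (I.n + 1) α ↔ ∃ a ∈ s, α = a + 1) {P : ℕ → Prop}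
    {Q : Fin I.n → Prop} (hPQ : ∀ a : Fin I.n, P (a + 1) ↔ Q a) :
    (∀ α < (I.encode c).length, Z (I.encode c) (I.n + 1) α → P α) ↔ ∀ a ∈ s, Q a := by
  have hlen := I.lt_length_encode c
  constructor
  · exact fun h a ha => (hPQ a).1 (h _ (by omega) ((hZ _).2 ⟨a, ha, rfl⟩))
  · rintro h α _ hα
    obtain ⟨a, ha, rfl⟩ := (hZ α).1 hα
    exact (hPQ a).2 (h a ha)

theorem CIAInput.forall_value (a : Fin I.n) {P : ℕ → Prop} {Q : ℕ → Prop}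
    (hPQ : ∀ x δ r, (I.encode c).drop (δ + 1) = encodeEntry (some x) ++ Γ'.comma :: r →
      (P δ ↔ Q x)) :
    (∀ δ < (I.encode c).length, ValueAt (I.encode c) (a + 1) δ → P δ) ↔
      ∀ x ∈ I.schema.dom a, Q x := by
  have hlen := I.lt_length_encode c
  have hb : I.headBlocks[(a : ℕ) + 1 + 1]? = some (domBlock (I.dom a)) := by
    simp [headBlocks]
  have hiff : ∀ q, BlockAt (I.encode c) q (domBlock (I.dom a)) →
      ((∀ δ < (I.encode c).length, FieldAt (I.encode c) q δ ∧ ¬ NextIs (I.encode c) δ Γ'.ket →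
        P δ) ↔ ∀ x ∈ I.schema.dom a, Q x) := by
    intro q hq
    rw [hq.fieldAt_iff (domBlock_good _) (Q := fun f => ∀ x, encodeEntry (some x) = f → Q x) rfl
      fun f hf δ _ ⟨r, hr⟩ => ?_]
    · simp only [domBlock, List.mem_map, forall_exists_index, and_imp, forall_apply_eq_imp_iff₂,
        encodeEntry_injective.eq_iff, Option.some.injEq, CIAInput.schema, List.mem_toFinset,
        forall_eq]
    · obtain ⟨x, -, rfl⟩ := List.mem_map.1 hf
      rw [hPQ x δ r hr]
      simp [encodeEntry_injective.eq_iff]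
  constructor
  · intro h
    obtain ⟨q, h1, h2⟩ : ∃ q, DomStart (I.encode c) (a + 1) q ∧
        BlockAt (I.encode c) q (domBlock (I.dom a)) := by
      rw [I.encode_eq c] at hlen ⊢
      exact exists_domStart I.headBlocks_good (by omega) hb
    exact (hiff q h2).1 fun δ hδ h3 => h δ hδ ⟨q, h2.lt_length, h1, h3⟩
  · rintro h δ hδ ⟨q, _, h1, h2⟩
    refine (hiff q ?_).2 h δ hδ h2
    rw [I.encode_eq c] at h1 hlen ⊢
    exact h1.blockAt I.headBlocks_good (I.rows_good c) (by omega) hb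

theorem CIAInput.constOnWord_iff {Z : List Γ' → ℕ → ℕ → Prop} {s : Finset (Fin I.n)}
    (hZ : ∀ α, Z (I.encode c) (I.n + 1) α ↔ ∃ a ∈ s, α = a + 1) :
    ConstOnWord (I.encode c) (I.n + 1) Z ↔ ConstOn s I.relation := by
  refine or_congr ?_ ?_
  · rw [I.card_relation_le_one_iff]
    refine forall_rowStart fun q p hp h => forall_rowStart fun q' p' hp' h' => and_congr ?_
      (singleRow_iff h (I.mult_pos p hp))
    have h1 : TupleAt c (I.encode c) q p.1 := ⟨p.2, h⟩
    rw [forall_attr (Z := AttrAt) (s := Finset.univ) (by simp [attrAt_iff])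
      fun a => h1.agreeAt_iff ⟨p'.2, h'⟩ a]
    simp [funext_iff]
  · exact forall_tuple fun q t h => forall_tuple fun q' t' h' => forall_attr hZ fun a =>
      and_congr (not_congr (h.nullAt_iff a)) (h.agreeAt_iff h' a)

theorem CIAInput.combinesWord_iff :
    CombinesWord (I.encode c) (I.n + 1) ↔ Combines I.X I.Y I.relation :=
  forall_tuple fun _ _ h => imp_congr
    (forall_attr (fun _ => fstAt_iff) fun a => not_congr (h.nullAt_iff a))
    (forall_tuple fun _ _ h' => imp_congr
      (forall_attr (fun _ => sndAt_iff) fun a => not_congr (h'.nullAt_iff a))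
      (exists_tuple fun _ _ hu => and_congr
        (forall_attr (fun _ => fstAt_iff) fun a => hu.agreeAt_iff h a)
        (forall_attr (fun _ => sndAt_iff) fun a => hu.agreeAt_iff h' a)))

theorem CIAInput.compatibleWord_iff {q q' : ℕ} {t u : Tuple (Fin I.n) ℕ}
    (h : TupleAt c (I.encode c) q t) (h' : TupleAt c (I.encode c) q' u) :
    CompatibleWord (I.encode c) (I.n + 1) q q' ↔
      (∀ a ∈ I.X ∪ I.Y, u a ≠ none) ∧ ∀ a ∈ I.X ∪ I.Y, t a = none ∨ t a = u a :=
  and_congr (forall_attr (fun _ => unionAt_iff) fun a => not_congr (h'.nullAt_iff a))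
    (forall_attr (fun _ => unionAt_iff) fun a => or_congr (h.nullAt_iff a) (h.agreeAt_iff h' a))

theorem CIAInput.containsGroundingsWord_iff :
    ContainsGroundingsWord (I.encode c) (I.n + 1) ↔
      I.schema.ContainsGroundings (I.X ∪ I.Y) I.relation := by
  rw [Schema.containsGroundings_iff_step I.isRelation]
  exact forall_tuple fun _ _ h => and_congr
    (exists_tuple fun _ _ hu => compatibleWord_iff h hu)
    (forall_tuple fun _ _ hu => imp_congr (compatibleWord_iff h hu)
      (forall_attr (fun _ => unionAt_iff) fun a => imp_congr (h.nullAt_iff a)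
        (forall_value a fun _ _ _ hx => exists_tuple fun _ _ hu' => and_congr
          (hu'.hasValueAt_iff a hx) (forall_attr (fun _ => unionAt_iff) fun b => imp_congr
            (by simp [Fin.ext_iff]) (hu'.agreeAt_iff hu b)))))

/-- The first closing bracket ends the vector of `I.X`, so the formula recovers `n` from the word
itself. -/
theorem CIAInput.satCIAWord_iff (I : CIAInput) (c : MultCode) :
    SatCIAWord (I.encode c) ↔ I.schema.SatCIA I.X I.Y I.relation := by
  have hket : ∀ K, ((I.encode c)[K]? = some Γ'.ket ∧
      ∀ x < (I.encode c).length, x < K → ¬ (I.encode c)[x]? = some Γ'.ket) ↔ K = I.n + 1 := by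
    obtain ⟨s, hs⟩ := I.encode_eq_append c
    have h1 : (I.encode c)[I.n + 1]? = some Γ'.ket := by
      rw [hs, List.getElem?_cons_succ, List.getElem?_append_right (by simp [encodeAttrs])]
      simp [encodeAttrs]
    have h2 : ∀ x < I.n + 1, ¬ (I.encode c)[x]? = some Γ'.ket := by
      intro x hx h
      rcases x with _ | x
      · simp [hs] at h
      · rw [I.getElem?_encode_fst c ⟨x, by omega⟩] at h
        simp at h
    intro K
    constructor
    · rintro ⟨h3, h4⟩
      refine le_antisymm ?_ ?_
      · by_contra hlt
        exact h4 (I.n + 1) (List.getElem?_eq_some_iff.1 h1).1 (by omega) h1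
      · by_contra hlt
        exact h2 K (by omega) h3
    · rintro rfl
      exact ⟨h1, fun x _ => h2 x⟩
  have hlen := I.lt_length_encode c
  rw [Schema.satCIA_iff I.isRelation, ← constOnWord_iff (c := c) fun _ => fstAt_iff,
    ← constOnWord_iff (c := c) fun _ => sndAt_iff, ← combinesWord_iff (c := c),
    ← containsGroundingsWord_iff (c := c)]
  constructor
  · rintro ⟨K, _, h1, h2, h3⟩
    obtain rfl := (hket K).1 ⟨h1, h2⟩
    exact h3
  · intro h
    obtain ⟨h1, h2⟩ := (hket _).2 rfl
    exact ⟨_, by omega, h1, h2, h⟩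

end Quantifiers

end Transfer

end IncompleteRel

/-! ### The theorem. -/

theorem mainTheorem6 :
    -- the characterisation of certain independence
    (∀ (n : ℕ) (V : Type u) (S : IncompleteRel.Schema (Fin n) V) (X Y : Finset (Fin n))
      (r : Multiset (IncompleteRel.Tuple (Fin n) V)), S.IsRelation r →
      (S.SatCIA X Y r ↔
        S.SatCIA X X r ∨ S.SatCIA Y Y r ∨
          ((∀ t ∈ IncompleteRel.proj X r, t.IsComplete →
              ∀ t' ∈ IncompleteRel.proj Y r, t'.IsComplete →
                ∃ t'' ∈ r, t''.proj X = t ∧ t''.proj Y = t') ∧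
            ∀ g, (S.restrict (X ∪ Y)).Grounding (IncompleteRel.proj (X ∪ Y) r) g →
              ∀ s ∈ g, s ∈ IncompleteRel.proj (X ∪ Y) r))) ∧
    -- the data complexity problem for independence atoms is in FO
    (∀ (n : ℕ) (X Y : Finset (Fin n)),
      IncompleteRel.InFO.{u} (n := n) fun _ r => IncompleteRel.SatIA X Y r) ∧
    -- the data complexity problem for certain independence atoms is in FO
    (∀ (n : ℕ) (X Y : Finset (Fin n)),
      IncompleteRel.InFO.{u} (n := n) fun S r => S.SatCIA X Y r) ∧
    -- the combined complexity problem for certain independence atoms is in polynomial time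
    (∀ c : IncompleteRel.MultCode,
      Nonempty (Turing.TM2ComputableInPolyTime (IncompleteRel.CIAInput.encode c)
        Computability.encodeBool IncompleteRel.CIAInput.answer)) := by
  refine ⟨fun n V S X Y r hr => ?_, fun n X Y => IncompleteRel.satIA_inFO X Y,
    fun n X Y => IncompleteRel.satCIA_inFO X Y, fun c =>
      IncompleteRel.Definable.satCIAWord.nonempty_computableInPolyTime _ _ fun I => ?_⟩
  · rw [IncompleteRel.Schema.satCIA_iff hr, IncompleteRel.Schema.satCIA_self_iff hr,
      IncompleteRel.Schema.satCIA_self_iff hr, IncompleteRel.combines_iff,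
      IncompleteRel.Schema.containsGroundings_iff hr]
  · simp only [IncompleteRel.CIAInput.answer, decide_eq_true_eq, I.satCIAWord_iff c]
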